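/- Let $\{R_1(u),\dots,R_n(u)\}$ be a $C^1$ frame (linearly independent $C^1$ vector fields) on an open set $\Omega\subset\mathbb R^n$ which is rich, i.e. $[R_i,R_j]\in\operatorname{span}\{R_i,R_j\}$ for all $i,j$. Let $\rho=(w^1,\dots,w^n)$ be a $C^1$ change of coordinates from an open subset of $\Omega$ onto an open subset of $\mathbb R^n$ (Riemann invariants) for which the frame is normalized, $\nabla w^i\cdot R_j\equiv\delta^i_j$, and let $\bar w$ be a point in the range of $\rho$. With $L=[R_1|\cdots|R_n]^{-1}$ and $L^k$ its $k$-th row, put $Z^k_{ij}(w)=\big(L^k (DR_j) R_i\big)\circ\rho^{-1}(w)$. The $\lambda$-system for $\kappa=(\kappa^1,\dots,\kappa^n)(w)$ is $$\partial_i\kappa^j=Z^j_{ji}(\kappa^i-\kappa^j)\quad (i\ne j),\qquad Z^k_{ij}(\kappa^j-\kappa^i)=0\quad (i<j,\ k\notin\{i,j\}),\qquad \partial_i=\partial/\partial w^i .$$ A local solution is a $C^1$ solution on some open neighbourhood of $\bar w$; the system is said to impose $\kappa^i=\kappa^j$ if every local solution satisfies $\kappa^i=\kappa^j$ near $\bar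 w$. Assume that each of the following functions either vanishes identically near $\bar w$ or is nonzero on a dense subset of some neighbourhood of $\bar w$: the functions $Z^k_{ij}$ with $i,j,k$ distinct, and the functions $Z^j_{ji}-Z^k_{ki}$ with $i,j,k$ distinct and such that $\kappa^j=\kappa^k$ is imposed. (This is automatic for real-analytic frames.) Assume also that for at least one triple of distinct $i,j,k$ the function $Z^k_{ij}$ does not vanish identically near $\bar w$. Then there are $s_0\ge1$ and pairwise disjoint sets $A_1,\dots,A_{s_0}\subset\{1,\dots,n\}$, each of cardinality at least two, such that for $i\neq j$ the $\lambda$-system imposes $\kappa^i=\kappa^j$ if and only if $i,j\in A_\alpha$ for some $\alpha$. Let $s_1=n-\sum_\alpha|A_\alpha|$. Moreover: 1. Given functions $\varphi^i$ of one variable, $C^1$ near $\bar w^i$, one for each of the $s_1$ indices $i\notin\bigcup_\alpha A_\alpha$, and constants $\hat h^1,\dots,\hat h^{s_0}$, there is a local solution $\kappa$ of the $\lambda$-system with $$\kappa^i(\bar w^1,\dots,\bar w^{i-1},w^i,\bar w^{i+1},\dots,\bar w^n)=\varphi^i(w^i)\ \text{ for $w^i$ near $\bar w^i$, if } i\notin\textstyle\bigcup_\alpha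 A_\alpha,\qquad \kappa^i(\bar w)=\hat h^\alpha\ \text{ if } i\in A_\alpha,$$ and any two such local solutions agree near $\bar w$. 2. Every local solution satisfies $\partial_i\kappa^j=0$ near $\bar w$ whenever $i,j\in A_\alpha$ for some $\alpha$; that is, the common value $h^\alpha$ of the $\kappa^j$, $j\in A_\alpha$, does not depend on the coordinates $w^i$ with $i\in A_\alpha$. 3. Say that $\kappa^i$ is simple at $w$ if $\kappa^j(w)\ne\kappa^i(w)$ for all $j\neq i$, and call a value taken by at least two of the $\kappa^i(w)$ a non-simple eigenvalue at $w$. For every local solution, at every $w$ near $\bar w$, there are at most $s_1$ simple eigenvalues, and if there are exactly $s_1$ of them then there are at most $s_0$ distinct non-simple eigenvalues. Some local solution has exactly $s_1$ simple and exactly $s_0$ distinct non-simple eigenvalues at every point near $\bar w$. -/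

import Mathlib

open Filter Topology

noncomputable section

/-- `R 1, …, R n` is a `C¹` frame of vector fields on the set `Ω ⊆ ℝⁿ`. -/
structure IsC1FrameOn {n : ℕ} (R : Fin n → (Fin n → ℝ) → (Fin n → ℝ))
    (Ω : Set (Fin n → ℝ)) : Prop where
  contDiffOn : ∀ i, ContDiffOn ℝ 1 (R i) Ω
  linearIndependent : ∀ u ∈ Ω, LinearIndependent ℝ (fun i => R i u)

/-- Richness: each pair of vector fields is in involution. -/
def IsRichOn {n : ℕ} (R : Fin n → (Fin n → ℝ) → (Fin n → ℝ))
    (Ω : Set (Fin n → ℝ)) : Prop :=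
  ∀ u ∈ Ω, ∀ i j,
    VectorField.lieBracket ℝ (R i) (R j) u ∈ Submodule.span ℝ {R i u, R j u}

/-- `ρ = (w¹, …, wⁿ)` is a `C¹` system of coordinates on an open set `ρ.source ⊆ Ω` consisting of
Riemann invariants of the frame `R`, and `R` is normalized to it: `∇wⁱ · R_j = δⁱ_j`.
(The inverse `ρ.symm` is then `C¹` as well, by the inverse function theorem.) -/
structure IsNormalizedRiemannInvariants {n : ℕ} (R : Fin n → (Fin n → ℝ) → (Fin n → ℝ))
    (Ω : Set (Fin n → ℝ)) (ρ : OpenPartialHomeomorph (Fin n → ℝ) (Fin n → ℝ)) : Prop where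
  source_subset : ρ.source ⊆ Ω
  contDiffOn : ContDiffOn ℝ 1 ρ ρ.source
  normalized : ∀ u ∈ ρ.source, ∀ i j,
    fderiv ℝ (fun v => ρ v i) u (R j u) = if i = j then 1 else 0

/-- The matrix `[R_1(u) | ⋯ | R_n(u)]` with columns `R_i(u)`. -/
def frameMatrix {n : ℕ} (R : Fin n → (Fin n → ℝ) → (Fin n → ℝ)) (u : Fin n → ℝ) :
    Matrix (Fin n) (Fin n) ℝ :=
  Matrix.of fun m i => R i u m

/-- The connection coefficient `Γ^k_{ij}(u) = L^k (D R_j) R_i`, where `L = R⁻¹`. -/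
def christoffel {n : ℕ} (R : Fin n → (Fin n → ℝ) → (Fin n → ℝ)) (k i j : Fin n)
    (u : Fin n → ℝ) : ℝ :=
  ((frameMatrix R u)⁻¹.mulVec (fderiv ℝ (R j) u (R i u))) k

/-- The connection coefficient in Riemann invariants, `Z^k_{ij} = Γ^k_{ij} ∘ ρ⁻¹`
(meaningful on `ρ.target`). The arguments are in the order `k i j`. -/
def connZ {n : ℕ} (R : Fin n → (Fin n → ℝ) → (Fin n → ℝ))
    (ρ : OpenPartialHomeomorph (Fin n → ℝ) (Fin n → ℝ)) (k i j : Fin n) (w : Fin n → ℝ) : ℝ :=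
  christoffel R k i j (ρ.symm w)

/-- The partial derivative `∂f/∂wⁱ`. -/
def partialD {n : ℕ} (i : Fin n) (f : (Fin n → ℝ) → ℝ) (w : Fin n → ℝ) : ℝ :=
  fderiv ℝ f w (Pi.single i 1)

/-- `κ = (κ¹, …, κⁿ)` is a `C¹` solution on `U` of the `λ`-system with coefficients
`Z k i j = Z^k_{ij}`. -/
structure IsLambdaSolutionOn {n : ℕ} (Z : Fin n → Fin n → Fin n → (Fin n → ℝ) → ℝ)
    (U : Set (Fin n → ℝ)) (κ : Fin n → (Fin n → ℝ) → ℝ) : Prop where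
  contDiffOn : ∀ j, ContDiffOn ℝ 1 (κ j) U
  differential : ∀ i j, i ≠ j → ∀ w ∈ U,
    partialD i (κ j) w = Z j j i w * (κ i w - κ j w)
  algebraic : ∀ i j k, i < j → k ≠ i → k ≠ j → ∀ w ∈ U,
    Z k i j w * (κ j w - κ i w) = 0

/-- `κ` is a solution of the `λ`-system in Riemann invariants on some open neighbourhood of `wbar`
inside the range `ρ.target` of the coordinates. -/
def IsLocalSolution {n : ℕ} (R : Fin n → (Fin n → ℝ) → (Fin n → ℝ))
    (ρ : OpenPartialHomeomorph (Fin n → ℝ) (Fin n → ℝ)) (wbar : Fin n → ℝ)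
    (κ : Fin n → (Fin n → ℝ) → ℝ) : Prop :=
  ∃ U : Set (Fin n → ℝ), IsOpen U ∧ wbar ∈ U ∧ U ⊆ ρ.target ∧
    IsLambdaSolutionOn (connZ R ρ) U κ

/-- The `λ`-system imposes the equality `κⁱ = κʲ` near `wbar`. -/
def ImposesEq {n : ℕ} (R : Fin n → (Fin n → ℝ) → (Fin n → ℝ))
    (ρ : OpenPartialHomeomorph (Fin n → ℝ) (Fin n → ℝ)) (wbar : Fin n → ℝ) (i j : Fin n) : Prop :=
  ∀ κ, IsLocalSolution R ρ wbar κ → ∀ᶠ w in 𝓝 wbar, κ i w = κ j w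

/-- Near `wbar`, the function `f` either vanishes identically or is nonzero on a dense set. -/
def ZeroOrDenselyNonzeroAt {n : ℕ} (f : (Fin n → ℝ) → ℝ) (wbar : Fin n → ℝ) : Prop :=
  (∀ᶠ w in 𝓝 wbar, f w = 0) ∨ (∀ᶠ w in 𝓝 wbar, w ∈ closure {z | f z ≠ 0})

/-- The initial data at `wbar`: the functions `φ i` of one variable on the `i`-th coordinate line
for the indices `i` outside all `A α`, and the constants `h α` for the indices in `A α`. -/
def HasInitialData {n s₀ : ℕ} (A : Fin s₀ → Finset (Fin n)) (φ : Fin n → ℝ → ℝ)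
    (h : Fin s₀ → ℝ) (wbar : Fin n → ℝ) (κ : Fin n → (Fin n → ℝ) → ℝ) : Prop :=
  (∀ i, (∀ α, i ∉ A α) →
    ∀ᶠ t in 𝓝 (wbar i), κ i (Function.update wbar i t) = φ i t) ∧
  (∀ α, ∀ i ∈ A α, κ i wbar = h α)

/-- The number of simple eigenvalues at `w`. -/
def numSimple {n : ℕ} (κ : Fin n → (Fin n → ℝ) → ℝ) (w : Fin n → ℝ) : ℕ :=
  {i | ∀ j, j ≠ i → κ j w ≠ κ i w}.ncard

/-- The number of non-simple eigenvalues at `w`, i.e. of distinct values taken by two or more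
of the `κⁱ(w)`. -/
def numNonSimple {n : ℕ} (κ : Fin n → (Fin n → ℝ) → ℝ) (w : Fin n → ℝ) : ℕ :=
  {c : ℝ | ∃ i j, i ≠ j ∧ κ i w = c ∧ κ j w = c}.ncard

end

open Filter Topology


/-! Being imposed is an equivalence relation ~ on the indices, and the sets A_α are its classes with
at least two elements. If i ≁ j and k ≠ i, j, then Z^k_ij vanishes near the base point: otherwise it
is densely nonzero, and the algebraic equation forces κ^i = κ^j for every local solution. If j ~ k
and i ≁ j, then Z^j_ji = Z^k_ki near the base point: otherwise differentiating κ^j = κ^k along w^i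
forces κ^i = κ^j. These are `eventually_connZ_eq_zero` and `eventually_connZ_sub_eq_zero`. Once the
κ's of each class are identified, the algebraic equations are void. What remains is a Darboux system
∂_i κ^j = c_ji (κ^i - κ^j), c_ji = Z^j_ji, with one unknown per class. It determines every
derivative of an unknown except that of a singleton class {j} along w^j. Hence the data are a
function of w^j for a singleton and a constant for a larger class.

Integrability comes from the flatness of the connection. The obstacle is regularity: the frame is
only C¹, so the coefficients are only continuous and cannot simply be cross-differentiated. But
Z^j_ki = ∑ L^j_m ∂_k R_i^m, so k ↦ Z^j_ki is a one-form of type L dp with L and p of class C¹. Its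
primitive in one coordinate is C¹ after an integration by parts, and its curl makes sense weakly as
the continuous form dL ∧ dp (`hasDerivAt_coordPrimitive`). Flatness evaluates that curl
(`sum_partialD_dualComp_mul_partialD_sub`). Where another component of the form vanishes, the weak
identity becomes a classical derivative of a coefficient
(`hasDerivAt_of_hasDerivAt_coordPrimitive`). The outcome is recorded in `IsCompatibleSystem` and
proved in `isCompatibleSystem_connZ`.

Existence (`IsCompatibleSystem.exists_solution`): integrate the equation for κ^j along a polygonal
path that switches on the coordinates outside the class of j one at a time. On a small ball this
linear operator is a contraction in a weighted C¹ norm, so a Neumann series gives a fixed point. By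
construction each equation holds only on the path segment in its own direction. Compatibility bounds
the defects of all equations by small integrals of the defects themselves, so they vanish.
Uniqueness is a similar smallness argument for the homogeneous linear system
(`eventually_eq_zero_of_lambda_system`).

The eigenvalue counts are combinatorial. The extremal solution takes pairwise different data on
different classes, and the values stay different nearby by continuity. -/

theorem update_mem_ball_pi {n : ℕ} {a w : Fin n → ℝ} {r : ℝ} (hw : w ∈ Metric.ball a r)
    {k : Fin n} {s : ℝ} (hs : s ∈ Metric.ball (a k) r) :
    Function.update w k s ∈ Metric.ball a r := by
  have hr : 0 < r := Metric.pos_of_mem_ball hw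
  rw [Metric.mem_ball, dist_pi_lt_iff hr] at *
  intro b
  rcases eq_or_ne b k with rfl | hb
  · simpa using hs
  · simpa [hb] using hw b

theorem apply_mem_ball_of_mem_ball_pi {n : ℕ} {a w : Fin n → ℝ} {r : ℝ}
    (hw : w ∈ Metric.ball a r) (k : Fin n) : w k ∈ Metric.ball (a k) r := by
  have hr : 0 < r := Metric.pos_of_mem_ball hw
  rw [Metric.mem_ball, dist_pi_lt_iff hr] at hw
  exact hw k

theorem mem_ball_of_mem_uIcc {a b r s : ℝ} (hb : b ∈ Metric.ball a r) (hs : s ∈ Set.uIcc a b) :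
    s ∈ Metric.ball a r := by
  have hr : 0 < r := Metric.pos_of_mem_ball hb
  rw [Real.ball_eq_Ioo] at *
  exact (Set.ordConnected_Ioo.uIcc_subset (by simp [hr]) hb) hs

/-! ### Partial derivatives along coordinate lines and the C¹ criterion -/

theorem hasDerivAt_update_of_contDiffOn {n : ℕ} {U : Set (Fin n → ℝ)} (hU : IsOpen U)
    {f : (Fin n → ℝ) → ℝ} (hf : ContDiffOn ℝ 1 f U) (i : Fin n) {w : Fin n → ℝ} {t : ℝ}
    (hw : Function.update w i t ∈ U) :
    HasDerivAt (fun t => f (Function.update w i t)) (partialD i f (Function.update w i t)) t := by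
  have h1 : HasFDerivAt f (fderiv ℝ f (Function.update w i t)) (Function.update w i t) :=
    ((hf.differentiableOn one_ne_zero).differentiableAt (hU.mem_nhds hw)).hasFDerivAt
  have h2 : HasDerivAt (fun t => Function.update w i t) (Pi.single i 1) t :=
    hasDerivAt_update w i t
  exact h1.comp_hasDerivAt t h2

theorem continuousOn_partialD {n : ℕ} {U : Set (Fin n → ℝ)} (hU : IsOpen U)
    {f : (Fin n → ℝ) → ℝ} (hf : ContDiffOn ℝ 1 f U) (i : Fin n) :
    ContinuousOn (partialD i f) U :=
  (hf.continuousOn_fderiv_of_isOpen hU le_rfl).clm_apply continuousOn_const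

theorem partialD_eq_of_hasDerivAt {n : ℕ} {U : Set (Fin n → ℝ)} (hU : IsOpen U)
    {f : (Fin n → ℝ) → ℝ} (hf : ContDiffOn ℝ 1 f U) {i : Fin n} {w : Fin n → ℝ} (hw : w ∈ U)
    {c : ℝ} (h : HasDerivAt (fun t => f (Function.update w i t)) c (w i)) :
    partialD i f w = c := by
  have := hasDerivAt_update_of_contDiffOn hU hf i (w := w) (t := w i) (by simpa using hw)
  simpa using this.unique h

/-- A function with continuous partial derivatives on an open set is `C¹`. -/
theorem hasFDerivAt_of_partials {n : ℕ} {U : Set (Fin n → ℝ)} (hU : IsOpen U)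
    {f : (Fin n → ℝ) → ℝ} {f' : Fin n → (Fin n → ℝ) → ℝ}
    (hf : ∀ i, ∀ w ∈ U, HasDerivAt (fun t => f (Function.update w i t)) (f' i w) (w i))
    (hc : ∀ i, ContinuousOn (f' i) U) {w : Fin n → ℝ} (hw : w ∈ U) :
    HasFDerivAt f (∑ i, f' i w • ContinuousLinearMap.proj (R := ℝ) (φ := fun _ : Fin n => ℝ) i)
      w := by
  rw [hasFDerivAt_iff_isLittleO_nhds_zero, Asymptotics.isLittleO_iff]
  intro ε hε
  obtain ⟨δ, hδ, hδU⟩ := Metric.isOpen_iff.1 hU w hw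
  -- The increment is split into `n` coordinate moves, each costing at most `η * ‖h‖`; the
  -- denominator `n + 1` keeps `η` positive also when `n = 0`.
  set η := ε / (n + 1) with hη
  have hη0 : 0 < η := by positivity
  have : ∀ᶠ z in 𝓝 w, z ∈ Metric.ball w δ ∧ ∀ i, |f' i z - f' i w| < η := by
    refine (show ∀ᶠ z in 𝓝 w, z ∈ Metric.ball w δ from Metric.ball_mem_nhds w hδ).and ?_
    refine eventually_all.2 fun i => ?_
    have := ((hc i).continuousAt (hU.mem_nhds hw)).tendsto
    have := (Metric.tendsto_nhds.1 this) η hη0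
    simpa [Real.dist_eq] using this
  obtain ⟨δ', hδ', H⟩ := Metric.eventually_nhds_iff_ball.1 this
  have key : ∀ v ∈ Metric.ball w δ', ∀ S : Finset (Fin n),
      |f (S.piecewise v w) - f w - ∑ i ∈ S, f' i w * (v i - w i)| ≤ S.card * (η * ‖v - w‖) := by
    intro v hv S
    induction S using Finset.induction_on with
    | empty => simp
    | insert a S ha ih =>
      set z := S.piecewise v w with hz
      have hzmem : ∀ T : Finset (Fin n), T.piecewise v w ∈ Metric.ball w δ' := by
        intro T
        rw [Metric.mem_ball, dist_pi_lt_iff hδ'] at *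
        intro b
        by_cases hb : b ∈ T
        · simpa [hb] using hv b
        · simpa [hb] using hδ'
      have hza : z a = w a := by simp [hz, ha]
      have hup : ∀ t ∈ Set.uIcc (w a) (v a), Function.update z a t ∈ Metric.ball w δ' :=
        fun t ht => update_mem_ball_pi (hzmem S)
          (mem_ball_of_mem_uIcc (apply_mem_ball_of_mem_ball_pi hv a) ht)
      have hmv := (convex_uIcc (w a) (v a)).norm_image_sub_le_of_norm_hasDerivWithin_le
        (f := fun t => f (Function.update z a t) - f' a w * t)
        (f' := fun t => f' a (Function.update z a t) - f' a w) (C := η)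
        (fun t ht => by
          have h1 := hf a (Function.update z a t) (hδU ((H _ (hup t ht)).1))
          simp only [Function.update_idem, Function.update_self] at h1
          have h2 := h1.fun_sub ((hasDerivAt_id t).const_mul (f' a w))
          simpa using h2.hasDerivWithinAt)
        (fun t ht => by simpa using ((H _ (hup t ht)).2 a).le)
        Set.left_mem_uIcc Set.right_mem_uIcc
      have e1 : Function.update z a (w a) = z := by rw [← hza]; simp
      rw [e1] at hmv
      rw [Finset.piecewise_insert, Finset.sum_insert ha, Finset.card_insert_of_notMem ha]
      have h3 : ‖v a - w a‖ ≤ ‖v - w‖ := norm_le_pi_norm (v - w) a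
      have h4 : η * ‖v a - w a‖ ≤ η * ‖v - w‖ := by gcongr
      rw [Real.norm_eq_abs] at hmv
      push_cast
      calc |f (Function.update z a (v a)) - f w -
            (f' a w * (v a - w a) + ∑ i ∈ S, f' i w * (v i - w i))|
          = |(f (Function.update z a (v a)) - f' a w * v a - (f z - f' a w * w a)) +
            (f z - f w - ∑ i ∈ S, f' i w * (v i - w i))| := by congr 1; ring
        _ ≤ _ := (abs_add_le _ _)
        _ ≤ η * ‖v - w‖ + S.card * (η * ‖v - w‖) := add_le_add (hmv.trans h4) ih
        _ = _ := by ring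
  have hev : ∀ᶠ h in 𝓝 (0 : Fin n → ℝ), w + h ∈ Metric.ball w δ' := by
    filter_upwards [Metric.ball_mem_nhds (0 : Fin n → ℝ) hδ'] with h hh
    simpa using hh
  filter_upwards [hev] with h hh
  have := key (w + h) hh Finset.univ
  simp only [Finset.piecewise_univ, Finset.card_univ, Fintype.card_fin, Pi.add_apply,
    add_sub_cancel_left] at this
  simp only [sum_apply, smul_apply,
    ContinuousLinearMap.proj_apply, smul_eq_mul, Real.norm_eq_abs]
  refine this.trans ?_
  have : (n : ℝ) * η ≤ ε := by
    rw [hη, ← mul_div_assoc, div_le_iff₀ (by positivity)]; nlinarith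
  calc (n : ℝ) * (η * ‖h‖) = (n * η) * ‖h‖ := by ring
    _ ≤ _ := by gcongr

theorem contDiffOn_one_of_partials {n : ℕ} {U : Set (Fin n → ℝ)} (hU : IsOpen U)
    {f : (Fin n → ℝ) → ℝ} {f' : Fin n → (Fin n → ℝ) → ℝ}
    (hf : ∀ i, ∀ w ∈ U, HasDerivAt (fun t => f (Function.update w i t)) (f' i w) (w i))
    (hc : ∀ i, ContinuousOn (f' i) U) : ContDiffOn ℝ 1 f U := by
  have h := fun w hw => hasFDerivAt_of_partials hU hf hc (w := w) hw
  have h1 : ContDiffOn ℝ (0 + 1) f U := by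
    rw [contDiffOn_succ_iff_fderiv_of_isOpen hU]
    refine ⟨fun w hw => (h w hw).differentiableAt.differentiableWithinAt, by simp, ?_⟩
    rw [contDiffOn_zero]
    refine ContinuousOn.congr (f := fun w => ∑ i, f' i w •
      ContinuousLinearMap.proj (R := ℝ) (φ := fun _ : Fin n => ℝ) i) ?_
      fun w hw => (h w hw).fderiv
    exact continuousOn_finsetSum _ fun i _ => (hc i).smul continuousOn_const
  simpa using h1


/-! ### Weak calculus for one-forms L dp with L and p of class C¹ -/

/-- Differentiation under the integral sign of `∫ L ∂_y p dy` for `L`, `p` of class `C¹`. -/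
theorem hasDerivAt_integral_mul_deriv {L Lx Ly p px py : ℝ → ℝ → ℝ} {x₀ δ y₀ y₁ : ℝ} (hδ : 0 < δ)
    (hLx : ∀ x ∈ Metric.closedBall x₀ δ, ∀ y ∈ Set.uIcc y₀ y₁,
      HasDerivAt (fun x => L x y) (Lx x y) x)
    (hLy : ∀ x ∈ Metric.closedBall x₀ δ, ∀ y ∈ Set.uIcc y₀ y₁,
      HasDerivAt (fun y => L x y) (Ly x y) y)
    (hpx : ∀ x ∈ Metric.closedBall x₀ δ, ∀ y ∈ Set.uIcc y₀ y₁,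
      HasDerivAt (fun x => p x y) (px x y) x)
    (hpy : ∀ x ∈ Metric.closedBall x₀ δ, ∀ y ∈ Set.uIcc y₀ y₁,
      HasDerivAt (fun y => p x y) (py x y) y)
    (cLx : ContinuousOn (fun z : ℝ × ℝ => Lx z.1 z.2) (Metric.closedBall x₀ δ ×ˢ Set.uIcc y₀ y₁))
    (cLy : ContinuousOn (fun y => Ly x₀ y) (Set.uIcc y₀ y₁))
    (cpx : ContinuousOn (fun z : ℝ × ℝ => px z.1 z.2) (Metric.closedBall x₀ δ ×ˢ Set.uIcc y₀ y₁))
    (cpy : ContinuousOn (fun z : ℝ × ℝ => py z.1 z.2) (Metric.closedBall x₀ δ ×ˢ Set.uIcc y₀ y₁)) :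
    HasDerivAt (fun x => ∫ y in y₀..y₁, L x y * py x y)
      (L x₀ y₁ * px x₀ y₁ - L x₀ y₀ * px x₀ y₀ +
        ∫ y in y₀..y₁, (Lx x₀ y * py x₀ y - Ly x₀ y * px x₀ y)) x₀ := by
  have hK : IsCompact (Metric.closedBall x₀ δ ×ˢ Set.uIcc y₀ y₁) :=
    (isCompact_closedBall x₀ δ).prod isCompact_uIcc
  have bd : ∀ g : ℝ → ℝ → ℝ, ContinuousOn (fun z : ℝ × ℝ => g z.1 z.2)
      (Metric.closedBall x₀ δ ×ˢ Set.uIcc y₀ y₁) →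
      ∃ C, 0 ≤ C ∧ ∀ x ∈ Metric.closedBall x₀ δ, ∀ y ∈ Set.uIcc y₀ y₁, |g x y| ≤ C := by
    intro g hg
    obtain ⟨C, hC⟩ := hK.exists_bound_of_continuousOn hg
    refine ⟨|C|, abs_nonneg _, fun x hx y hy => (hC (x, y) ⟨hx, hy⟩).trans (le_abs_self C)⟩
  obtain ⟨M₁, hM₁0, hM₁⟩ := bd Lx cLx
  obtain ⟨M₂, hM₂0, hM₂⟩ := bd px cpx
  obtain ⟨M₃, hM₃0, hM₃⟩ := bd py cpy
  have hx₀ : x₀ ∈ Metric.closedBall x₀ δ := Metric.mem_closedBall_self hδ.le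
  have slopeBd : ∀ (g g' : ℝ → ℝ → ℝ) (C : ℝ), (∀ x ∈ Metric.closedBall x₀ δ,
      ∀ y ∈ Set.uIcc y₀ y₁, HasDerivAt (fun x => g x y) (g' x y) x) →
      (∀ x ∈ Metric.closedBall x₀ δ, ∀ y ∈ Set.uIcc y₀ y₁, |g' x y| ≤ C) →
      ∀ x ∈ Metric.closedBall x₀ δ, ∀ y ∈ Set.uIcc y₀ y₁, |(x - x₀)⁻¹ * (g x y - g x₀ y)| ≤ C := by
    intro g g' C hg hC x hx y hy
    have := (convex_closedBall x₀ δ).norm_image_sub_le_of_norm_hasDerivWithin_le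
      (f := fun x => g x y) (f' := fun x => g' x y)
      (fun t ht => (hg t ht y hy).hasDerivWithinAt) (fun t ht => hC t ht y hy) hx₀ hx
    rcases eq_or_ne x x₀ with rfl | hne
    · simpa using (abs_nonneg _).trans (hC x hx y hy)
    rw [abs_mul, abs_inv, inv_mul_le_iff₀ (abs_pos.2 (sub_ne_zero.2 hne)), mul_comm]
    simpa [Real.norm_eq_abs] using this
  have contx : ∀ (g : ℝ → ℝ → ℝ), ContinuousOn (fun z : ℝ × ℝ => g z.1 z.2)
      (Metric.closedBall x₀ δ ×ˢ Set.uIcc y₀ y₁) → ∀ x ∈ Metric.closedBall x₀ δ,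
      ContinuousOn (fun y => g x y) (Set.uIcc y₀ y₁) := by
    intro g hg x hx
    exact hg.comp (f := fun y => (x, y)) (by fun_prop) fun y hy => ⟨hx, hy⟩
  have contpy := contx py cpy
  have contp : ∀ x ∈ Metric.closedBall x₀ δ, ContinuousOn (fun y => p x y) (Set.uIcc y₀ y₁) :=
    fun x hx y hy => (hpy x hx y hy).continuousAt.continuousWithinAt
  have contL : ∀ x ∈ Metric.closedBall x₀ δ, ContinuousOn (fun y => L x y) (Set.uIcc y₀ y₁) :=
    fun x hx y hy => (hLy x hx y hy).continuousAt.continuousWithinAt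
  have hnear : ∀ᶠ x in 𝓝[≠] x₀, x ∈ Metric.closedBall x₀ δ :=
    nhdsWithin_le_nhds (Metric.closedBall_mem_nhds x₀ hδ)
  have hsub := Set.uIoc_subset_uIcc (a := y₀) (b := y₁)
  rw [hasDerivAt_iff_tendsto_slope]
  -- The x-difference quotient of `L * py` contains that of `py`, which need not converge.
  -- Integration by parts in y moves the y-derivative from `p` to `L`; then only the quotients of
  -- `L` and `p` occur, and these converge boundedly.
  have hslope : ∀ x ∈ Metric.closedBall x₀ δ,
      slope (fun x => ∫ y in y₀..y₁, L x y * py x y) x₀ x =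
      (L x₀ y₁ * ((x - x₀)⁻¹ * (p x y₁ - p x₀ y₁)) - L x₀ y₀ * ((x - x₀)⁻¹ * (p x y₀ - p x₀ y₀))) +
      ∫ y in y₀..y₁, (((x - x₀)⁻¹ * (L x y - L x₀ y)) * py x y -
        Ly x₀ y * ((x - x₀)⁻¹ * (p x y - p x₀ y))) := by
    intro x hx
    have ibp := intervalIntegral.integral_mul_deriv_eq_deriv_mul (a := y₀) (b := y₁)
      (u := fun y => L x₀ y) (u' := fun y => Ly x₀ y) (v := fun y => p x y - p x₀ y)
      (v' := fun y => py x y - py x₀ y) (hLy x₀ hx₀)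
      (fun y hy => (hpy x hx y hy).sub (hpy x₀ hx₀ y hy)) cLy.intervalIntegrable
      ((contpy x hx).sub (contpy x₀ hx₀)).intervalIntegrable
    have e1 : ∫ y in y₀..y₁, (((x - x₀)⁻¹ * (L x y - L x₀ y)) * py x y -
        Ly x₀ y * ((x - x₀)⁻¹ * (p x y - p x₀ y))) = (x - x₀)⁻¹ *
        ((∫ y in y₀..y₁, (L x y - L x₀ y) * py x y) -
          ∫ y in y₀..y₁, Ly x₀ y * (p x y - p x₀ y)) := by
      rw [← intervalIntegral.integral_sub, ← intervalIntegral.integral_const_mul]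
      · congr 1; ext y; ring
      · exact (((contL x hx).sub (contL x₀ hx₀)).mul (contpy x hx)).intervalIntegrable
      · exact (cLy.mul ((contp x hx).sub (contp x₀ hx₀))).intervalIntegrable
    have e2 : (∫ y in y₀..y₁, L x y * py x y) - ∫ y in y₀..y₁, L x₀ y * py x₀ y =
        (∫ y in y₀..y₁, (L x y - L x₀ y) * py x y) +
          ∫ y in y₀..y₁, L x₀ y * (py x y - py x₀ y) := by
      rw [← intervalIntegral.integral_sub, ← intervalIntegral.integral_add]
      · congr 1; ext y; ring
      · exact (((contL x hx).sub (contL x₀ hx₀)).mul (contpy x hx)).intervalIntegrable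
      · exact ((contL x₀ hx₀).mul ((contpy x hx).sub (contpy x₀ hx₀))).intervalIntegrable
      · exact ((contL x hx).mul (contpy x hx)).intervalIntegrable
      · exact ((contL x₀ hx₀).mul (contpy x₀ hx₀)).intervalIntegrable
    rw [slope_def_field, e1, e2, ibp, div_eq_inv_mul]
    ring
  refine Tendsto.congr' (hnear.mono fun x hx => (hslope x hx).symm) ?_
  have slopeT : ∀ (g g' : ℝ → ℝ → ℝ), (∀ x ∈ Metric.closedBall x₀ δ,
      ∀ y ∈ Set.uIcc y₀ y₁, HasDerivAt (fun x => g x y) (g' x y) x) → ∀ y ∈ Set.uIcc y₀ y₁,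
      Tendsto (fun x => (x - x₀)⁻¹ * (g x y - g x₀ y)) (𝓝[≠] x₀) (𝓝 (g' x₀ y)) := by
    intro g g' hg y hy
    have := (hg x₀ hx₀ y hy).tendsto_slope
    refine this.congr fun x => ?_
    rw [slope_def_field, div_eq_inv_mul]
  refine Tendsto.add (((slopeT p px hpx y₁ Set.right_mem_uIcc).const_mul _).sub
    ((slopeT p px hpx y₀ Set.left_mem_uIcc).const_mul _)) ?_
  obtain ⟨M₄, hM₄⟩ := isCompact_uIcc.exists_bound_of_continuousOn cLy
  refine intervalIntegral.tendsto_integral_filter_of_dominated_convergence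
    (fun _ => M₁ * M₃ + M₄ * M₂) ?_ ?_ intervalIntegrable_const ?_
  · refine hnear.mono fun x hx => ?_
    refine ContinuousOn.aestronglyMeasurable ?_ measurableSet_uIoc
    refine ContinuousOn.mono ?_ hsub
    exact ((continuousOn_const.mul ((contL x hx).sub (contL x₀ hx₀))).mul (contpy x hx)).sub
      (cLy.mul (continuousOn_const.mul ((contp x hx).sub (contp x₀ hx₀))))
  · refine hnear.mono fun x hx => Eventually.of_forall fun y hy => ?_
    have hy := hsub hy
    refine (norm_sub_le _ _).trans (add_le_add ?_ ?_)
    · rw [norm_mul]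
      exact mul_le_mul (slopeBd L Lx M₁ hLx hM₁ x hx y hy) (hM₃ x hx y hy) (norm_nonneg _) hM₁0
    · rw [norm_mul]
      exact mul_le_mul (hM₄ y hy) (slopeBd p px M₂ hpx hM₂ x hx y hy) (norm_nonneg _)
        ((norm_nonneg _).trans (hM₄ y hy))
  · refine Eventually.of_forall fun y hy => ?_
    have hy := hsub hy
    refine ((slopeT L Lx hLx y hy).mul ?_).sub ((slopeT p px hpx y hy).const_mul _)
    have h1 : ContinuousOn (fun x => py x y) (Metric.closedBall x₀ δ) :=
      cpy.comp (f := fun x => (x, y)) (by fun_prop) fun x hx => ⟨hx, hy⟩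
    exact (h1.continuousAt (Metric.closedBall_mem_nhds x₀ hδ)).tendsto.mono_left nhdsWithin_le_nhds


/-! ### Primitives in one coordinate -/

/-- The primitive of `G` in the `k`-th coordinate that vanishes on the hyperplane `wᵏ = aᵏ`. -/
noncomputable def coordPrimitive {n : ℕ} (a : Fin n → ℝ) (k : Fin n) (G : (Fin n → ℝ) → ℝ)
    (w : Fin n → ℝ) : ℝ :=
  ∫ s in (a k)..(w k), G (Function.update w k s)

theorem update_mem_ball_of_mem_uIcc {n : ℕ} {a w : Fin n → ℝ} {r : ℝ} (hw : w ∈ Metric.ball a r)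
    {k : Fin n} {s : ℝ} (hs : s ∈ Set.uIcc (a k) (w k)) :
    Function.update w k s ∈ Metric.ball a r :=
  update_mem_ball_pi hw (mem_ball_of_mem_uIcc (apply_mem_ball_of_mem_ball_pi hw k) hs)

theorem update_self_mem_ball {n : ℕ} {a w : Fin n → ℝ} {r : ℝ} (hw : w ∈ Metric.ball a r)
    (k : Fin n) : Function.update w k (a k) ∈ Metric.ball a r :=
  update_mem_ball_of_mem_uIcc hw Set.left_mem_uIcc

theorem continuousOn_coordPrimitive {n : ℕ} {a : Fin n → ℝ} {r : ℝ} {G : (Fin n → ℝ) → ℝ}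
    (hG : ContinuousOn G (Metric.ball a r)) (k : Fin n) :
    ContinuousOn (coordPrimitive a k G) (Metric.ball a r) := by
  intro w₀ hw₀
  obtain ⟨r', h1, h2⟩ := exists_between (Metric.mem_ball.1 hw₀)
  have hr' : 0 ≤ r' := dist_nonneg.trans h1.le
  -- Clamping to a smaller closed box turns `G` into a globally continuous function without changing
  -- the primitive near `w₀`, so continuity of parametric integrals applies.
  set cl : (Fin n → ℝ) → (Fin n → ℝ) := fun z i => max (a i - r') (min (z i) (a i + r')) with hcl
  have hclc : Continuous cl := continuous_pi fun i =>
    continuous_const.max ((continuous_apply i).min continuous_const)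
  have hclB : ∀ z, cl z ∈ Metric.ball a r := by
    intro z
    rw [Metric.mem_ball, dist_pi_lt_iff (hr'.trans_lt h2)]
    intro i
    rw [Real.dist_eq, abs_lt]
    have h3 : a i - r' ≤ cl z i := le_max_left _ _
    have h4 : cl z i ≤ a i + r' := max_le (by linarith) (min_le_right _ _)
    constructor <;> linarith
  have hcleq : ∀ z ∈ Metric.ball a r', cl z = z := by
    intro z hz
    ext i
    have := apply_mem_ball_of_mem_ball_pi hz i
    rw [Real.ball_eq_Ioo] at this
    simp only [hcl]
    rw [min_eq_left this.2.le, max_eq_right this.1.le]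
  have hGc : Continuous (G ∘ cl) := hG.comp_continuous hclc hclB
  have hcont : Continuous (coordPrimitive a k (G ∘ cl)) := by
    refine intervalIntegral.continuous_parametric_intervalIntegral_of_continuous
      (f := fun w s => (G ∘ cl) (Function.update w k s)) ?_ (continuous_apply k)
    exact hGc.comp (Continuous.update (f := fun z : (Fin n → ℝ) × ℝ => z.1) continuous_fst k
      continuous_snd)
  refine (hcont.continuousAt.congr ?_).continuousWithinAt
  filter_upwards [Metric.isOpen_ball.mem_nhds (Metric.mem_ball.2 h1)] with w hw
  refine intervalIntegral.integral_congr fun s hs => ?_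
  simp only [Function.comp]
  rw [hcleq _ (update_mem_ball_of_mem_uIcc hw hs)]

/-- The `i`-th partial derivative of the primitive of `f ∂ₖg` in the `k`-th coordinate. -/
noncomputable def coordPrimitiveDeriv {n : ℕ} (a : Fin n → ℝ) (k : Fin n)
    (f g : (Fin n → ℝ) → ℝ) (i : Fin n) (w : Fin n → ℝ) : ℝ :=
  if i = k then f w * partialD k g w else
    f w * partialD i g w
      - f (Function.update w k (a k)) * partialD i g (Function.update w k (a k))
      + coordPrimitive a k
          (fun z => partialD i f z * partialD k g z - partialD k f z * partialD i g z) w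

theorem hasDerivAt_coordPrimitive_self {n : ℕ} {a : Fin n → ℝ} {r : ℝ} {G : (Fin n → ℝ) → ℝ}
    (hG : ContinuousOn G (Metric.ball a r)) (k : Fin n) {w : Fin n → ℝ}
    (hw : w ∈ Metric.ball a r) :
    HasDerivAt (fun t => coordPrimitive a k G (Function.update w k t)) (G w) (w k) := by
  have h0 : (fun t => coordPrimitive a k G (Function.update w k t)) =
      fun t => ∫ s in (a k)..t, G (Function.update w k s) := by
    ext t; simp [coordPrimitive]
  rw [h0]
  have hc : ContinuousOn (fun s => G (Function.update w k s)) (Metric.ball (a k) r) :=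
    hG.comp (f := fun s => Function.update w k s)
      (Continuous.update (f := fun _ : ℝ => w) continuous_const k continuous_id).continuousOn
      fun s hs => update_mem_ball_pi hw hs
  have hwk := apply_mem_ball_of_mem_ball_pi hw k
  have := intervalIntegral.integral_hasDerivAt_right (a := a k) (b := w k)
    (f := fun s => G (Function.update w k s))
    (hc.mono fun s hs => mem_ball_of_mem_uIcc hwk hs).intervalIntegrable
    (hc.stronglyMeasurableAtFilter Metric.isOpen_ball _ hwk)
    (hc.continuousAt (Metric.isOpen_ball.mem_nhds hwk))
  simpa using this

/-- For i ≠ k the mixed derivative ∂_i ∂_k g need not exist. After integration by parts the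
derivative consists of the boundary values of f ∂_i g and the integral of the curl ∂_i f ∂_k g - ∂_k
f ∂_i g, all continuous. This is what makes the Picard operator preserve C¹. -/
theorem hasDerivAt_coordPrimitive {n : ℕ} {a : Fin n → ℝ} {r : ℝ} {f g : (Fin n → ℝ) → ℝ}
    (hf : ContDiffOn ℝ 1 f (Metric.ball a r)) (hg : ContDiffOn ℝ 1 g (Metric.ball a r))
    (k i : Fin n) {w : Fin n → ℝ} (hw : w ∈ Metric.ball a r) :
    HasDerivAt (fun t => coordPrimitive a k (fun z => f z * partialD k g z) (Function.update w i t))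
      (coordPrimitiveDeriv a k f g i w) (w i) := by
  have hB : IsOpen (Metric.ball a r) := Metric.isOpen_ball
  have cf := fun j => continuousOn_partialD hB hf j
  have cg := fun j => continuousOn_partialD hB hg j
  rcases eq_or_ne i k with rfl | hik
  · simp only [coordPrimitiveDeriv, if_true]
    exact hasDerivAt_coordPrimitive_self (hf.continuousOn.mul (cg i)) i hw
  simp only [coordPrimitiveDeriv, if_neg hik]
  have hwi := apply_mem_ball_of_mem_ball_pi hw i
  obtain ⟨δ', hδ', hsub⟩ := Metric.isOpen_iff.1 Metric.isOpen_ball _ hwi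
  set δ := δ' / 2
  have hδ : 0 < δ := by positivity
  have hcb : Metric.closedBall (w i) δ ⊆ Metric.ball (a i) r :=
    (Metric.closedBall_subset_ball (by simp only [δ]; linarith)).trans hsub
  set W : ℝ → ℝ → (Fin n → ℝ) := fun x y => Function.update (Function.update w i x) k y with hW
  have hW' : ∀ x y, W x y = Function.update (Function.update w k y) i x := fun x y =>
    Function.update_comm hik _ _ _
  have hWm : ∀ x ∈ Metric.closedBall (w i) δ, ∀ y ∈ Set.uIcc (a k) (w k),
      W x y ∈ Metric.ball a r := fun x hx y hy => by
    refine update_mem_ball_of_mem_uIcc (update_mem_ball_pi hw (hcb hx)) ?_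
    simpa [hik.symm] using hy
  have hWi : ∀ {F : (Fin n → ℝ) → ℝ}, ContDiffOn ℝ 1 F (Metric.ball a r) →
      ∀ x ∈ Metric.closedBall (w i) δ, ∀ y ∈ Set.uIcc (a k) (w k),
      HasDerivAt (fun x => F (W x y)) (partialD i F (W x y)) x := by
    intro F hF x hx y hy
    have := hWm x hx y hy
    simp only [hW'] at this ⊢
    exact hasDerivAt_update_of_contDiffOn hB hF i this
  have hWk : ∀ {F : (Fin n → ℝ) → ℝ}, ContDiffOn ℝ 1 F (Metric.ball a r) →
      ∀ x ∈ Metric.closedBall (w i) δ, ∀ y ∈ Set.uIcc (a k) (w k),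
      HasDerivAt (fun y => F (W x y)) (partialD k F (W x y)) y := by
    intro F hF x hx y hy
    exact hasDerivAt_update_of_contDiffOn hB hF k (hWm x hx y hy)
  have hWc : ∀ {F : (Fin n → ℝ) → ℝ}, ContinuousOn F (Metric.ball a r) →
      ContinuousOn (fun z : ℝ × ℝ => F (W z.1 z.2))
        (Metric.closedBall (w i) δ ×ˢ Set.uIcc (a k) (w k)) := by
    intro F hF
    refine hF.comp (Continuous.continuousOn ?_) fun z hz => hWm _ hz.1 _ hz.2
    exact Continuous.update (f := fun z : ℝ × ℝ => Function.update w i z.1)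
      (Continuous.update (f := fun _ : ℝ × ℝ => w) continuous_const i continuous_fst) k
      continuous_snd
  have hx0 : w i ∈ Metric.closedBall (w i) δ := Metric.mem_closedBall_self hδ.le
  have main := hasDerivAt_integral_mul_deriv (L := fun x y => f (W x y)) (p := fun x y => g (W x y))
    (Lx := fun x y => partialD i f (W x y)) (Ly := fun x y => partialD k f (W x y))
    (px := fun x y => partialD i g (W x y)) (py := fun x y => partialD k g (W x y))
    (x₀ := w i) (y₀ := a k) (y₁ := w k) hδ (hWi hf) (hWk hf) (hWi hg) (hWk hg)
    (hWc (cf i))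
    ((hWc (cf k)).comp (f := fun y => (w i, y)) (Continuous.prodMk_right _).continuousOn fun y hy => ⟨hx0, hy⟩)
    (hWc (cg i)) (hWc (cg k))
  have e0 : ∀ y, W (w i) y = Function.update w k y := fun y => by simp [hW]
  simp only [e0, Function.update_eq_self] at main
  refine main.congr_deriv rfl |>.congr_of_eventuallyEq (Eventually.of_forall fun t => ?_)
  simp [coordPrimitive, hW, hik.symm]

theorem continuousOn_coordPrimitiveDeriv {n : ℕ} {a : Fin n → ℝ} {r : ℝ} {f g : (Fin n → ℝ) → ℝ}
    (hf : ContDiffOn ℝ 1 f (Metric.ball a r)) (hg : ContDiffOn ℝ 1 g (Metric.ball a r))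
    (k i : Fin n) : ContinuousOn (coordPrimitiveDeriv a k f g i) (Metric.ball a r) := by
  have hB : IsOpen (Metric.ball a r) := Metric.isOpen_ball
  have cf := fun j => continuousOn_partialD hB hf j
  have cg := fun j => continuousOn_partialD hB hg j
  unfold coordPrimitiveDeriv
  split_ifs
  · exact hf.continuousOn.mul (cg k)
  · refine ((hf.continuousOn.mul (cg i)).sub ?_).add (continuousOn_coordPrimitive
      (((cf i).mul (cg k)).sub ((cf k).mul (cg i))) k)
    have h1 : ContinuousOn (fun z => f z * partialD i g z) (Metric.ball a r) :=
      hf.continuousOn.mul (cg i)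
    have h2 : Continuous (fun w : Fin n → ℝ => Function.update w k (a k)) :=
      Continuous.update (f := fun w : Fin n → ℝ => w) continuous_id k continuous_const
    exact ContinuousOn.comp (g := fun z => f z * partialD i g z) h1 h2.continuousOn
      fun w hw => update_self_mem_ball hw k

theorem contDiffOn_coordPrimitive {n : ℕ} {a : Fin n → ℝ} {r : ℝ} {f g : (Fin n → ℝ) → ℝ}
    (hf : ContDiffOn ℝ 1 f (Metric.ball a r)) (hg : ContDiffOn ℝ 1 g (Metric.ball a r))
    (k : Fin n) :
    ContDiffOn ℝ 1 (coordPrimitive a k (fun z => f z * partialD k g z)) (Metric.ball a r) :=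
  contDiffOn_one_of_partials Metric.isOpen_ball
    (fun i _ hw => hasDerivAt_coordPrimitive hf hg k i hw)
    (fun i => continuousOn_coordPrimitiveDeriv hf hg k i)

theorem partialD_coordPrimitive {n : ℕ} {a : Fin n → ℝ} {r : ℝ} {f g : (Fin n → ℝ) → ℝ}
    (hf : ContDiffOn ℝ 1 f (Metric.ball a r)) (hg : ContDiffOn ℝ 1 g (Metric.ball a r))
    (k i : Fin n) {w : Fin n → ℝ} (hw : w ∈ Metric.ball a r) :
    partialD i (coordPrimitive a k (fun z => f z * partialD k g z)) w =
      coordPrimitiveDeriv a k f g i w :=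
  partialD_eq_of_hasDerivAt Metric.isOpen_ball (contDiffOn_coordPrimitive hf hg k) hw
    (hasDerivAt_coordPrimitive hf hg k i hw)


/-! ### From weak to classical derivatives; truncations and series -/

/-- If the form `q dwᵏ` has the continuous function `r` as its weak derivative in the direction
`i ≠ k`, then `∂ᵢq = r` in the classical sense. -/
theorem hasDerivAt_of_hasDerivAt_coordPrimitive {n : ℕ} {a : Fin n → ℝ} {r : ℝ}
    {q q' : (Fin n → ℝ) → ℝ} (hq : ContinuousOn q (Metric.ball a r))
    (hq' : ContinuousOn q' (Metric.ball a r)) {i k : Fin n} (hik : i ≠ k)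
    (h : ∀ w ∈ Metric.ball a r, HasDerivAt (fun t => coordPrimitive a k q (Function.update w i t))
      (coordPrimitive a k q' w) (w i)) {w : Fin n → ℝ} (hw : w ∈ Metric.ball a r) :
    HasDerivAt (fun t => q (Function.update w i t)) (q' w) (w i) := by
  have hwi := apply_mem_ball_of_mem_ball_pi hw i
  have hwk := apply_mem_ball_of_mem_ball_pi hw k
  set I := Metric.ball (a i) r
  set J := Metric.ball (a k) r
  have hIo : IsOpen I := Metric.isOpen_ball
  have hJo : IsOpen J := Metric.isOpen_ball
  set W : ℝ → ℝ → (Fin n → ℝ) := fun x y => Function.update (Function.update w i x) k y with hW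
  have hW' : ∀ x y, W x y = Function.update (Function.update w k y) i x := fun x y =>
    Function.update_comm hik _ _ _
  have hWm : ∀ x ∈ I, ∀ y ∈ J, W x y ∈ Metric.ball a r := fun x hx y hy =>
    update_mem_ball_pi (update_mem_ball_pi hw hx) hy
  have hWc : Continuous (fun z : ℝ × ℝ => W z.1 z.2) :=
    Continuous.update (f := fun z : ℝ × ℝ => Function.update w i z.1)
      (Continuous.update (f := fun _ : ℝ × ℝ => w) continuous_const i continuous_fst) k
      continuous_snd
  have hWk : ∀ x, W x (w k) = Function.update w i x := fun x => by simp [hW']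
  have hIs : ∀ x ∈ I, Set.uIcc (w i) x ⊆ I := fun x hx => by
    have : Set.OrdConnected I := by
      simp only [I, Real.ball_eq_Ioo]; exact Set.ordConnected_Ioo
    exact this.uIcc_subset hwi hx
  have cq'x : ∀ y ∈ J, ContinuousOn (fun x => q' (W x y)) I := fun y hy =>
    ContinuousOn.comp (g := q') (f := fun x => W x y) hq'
      (hWc.comp (Continuous.prodMk_left y)).continuousOn fun x hx => hWm x hx y hy
  have cPx : ∀ y ∈ J, ContinuousOn (fun x => coordPrimitive a k q' (W x y)) I := fun y hy =>
    ContinuousOn.comp (g := coordPrimitive a k q') (f := fun x => W x y)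
      (continuousOn_coordPrimitive hq' k)
      (hWc.comp (Continuous.prodMk_left y)).continuousOn fun x hx => hWm x hx y hy
  have ftc : ∀ x ∈ I, ∀ y ∈ J, ∫ ξ in (w i)..x, coordPrimitive a k q' (W ξ y) =
      coordPrimitive a k q (W x y) - coordPrimitive a k q (W (w i) y) := by
    intro x hx y hy
    refine intervalIntegral.integral_eq_sub_of_hasDerivAt
      (f := fun ξ => coordPrimitive a k q (W ξ y)) (fun ξ hξ => ?_)
      ((cPx y hy).mono (hIs x hx)).intervalIntegrable
    have := h _ (hWm ξ (hIs x hx hξ) y hy)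
    simp only [hW', Function.update_idem, Function.update_self] at this ⊢
    exact this
  have dq : ∀ x ∈ I, HasDerivAt (fun y => coordPrimitive a k q (W x y)) (q (W x (w k))) (w k) := by
    intro x hx
    have := hasDerivAt_coordPrimitive_self hq k (hWm x hx (w k) hwk)
    simpa [hW] using this
  have dq' : ∀ x ∈ I, ∀ y ∈ J,
      HasDerivAt (fun y => coordPrimitive a k q' (W x y)) (q' (W x y)) y := by
    intro x hx y hy
    have := hasDerivAt_coordPrimitive_self hq' k (hWm x hx y hy)
    simpa [hW] using this
  obtain ⟨δ, hδ, hδJ⟩ := Metric.nhds_basis_closedBall.mem_iff.1 (hJo.mem_nhds hwk)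
  -- Integrating the hypothesis in w^i expresses a difference of primitives of q as an integral of
  -- primitives of q'. Differentiating that identity in w^k removes the primitives on both sides.
  have key : ∀ x ∈ I, q (Function.update w i x) = q w + ∫ ξ in (w i)..x, q' (W ξ (w k)) := by
    intro x hx
    have hK : IsCompact (Set.uIcc (w i) x ×ˢ Metric.closedBall (w k) δ) :=
      isCompact_uIcc.prod (isCompact_closedBall _ _)
    obtain ⟨C, hC⟩ := hK.exists_bound_of_continuousOn (f := fun z : ℝ × ℝ => q' (W z.1 z.2))
      (ContinuousOn.comp (g := q') (f := fun z : ℝ × ℝ => W z.1 z.2) hq' hWc.continuousOn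
        fun z hz => hWm _ (hIs x hx hz.1) _ (hδJ hz.2))
    have hsub := Set.uIoc_subset_uIcc (a := w i) (b := x)
    have hd := (intervalIntegral.hasDerivAt_integral_of_dominated_loc_of_deriv_le
      (μ := MeasureTheory.volume) (a := w i) (b := x)
      (F := fun y ξ => coordPrimitive a k q' (W ξ y)) (F' := fun y ξ => q' (W ξ y))
      (x₀ := w k) (s := Metric.closedBall (w k) δ) (bound := fun _ => C)
      (Metric.closedBall_mem_nhds _ hδ)
      (by
        filter_upwards [hJo.mem_nhds hwk] with y hy
        exact ((cPx y hy).mono (hsub.trans (hIs x hx))).aestronglyMeasurable measurableSet_uIoc)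
      ((cPx _ hwk).mono (hIs x hx)).intervalIntegrable
      (((cq'x _ hwk).mono (hsub.trans (hIs x hx))).aestronglyMeasurable measurableSet_uIoc)
      (Eventually.of_forall fun ξ hξ y hy => hC (ξ, y) ⟨hsub hξ, hy⟩)
      intervalIntegrable_const
      (Eventually.of_forall fun ξ hξ y hy => dq' ξ (hIs x hx (hsub hξ)) y (hδJ hy))).2
    have hd2 := (dq x hx).sub (dq (w i) hwi)
    have := hd.unique (hd2.congr_of_eventuallyEq (by
      filter_upwards [hJo.mem_nhds hwk] with y hy using ftc x hx y hy))
    rw [this, hWk, hWk]; simp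
  have hfin : HasDerivAt (fun x => q w + ∫ ξ in (w i)..x, q' (W ξ (w k))) (q' w) (w i) := by
    have := intervalIntegral.integral_hasDerivAt_right (a := w i) (b := w i)
      (f := fun ξ => q' (W ξ (w k))) (by simp)
      ((cq'x _ hwk).stronglyMeasurableAtFilter hIo _ hwi)
      ((cq'x _ hwk).continuousAt (hIo.mem_nhds hwi))
    simpa [hWk] using this.const_add (q w)
  exact hfin.congr_of_eventuallyEq (by filter_upwards [hIo.mem_nhds hwi] with x hx using key x hx)

theorem piecewise_mem_ball {n : ℕ} {a w : Fin n → ℝ} {r : ℝ} (hw : w ∈ Metric.ball a r)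
    (S : Finset (Fin n)) : S.piecewise w a ∈ Metric.ball a r := by
  have hr : 0 < r := Metric.pos_of_mem_ball hw
  rw [Metric.mem_ball, dist_pi_lt_iff hr] at *
  intro b
  by_cases hb : b ∈ S
  · simpa [hb] using hw b
  · simpa [hb] using hr

theorem contDiff_piecewise_const {n : ℕ} (a : Fin n → ℝ) (S : Finset (Fin n)) :
    ContDiff ℝ 1 (fun w : Fin n → ℝ => S.piecewise w a) := by
  refine contDiff_pi.2 fun i => ?_
  by_cases hi : i ∈ S
  · simpa [hi] using contDiff_apply ℝ ℝ i
  · simpa [hi] using contDiff_const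

theorem contDiffOn_comp_piecewise {n : ℕ} {a : Fin n → ℝ} {r : ℝ} {f : (Fin n → ℝ) → ℝ}
    (hf : ContDiffOn ℝ 1 f (Metric.ball a r)) (S : Finset (Fin n)) :
    ContDiffOn ℝ 1 (fun w => f (S.piecewise w a)) (Metric.ball a r) :=
  hf.comp (contDiff_piecewise_const a S).contDiffOn fun _ hw => piecewise_mem_ball hw S

theorem partialD_comp_piecewise {n : ℕ} {a : Fin n → ℝ} {r : ℝ} {f : (Fin n → ℝ) → ℝ}
    (hf : ContDiffOn ℝ 1 f (Metric.ball a r)) (S : Finset (Fin n)) (i : Fin n) {w : Fin n → ℝ}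
    (hw : w ∈ Metric.ball a r) :
    partialD i (fun w => f (S.piecewise w a)) w =
      if i ∈ S then partialD i f (S.piecewise w a) else 0 := by
  refine partialD_eq_of_hasDerivAt Metric.isOpen_ball (contDiffOn_comp_piecewise hf S) hw ?_
  split_ifs with hi
  · have e : ∀ t, S.piecewise (Function.update w i t) a = Function.update (S.piecewise w a) i t := by
      intro t
      ext j
      rcases eq_or_ne j i with rfl | hj
      · simp [hi]
      · by_cases hjS : j ∈ S <;> simp [hj, hjS]
    have hwi : w i = S.piecewise w a i := by simp [hi]
    simp only [e]
    rw [hwi]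
    have := hasDerivAt_update_of_contDiffOn Metric.isOpen_ball hf i (w := S.piecewise w a)
      (t := S.piecewise w a i) (by simpa using piecewise_mem_ball hw S)
    simpa using this
  · have e : ∀ t, S.piecewise (Function.update w i t) a = S.piecewise w a := by
      intro t
      ext j
      by_cases hjS : j ∈ S
      · have : j ≠ i := fun h => hi (h ▸ hjS)
        simp [hjS, this]
      · simp [hjS]
    simp only [e]
    exact hasDerivAt_const _ _

theorem hasDerivAt_tsum_update {n : ℕ} {a : Fin n → ℝ} {r : ℝ} {f : ℕ → (Fin n → ℝ) → ℝ}
    {u : ℕ → ℝ} (hu : Summable u) (hf : ∀ N, ContDiffOn ℝ 1 (f N) (Metric.ball a r))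
    (hb : ∀ N, ∀ w ∈ Metric.ball a r, |f N w| ≤ u N)
    (hb' : ∀ N, ∀ i, ∀ w ∈ Metric.ball a r, |partialD i (f N) w| ≤ u N)
    (i : Fin n) {w : Fin n → ℝ} (hw : w ∈ Metric.ball a r) :
    HasDerivAt (fun t => ∑' N, f N (Function.update w i t)) (∑' N, partialD i (f N) w) (w i) := by
  have hwi := apply_mem_ball_of_mem_ball_pi hw i
  have := hasDerivAt_tsum_of_isPreconnected (g := fun N t => f N (Function.update w i t))
    (g' := fun N t => partialD i (f N) (Function.update w i t)) hu
    (Metric.isOpen_ball (x := a i) (ε := r)) (convex_ball _ _).isPreconnected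
    (fun N t ht => hasDerivAt_update_of_contDiffOn Metric.isOpen_ball (hf N) i
      (update_mem_ball_pi hw ht))
    (fun N t ht => hb' N i _ (update_mem_ball_pi hw ht)) hwi
    (by
      refine Summable.of_norm_bounded hu fun N => ?_
      simpa using hb N w hw) hwi
  simpa using this

theorem contDiffOn_tsum_of_partialD_bound {n : ℕ} {a : Fin n → ℝ} {r : ℝ}
    {f : ℕ → (Fin n → ℝ) → ℝ}
    {u : ℕ → ℝ} (hu : Summable u) (hf : ∀ N, ContDiffOn ℝ 1 (f N) (Metric.ball a r))
    (hb : ∀ N, ∀ w ∈ Metric.ball a r, |f N w| ≤ u N)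
    (hb' : ∀ N, ∀ i, ∀ w ∈ Metric.ball a r, |partialD i (f N) w| ≤ u N) :
    ContDiffOn ℝ 1 (fun w => ∑' N, f N w) (Metric.ball a r) :=
  contDiffOn_one_of_partials Metric.isOpen_ball
    (fun i _ hw => hasDerivAt_tsum_update hu hf hb hb' i hw)
    fun i => continuousOn_tsum (fun N => continuousOn_partialD Metric.isOpen_ball (hf N) i) hu
      fun N w hw => hb' N i w hw


/-! ### Linearity, bounds and differentiation of coordinate primitives -/

theorem continuousOn_comp_update {n : ℕ} {a : Fin n → ℝ} {r : ℝ} {G : (Fin n → ℝ) → ℝ}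
    (hG : ContinuousOn G (Metric.ball a r)) (k : Fin n) {w : Fin n → ℝ}
    (hw : w ∈ Metric.ball a r) :
    ContinuousOn (fun s => G (Function.update w k s)) (Set.uIcc (a k) (w k)) :=
  ContinuousOn.comp (g := G) hG
    (Continuous.update (f := fun _ : ℝ => w) continuous_const k continuous_id).continuousOn
    fun _ hs => update_mem_ball_of_mem_uIcc hw hs

theorem intervalIntegrable_comp_update {n : ℕ} {a : Fin n → ℝ} {r : ℝ} {G : (Fin n → ℝ) → ℝ}
    (hG : ContinuousOn G (Metric.ball a r)) (k : Fin n) {w : Fin n → ℝ}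
    (hw : w ∈ Metric.ball a r) :
    IntervalIntegrable (fun s => G (Function.update w k s)) MeasureTheory.volume (a k) (w k) :=
  (continuousOn_comp_update hG k hw).intervalIntegrable

theorem coordPrimitive_congr {n : ℕ} {a : Fin n → ℝ} {r : ℝ} {G G' : (Fin n → ℝ) → ℝ}
    (h : ∀ z ∈ Metric.ball a r, G z = G' z) (k : Fin n) {w : Fin n → ℝ}
    (hw : w ∈ Metric.ball a r) : coordPrimitive a k G w = coordPrimitive a k G' w :=
  intervalIntegral.integral_congr fun _ hs => h _ (update_mem_ball_of_mem_uIcc hw hs)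

theorem coordPrimitive_sum {n : ℕ} {ι : Type*} {a : Fin n → ℝ} {r : ℝ}
    {G : ι → (Fin n → ℝ) → ℝ} (s : Finset ι) (hG : ∀ m, ContinuousOn (G m) (Metric.ball a r))
    (k : Fin n) {w : Fin n → ℝ} (hw : w ∈ Metric.ball a r) :
    coordPrimitive a k (fun z => ∑ m ∈ s, G m z) w = ∑ m ∈ s, coordPrimitive a k (G m) w := by
  unfold coordPrimitive
  rw [intervalIntegral.integral_finsetSum]
  exact fun m _ => intervalIntegrable_comp_update (hG m) k hw

theorem coordPrimitive_add {n : ℕ} {a : Fin n → ℝ} {r : ℝ} {F G : (Fin n → ℝ) → ℝ}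
    (hF : ContinuousOn F (Metric.ball a r)) (hG : ContinuousOn G (Metric.ball a r)) (k : Fin n)
    {w : Fin n → ℝ} (hw : w ∈ Metric.ball a r) :
    coordPrimitive a k (fun z => F z + G z) w = coordPrimitive a k F w + coordPrimitive a k G w :=
  intervalIntegral.integral_add (intervalIntegrable_comp_update hF k hw)
    (intervalIntegrable_comp_update hG k hw)

theorem abs_coordPrimitive_le {n : ℕ} {a : Fin n → ℝ} {r C : ℝ} {G : (Fin n → ℝ) → ℝ}
    (h : ∀ z ∈ Metric.ball a r, |G z| ≤ C) (k : Fin n) {w : Fin n → ℝ}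
    (hw : w ∈ Metric.ball a r) : |coordPrimitive a k G w| ≤ r * C := by
  have hwk := Metric.mem_ball.1 (apply_mem_ball_of_mem_ball_pi hw k)
  rw [Real.dist_eq] at hwk
  have hC : 0 ≤ C := (abs_nonneg _).trans (h w hw)
  have := intervalIntegral.norm_integral_le_of_norm_le_const (a := a k) (b := w k) (C := C)
    (f := fun s => G (Function.update w k s)) fun s hs =>
      h _ (update_mem_ball_of_mem_uIcc hw (Set.uIoc_subset_uIcc hs))
  calc |coordPrimitive a k G w| ≤ C * |w k - a k| := this
    _ ≤ C * r := by gcongr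
    _ = r * C := mul_comm _ _

/-- Differentiation under the integral sign. -/
theorem hasDerivAt_coordPrimitive_of_hasDerivAt {n : ℕ} {a : Fin n → ℝ} {r : ℝ}
    {q q' : (Fin n → ℝ) → ℝ} (hq : ContinuousOn q (Metric.ball a r))
    (hq' : ContinuousOn q' (Metric.ball a r)) {i k : Fin n} (hik : i ≠ k)
    (h : ∀ w ∈ Metric.ball a r, HasDerivAt (fun t => q (Function.update w i t)) (q' w) (w i))
    {w : Fin n → ℝ} (hw : w ∈ Metric.ball a r) :
    HasDerivAt (fun t => coordPrimitive a k q (Function.update w i t))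
      (coordPrimitive a k q' w) (w i) := by
  have hwi := apply_mem_ball_of_mem_ball_pi hw i
  obtain ⟨δ, hδ, hδI⟩ := Metric.nhds_basis_closedBall.mem_iff.1
    (Metric.isOpen_ball.mem_nhds hwi)
  set W : ℝ → ℝ → (Fin n → ℝ) := fun x y => Function.update (Function.update w i x) k y with hW
  have hW' : ∀ x y, W x y = Function.update (Function.update w k y) i x := fun x y =>
    Function.update_comm hik _ _ _
  have hWm : ∀ x ∈ Metric.closedBall (w i) δ, ∀ y ∈ Set.uIcc (a k) (w k),
      W x y ∈ Metric.ball a r := fun x hx y hy => by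
    refine update_mem_ball_of_mem_uIcc (update_mem_ball_pi hw (hδI hx)) ?_
    simpa [hik.symm] using hy
  have hWc : Continuous (fun z : ℝ × ℝ => W z.1 z.2) :=
    Continuous.update (f := fun z : ℝ × ℝ => Function.update w i z.1)
      (Continuous.update (f := fun _ : ℝ × ℝ => w) continuous_const i continuous_fst) k
      continuous_snd
  have hcy : ∀ {F : (Fin n → ℝ) → ℝ}, ContinuousOn F (Metric.ball a r) →
      ∀ x ∈ Metric.closedBall (w i) δ, ContinuousOn (fun y => F (W x y)) (Set.uIcc (a k) (w k)) :=
    fun {F} hF x hx => ContinuousOn.comp (g := F) (f := fun y => W x y) hF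
      (hWc.comp (Continuous.prodMk_right x)).continuousOn fun y hy => hWm x hx y hy
  have hK : IsCompact (Metric.closedBall (w i) δ ×ˢ Set.uIcc (a k) (w k)) :=
    (isCompact_closedBall _ _).prod isCompact_uIcc
  obtain ⟨C, hC⟩ := hK.exists_bound_of_continuousOn (f := fun z : ℝ × ℝ => q' (W z.1 z.2))
    (ContinuousOn.comp (g := q') (f := fun z : ℝ × ℝ => W z.1 z.2) hq' hWc.continuousOn
      fun z hz => hWm _ hz.1 _ hz.2)
  have hsub := Set.uIoc_subset_uIcc (a := a k) (b := w k)
  have hx0 : w i ∈ Metric.closedBall (w i) δ := Metric.mem_closedBall_self hδ.le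
  have hd := (intervalIntegral.hasDerivAt_integral_of_dominated_loc_of_deriv_le
    (μ := MeasureTheory.volume) (a := a k) (b := w k)
    (F := fun x y => q (W x y)) (F' := fun x y => q' (W x y))
    (x₀ := w i) (s := Metric.closedBall (w i) δ) (bound := fun _ => C)
    (Metric.closedBall_mem_nhds _ hδ)
    (by
      filter_upwards [Metric.closedBall_mem_nhds (w i) hδ] with x hx
      exact ((hcy hq x hx).mono hsub).aestronglyMeasurable measurableSet_uIoc)
    (hcy hq _ hx0).intervalIntegrable
    (((hcy hq' _ hx0).mono hsub).aestronglyMeasurable measurableSet_uIoc)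
    (Eventually.of_forall fun y hy x hx => hC (x, y) ⟨hx, hsub hy⟩)
    intervalIntegrable_const
    (Eventually.of_forall fun y hy x hx => by
      have := h _ (hWm x hx y (hsub hy))
      simp only [hW', Function.update_idem, Function.update_self] at this ⊢
      exact this)).2
  simp only [hW, Function.update_eq_self] at hd
  refine hd.congr_of_eventuallyEq (Eventually.of_forall fun t => ?_)
  simp [coordPrimitive, hik.symm]

theorem coordPrimitive_of_hasDerivAt {n : ℕ} {a : Fin n → ℝ} {r : ℝ} {g g' : (Fin n → ℝ) → ℝ}
    (hg' : ContinuousOn g' (Metric.ball a r)) {k : Fin n}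
    (h : ∀ w ∈ Metric.ball a r, HasDerivAt (fun t => g (Function.update w k t)) (g' w) (w k))
    {w : Fin n → ℝ} (hw : w ∈ Metric.ball a r) :
    coordPrimitive a k g' w = g w - g (Function.update w k (a k)) := by
  have := intervalIntegral.integral_eq_sub_of_hasDerivAt (a := a k) (b := w k)
    (f := fun s => g (Function.update w k s)) (f' := fun s => g' (Function.update w k s))
    (fun s hs => by
      have := h _ (update_mem_ball_of_mem_uIcc hw hs)
      simpa using this)
    (intervalIntegrable_comp_update hg' k hw)
  simpa [coordPrimitive] using this


/-! ### Compatible systems and estimates for the Picard operator -/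

/-- The hypotheses on the coefficients `c j k = Z^j_{jk}` under which the system
`∂ₖκʲ = c j k (κᵏ - κʲ)`, with the `κʲ` of each class of the relation `sim` identified,
is compatible. -/
structure IsCompatibleSystem {n : ℕ} (a : Fin n → ℝ) (r : ℝ) (sim : Fin n → Fin n → Prop)
    (c : Fin n → Fin n → (Fin n → ℝ) → ℝ) (L p : Fin n → Fin n → (Fin n → ℝ) → ℝ) : Prop where
  equiv : Equivalence sim
  contDiffOn_L : ∀ j m, ContDiffOn ℝ 1 (L j m) (Metric.ball a r)
  contDiffOn_p : ∀ j m, ContDiffOn ℝ 1 (p j m) (Metric.ball a r)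
  -- The coefficients are only continuous; this representation as a form L dp replaces their
  -- differentiability.
  coeff_eq : ∀ j k, ∀ w ∈ Metric.ball a r, c j k w = ∑ m, L j m w * partialD k (p j m) w
  coeff_congr : ∀ i j k, sim i j → ¬ sim j k → ∀ w ∈ Metric.ball a r, c i k w = c j k w
  -- Weak form of ∂_i c_jk = ∂_k c_ji for two directions in the same class, where κ^i = κ^k and
  -- nothing more is needed.
  closed : ∀ i j k, sim i k → ¬ sim i j → ∀ w ∈ Metric.ball a r,
    ∑ m, (partialD i (L j m) w * partialD k (p j m) w
      - partialD k (L j m) w * partialD i (p j m) w) = 0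
  -- The classical integrability condition. The disjunction, which recurs below, says that the
  -- system really prescribes ∂_i κ^j: either i ≠ j, or the class of j is nontrivial and a partner
  -- j' supplies the derivative along w^j.
  hasDerivAt_coeff : ∀ i j k, ¬ sim k i → ¬ sim k j → (i ≠ j ∨ ∃ j', j' ≠ j ∧ sim j' j) →
    ∀ w ∈ Metric.ball a r, HasDerivAt (fun t => c j k (Function.update w i t))
      (c j k w * c k i w + c j i w * (c i k w - c j k w)) (w i)

theorem IsCompatibleSystem.mono {n : ℕ} {a : Fin n → ℝ} {r r' : ℝ} {sim : Fin n → Fin n → Prop}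
    {c L p : Fin n → Fin n → (Fin n → ℝ) → ℝ} (h : IsCompatibleSystem a r sim c L p)
    (hr : r' ≤ r) : IsCompatibleSystem a r' sim c L p where
  equiv := h.equiv
  contDiffOn_L j m := (h.contDiffOn_L j m).mono (Metric.ball_subset_ball hr)
  contDiffOn_p j m := (h.contDiffOn_p j m).mono (Metric.ball_subset_ball hr)
  coeff_eq j k w hw := h.coeff_eq j k w (Metric.ball_subset_ball hr hw)
  coeff_congr i j k h1 h2 w hw := h.coeff_congr i j k h1 h2 w (Metric.ball_subset_ball hr hw)
  closed i j k h1 h2 w hw := h.closed i j k h1 h2 w (Metric.ball_subset_ball hr hw)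
  hasDerivAt_coeff i j k h1 h2 h3 w hw :=
    h.hasDerivAt_coeff i j k h1 h2 h3 w (Metric.ball_subset_ball hr hw)

theorem IsCompatibleSystem.continuousOn_coeff {n : ℕ} {a : Fin n → ℝ} {r : ℝ}
    {sim : Fin n → Fin n → Prop} {c L p : Fin n → Fin n → (Fin n → ℝ) → ℝ}
    (h : IsCompatibleSystem a r sim c L p) (j k : Fin n) :
    ContinuousOn (c j k) (Metric.ball a r) :=
  (continuousOn_finsetSum _ fun m _ => (h.contDiffOn_L j m).continuousOn.mul
    (continuousOn_partialD Metric.isOpen_ball (h.contDiffOn_p j m) k)).congr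
    fun w hw => h.coeff_eq j k w hw

open Classical in
/-- The first `N` coordinates together with those equivalent to `j`. -/
noncomputable def keepSet {n : ℕ} (sim : Fin n → Fin n → Prop) (j : Fin n) (N : ℕ) :
    Finset (Fin n) :=
  Finset.univ.filter fun i => i.val < N ∨ sim j i

open Classical in
/-- The Picard operator of the system `∂ₖκʲ = c j k (κᵏ - κʲ)`: integration along the polygonal path
that switches on the coordinates not equivalent to `j` one after the other. -/
noncomputable def picardOp {n : ℕ} (a : Fin n → ℝ) (sim : Fin n → Fin n → Prop)
    (L p : Fin n → Fin n → (Fin n → ℝ) → ℝ) (h : Fin n → (Fin n → ℝ) → ℝ) (j : Fin n)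
    (w : Fin n → ℝ) : ℝ :=
  ∑ k with ¬ sim j k, ∑ m, coordPrimitive a k
    (fun z => ((h k z - h j z) * L j m z) * partialD k (p j m) z)
    ((keepSet sim j (k.val + 1)).piecewise w a)

theorem contDiffOn_picardOp {n : ℕ} {a : Fin n → ℝ} {r : ℝ} {sim : Fin n → Fin n → Prop}
    {L p : Fin n → Fin n → (Fin n → ℝ) → ℝ} {h : Fin n → (Fin n → ℝ) → ℝ}
    (hL : ∀ j m, ContDiffOn ℝ 1 (L j m) (Metric.ball a r))
    (hp : ∀ j m, ContDiffOn ℝ 1 (p j m) (Metric.ball a r))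
    (hh : ∀ j, ContDiffOn ℝ 1 (h j) (Metric.ball a r)) (j : Fin n) :
    ContDiffOn ℝ 1 (picardOp a sim L p h j) (Metric.ball a r) :=
  ContDiffOn.sum fun k _ => ContDiffOn.sum fun m _ => contDiffOn_comp_piecewise
    (contDiffOn_coordPrimitive (((hh k).sub (hh j)).mul (hL j m)) (hp j m) k) _

theorem partialD_sum {n : ℕ} {ι : Type*} {U : Set (Fin n → ℝ)} (hU : IsOpen U) (s : Finset ι)
    {f : ι → (Fin n → ℝ) → ℝ} (hf : ∀ m ∈ s, ContDiffOn ℝ 1 (f m) U) (i : Fin n)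
    {w : Fin n → ℝ} (hw : w ∈ U) :
    partialD i (fun z => ∑ m ∈ s, f m z) w = ∑ m ∈ s, partialD i (f m) w := by
  unfold partialD
  rw [fderiv_fun_sum fun m hm =>
    ((hf m hm).differentiableOn one_ne_zero).differentiableAt (hU.mem_nhds hw)]
  simp

theorem partialD_mul {n : ℕ} {U : Set (Fin n → ℝ)} (hU : IsOpen U) {f g : (Fin n → ℝ) → ℝ}
    (hf : ContDiffOn ℝ 1 f U) (hg : ContDiffOn ℝ 1 g U) (i : Fin n) {w : Fin n → ℝ} (hw : w ∈ U) :
    partialD i (fun z => f z * g z) w = f w * partialD i g w + g w * partialD i f w := by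
  unfold partialD
  rw [fderiv_fun_mul ((hf.differentiableOn one_ne_zero).differentiableAt (hU.mem_nhds hw))
    ((hg.differentiableOn one_ne_zero).differentiableAt (hU.mem_nhds hw))]
  simp

theorem partialD_sub {n : ℕ} {U : Set (Fin n → ℝ)} (hU : IsOpen U) {f g : (Fin n → ℝ) → ℝ}
    (hf : ContDiffOn ℝ 1 f U) (hg : ContDiffOn ℝ 1 g U) (i : Fin n) {w : Fin n → ℝ} (hw : w ∈ U) :
    partialD i (fun z => f z - g z) w = partialD i f w - partialD i g w := by
  unfold partialD
  rw [fderiv_fun_sub ((hf.differentiableOn one_ne_zero).differentiableAt (hU.mem_nhds hw))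
    ((hg.differentiableOn one_ne_zero).differentiableAt (hU.mem_nhds hw))]
  simp

theorem abs_coordPrimitiveDeriv_le {n : ℕ} {a : Fin n → ℝ} {r A A' M : ℝ}
    {f g : (Fin n → ℝ) → ℝ} (hf : ∀ z ∈ Metric.ball a r, |f z| ≤ A)
    (hf' : ∀ i, ∀ z ∈ Metric.ball a r, |partialD i f z| ≤ A')
    (hg' : ∀ i, ∀ z ∈ Metric.ball a r, |partialD i g z| ≤ M) (k i : Fin n) {w : Fin n → ℝ}
    (hw : w ∈ Metric.ball a r) :
    |coordPrimitiveDeriv a k f g i w| ≤ 2 * A * M + r * (2 * A' * M) := by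
  have hr : 0 < r := Metric.pos_of_mem_ball hw
  have hA : 0 ≤ A := (abs_nonneg _).trans (hf w hw)
  have hA' : 0 ≤ A' := (abs_nonneg _).trans (hf' i w hw)
  have hM : 0 ≤ M := (abs_nonneg _).trans (hg' i w hw)
  have hfg : ∀ i, ∀ z ∈ Metric.ball a r, |f z * partialD i g z| ≤ A * M := fun i z hz => by
    rw [abs_mul]; exact mul_le_mul (hf z hz) (hg' i z hz) (abs_nonneg _) hA
  have hfg' : ∀ i k, ∀ z ∈ Metric.ball a r, |partialD i f z * partialD k g z| ≤ A' * M :=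
    fun i k z hz => by
      rw [abs_mul]; exact mul_le_mul (hf' i z hz) (hg' k z hz) (abs_nonneg _) hA'
  unfold coordPrimitiveDeriv
  split_ifs
  · have := hfg k w hw
    have h1 : 0 ≤ A * M := by positivity
    have h2 : 0 ≤ r * (2 * A' * M) := by positivity
    linarith
  · refine (abs_add_le _ _).trans (add_le_add ?_ (abs_coordPrimitive_le (fun z hz => ?_) k hw))
    · refine (abs_sub _ _).trans ?_
      have h1 := hfg i w hw
      have h2 := hfg i _ (update_self_mem_ball hw k)
      linarith
    · refine (abs_sub _ _).trans ?_
      have h1 := hfg' i k z hz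
      have h2 := hfg' k i z hz
      linarith

/-- Each primitive contributes a factor r and there are at most n² of them, so on a small ball the
operator halves the sup bound. -/
theorem abs_picardOp_le {n : ℕ} {a : Fin n → ℝ} {r A M : ℝ} {sim : Fin n → Fin n → Prop}
    {L p : Fin n → Fin n → (Fin n → ℝ) → ℝ} {h : Fin n → (Fin n → ℝ) → ℝ}
    (hLM : ∀ j m, ∀ z ∈ Metric.ball a r, |L j m z| ≤ M)
    (hpM : ∀ j m i, ∀ z ∈ Metric.ball a r, |partialD i (p j m) z| ≤ M)
    (hr : r * (n ^ 2 * M ^ 2) ≤ 1 / 32)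
    (hhA : ∀ j, ∀ z ∈ Metric.ball a r, |h j z| ≤ A) (j : Fin n) {w : Fin n → ℝ}
    (hw : w ∈ Metric.ball a r) : |picardOp a sim L p h j w| ≤ A / 2 := by
  have hA : 0 ≤ A := (abs_nonneg _).trans (hhA j w hw)
  have hM : 0 ≤ M := (abs_nonneg _).trans (hLM j j w hw)
  have h1 : ∀ k m, |coordPrimitive a k
      (fun z => ((h k z - h j z) * L j m z) * partialD k (p j m) z)
      ((keepSet sim j (k.val + 1)).piecewise w a)| ≤ r * (2 * A * M * M) := by
    intro k m
    refine abs_coordPrimitive_le (fun z hz => ?_) k (piecewise_mem_ball hw _)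
    have : |h k z - h j z| ≤ 2 * A := (abs_sub _ _).trans (by linarith [hhA k z hz, hhA j z hz])
    rw [abs_mul, abs_mul]
    have := hLM j m z hz
    have := hpM j m k z hz
    gcongr
  have h0 : 0 ≤ r * (2 * A * M * M) := (abs_nonneg _).trans (h1 j j)
  classical
  calc |picardOp a sim L p h j w| ≤ ∑ k with ¬ sim j k, ∑ m : Fin n, r * (2 * A * M * M) := by
        refine (Finset.abs_sum_le_sum_abs _ _).trans (Finset.sum_le_sum fun k _ => ?_)
        exact (Finset.abs_sum_le_sum_abs _ _).trans (Finset.sum_le_sum fun m _ => h1 k m)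
    _ ≤ ∑ k : Fin n, ∑ m : Fin n, r * (2 * A * M * M) := by
        refine Finset.sum_le_sum_of_subset_of_nonneg (Finset.subset_univ _) fun k _ _ => ?_
        exact Finset.sum_nonneg fun _ _ => h0
    _ = 2 * A * (r * (n ^ 2 * M ^ 2)) := by simp; ring
    _ ≤ 2 * A * (1 / 32) := by gcongr
    _ ≤ A / 2 := by linarith

/-- The boundary terms of the differentiated primitive carry no factor r, but they involve only the
values of h, not its derivatives. Weighting derivative bounds by K = 16 n² M² + 1 makes these terms
at most K A / 4; the integral terms, small with r, give another K A / 4. So the derivative bound is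
halved as well. -/
theorem abs_partialD_picardOp_le {n : ℕ} {a : Fin n → ℝ} {r A M : ℝ}
    {sim : Fin n → Fin n → Prop}
    {L p : Fin n → Fin n → (Fin n → ℝ) → ℝ} {h : Fin n → (Fin n → ℝ) → ℝ}
    (hL : ∀ j m, ContDiffOn ℝ 1 (L j m) (Metric.ball a r))
    (hp : ∀ j m, ContDiffOn ℝ 1 (p j m) (Metric.ball a r))
    (hh : ∀ j, ContDiffOn ℝ 1 (h j) (Metric.ball a r))
    (hLM : ∀ j m, ∀ z ∈ Metric.ball a r, |L j m z| ≤ M)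
    (hLM' : ∀ j m i, ∀ z ∈ Metric.ball a r, |partialD i (L j m) z| ≤ M)
    (hpM : ∀ j m i, ∀ z ∈ Metric.ball a r, |partialD i (p j m) z| ≤ M)
    (hr : r * (n ^ 2 * M ^ 2) ≤ 1 / 32)
    (hhA : ∀ j, ∀ z ∈ Metric.ball a r, |h j z| ≤ A)
    (hhA' : ∀ j i, ∀ z ∈ Metric.ball a r, |partialD i (h j) z| ≤ (16 * (n ^ 2 * M ^ 2) + 1) * A)
    (j i : Fin n) {w : Fin n → ℝ} (hw : w ∈ Metric.ball a r) :
    |partialD i (picardOp a sim L p h j) w| ≤ (16 * (n ^ 2 * M ^ 2) + 1) * (A / 2) := by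
  have hB : IsOpen (Metric.ball a r) := Metric.isOpen_ball
  have hr0 : 0 < r := Metric.pos_of_mem_ball hw
  have hA : 0 ≤ A := (abs_nonneg _).trans (hhA j w hw)
  have hM : 0 ≤ M := (abs_nonneg _).trans (hLM j j w hw)
  set K := 16 * ((n : ℝ) ^ 2 * M ^ 2) + 1 with hK
  have hK1 : 1 ≤ K := by rw [hK]; have : 0 ≤ 16 * ((n : ℝ) ^ 2 * M ^ 2) := by positivity
                         linarith
  have hsub : ∀ k, ∀ z ∈ Metric.ball a r, |h k z - h j z| ≤ 2 * A := fun k z hz =>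
    (abs_sub _ _).trans (by linarith [hhA k z hz, hhA j z hz])
  have hfC : ∀ k m, ContDiffOn ℝ 1 (fun z => (h k z - h j z) * L j m z) (Metric.ball a r) :=
    fun k m => ((hh k).sub (hh j)).mul (hL j m)
  set E := 2 * (2 * A * M) * M + r * (2 * (4 * K * A * M) * M) with hE
  have hE0 : 0 ≤ E := by positivity
  have h1 : ∀ k m, |partialD i (fun w => coordPrimitive a k
      (fun z => ((h k z - h j z) * L j m z) * partialD k (p j m) z)
      ((keepSet sim j (k.val + 1)).piecewise w a)) w| ≤ E := by
    intro k m
    rw [partialD_comp_piecewise (contDiffOn_coordPrimitive (hfC k m) (hp j m) k) _ i hw]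
    split_ifs
    · rw [partialD_coordPrimitive (hfC k m) (hp j m) k i (piecewise_mem_ball hw _)]
      refine abs_coordPrimitiveDeriv_le (fun z hz => ?_) (fun i z hz => ?_) (hpM j m) k i
        (piecewise_mem_ball hw _)
      · rw [abs_mul]
        exact mul_le_mul (hsub k z hz) (hLM j m z hz) (abs_nonneg _) (by positivity)
      · rw [partialD_mul hB ((hh k).sub (hh j)) (hL j m) i hz, partialD_sub hB (hh k) (hh j) i hz]
        have e1 : |partialD i (h k) z - partialD i (h j) z| ≤ 2 * (K * A) :=
          (abs_sub _ _).trans (by linarith [hhA' k i z hz, hhA' j i z hz])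
        have e2 := hsub k z hz
        have e3 := hLM j m z hz
        have e4 := hLM' j m i z hz
        calc _ ≤ |(h k z - h j z)| * |partialD i (L j m) z| +
              |L j m z| * |partialD i (h k) z - partialD i (h j) z| := by
              refine (abs_add_le _ _).trans ?_
              rw [abs_mul, abs_mul]
          _ ≤ 2 * A * M + M * (2 * (K * A)) := by gcongr
          _ ≤ 2 * (K * A) * M + M * (2 * (K * A)) := by
              gcongr; nlinarith
          _ = 4 * K * A * M := by ring
    · simpa using hE0
  classical
  have h2 : partialD i (picardOp a sim L p h j) w = ∑ k with ¬ sim j k, ∑ m,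
      partialD i (fun w => coordPrimitive a k
        (fun z => ((h k z - h j z) * L j m z) * partialD k (p j m) z)
        ((keepSet sim j (k.val + 1)).piecewise w a)) w := by
    have hC := fun k m => contDiffOn_comp_piecewise
      (contDiffOn_coordPrimitive (hfC k m) (hp j m) k) (keepSet sim j (k.val + 1))
    unfold picardOp
    rw [partialD_sum hB _ (fun k _ => ContDiffOn.sum fun m _ => hC k m) i hw]
    exact Finset.sum_congr rfl fun k _ => partialD_sum hB _ (fun m _ => hC k m) i hw
  calc |partialD i (picardOp a sim L p h j) w| ≤ ∑ k with ¬ sim j k, ∑ m : Fin n, E := by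
        rw [h2]
        refine (Finset.abs_sum_le_sum_abs _ _).trans (Finset.sum_le_sum fun k _ => ?_)
        exact (Finset.abs_sum_le_sum_abs _ _).trans (Finset.sum_le_sum fun m _ => h1 k m)
    _ ≤ ∑ k : Fin n, ∑ m : Fin n, E := by
        refine Finset.sum_le_sum_of_subset_of_nonneg (Finset.subset_univ _) fun k _ _ => ?_
        exact Finset.sum_nonneg fun _ _ => hE0
    _ = 4 * (n ^ 2 * M ^ 2) * A + 8 * (K * A) * (r * (n ^ 2 * M ^ 2)) := by simp [hE]; ring
    _ ≤ (K / 4) * A + 8 * (K * A) * (1 / 32) := by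
        gcongr
        rw [hK]; linarith
    _ = K * (A / 2) := by ring


/-! ### Fixed point of the Picard operator -/

section
variable {n : ℕ} {a : Fin n → ℝ} {r : ℝ} {sim : Fin n → Fin n → Prop}
  {c L p : Fin n → Fin n → (Fin n → ℝ) → ℝ}

open Classical in
theorem IsCompatibleSystem.picardOp_eq (hs : IsCompatibleSystem a r sim c L p)
    {h : Fin n → (Fin n → ℝ) → ℝ} (hh : ∀ j, ContinuousOn (h j) (Metric.ball a r)) (j : Fin n)
    {w : Fin n → ℝ} (hw : w ∈ Metric.ball a r) :
    picardOp a sim L p h j w = ∑ k with ¬ sim j k,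
      coordPrimitive a k (fun z => c j k z * (h k z - h j z))
        ((keepSet sim j (k.val + 1)).piecewise w a) := by
  refine Finset.sum_congr rfl fun k _ => ?_
  rw [← coordPrimitive_sum (r := r) Finset.univ
    (G := fun m z => ((h k z - h j z) * L j m z) * partialD k (p j m) z)
    (fun m => (((hh k).sub (hh j)).mul (hs.contDiffOn_L j m).continuousOn).mul
      (continuousOn_partialD Metric.isOpen_ball (hs.contDiffOn_p j m) k)) k
    (piecewise_mem_ball hw _)]
  refine coordPrimitive_congr (fun z hz => ?_) k (piecewise_mem_ball hw _)
  rw [hs.coeff_eq j k z hz, Finset.sum_mul]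
  exact Finset.sum_congr rfl fun m _ => by ring

theorem keepSet_congr (hs : Equivalence sim) {i j : Fin n} (hij : sim i j) (N : ℕ) :
    keepSet sim i N = keepSet sim j N := by
  ext l
  simp only [keepSet, Finset.mem_filter, Finset.mem_univ, true_and]
  exact or_congr_right ⟨fun h => hs.trans (hs.symm hij) h, fun h => hs.trans hij h⟩

/-- The path depends only on the class of j, and `coeff_congr` makes the integrands agree. So the
iteration preserves the identification of the κ's within a class. -/
theorem IsCompatibleSystem.picardOp_congr (hs : IsCompatibleSystem a r sim c L p)
    {h : Fin n → (Fin n → ℝ) → ℝ} (hh : ∀ j, ContinuousOn (h j) (Metric.ball a r))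
    {i j : Fin n} (hij : sim i j) (hhij : ∀ w ∈ Metric.ball a r, h i w = h j w)
    {w : Fin n → ℝ} (hw : w ∈ Metric.ball a r) :
    picardOp a sim L p h i w = picardOp a sim L p h j w := by
  classical
  rw [hs.picardOp_eq hh i hw, hs.picardOp_eq hh j hw]
  have hf : (Finset.univ.filter fun k => ¬ sim i k) = Finset.univ.filter fun k => ¬ sim j k := by
    ext k
    simp only [Finset.mem_filter, Finset.mem_univ, true_and]
    exact not_congr ⟨fun h => hs.equiv.trans (hs.equiv.symm hij) h,
      fun h => hs.equiv.trans hij h⟩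
  rw [hf]
  refine Finset.sum_congr rfl fun k hk => ?_
  rw [keepSet_congr hs.equiv hij]
  refine coordPrimitive_congr (fun z hz => ?_) k (piecewise_mem_ball hw _)
  rw [hhij z hz, hs.coeff_congr i j k hij (by simpa using hk) z hz]

theorem hasSum_coordPrimitive {G : ℕ → (Fin n → ℝ) → ℝ} {u : ℕ → ℝ} (hu : Summable u)
    (hG : ∀ N, ContinuousOn (G N) (Metric.ball a r))
    (hb : ∀ N, ∀ z ∈ Metric.ball a r, |G N z| ≤ u N) (k : Fin n) {w : Fin n → ℝ}
    (hw : w ∈ Metric.ball a r) :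
    HasSum (fun N => coordPrimitive a k (G N) w) (coordPrimitive a k (fun z => ∑' N, G N z) w) := by
  have hsub := Set.uIoc_subset_uIcc (a := a k) (b := w k)
  refine intervalIntegral.hasSum_integral_of_dominated_convergence (fun N _ => u N)
    (fun N => ((continuousOn_comp_update (hG N) k hw).mono hsub).aestronglyMeasurable
      measurableSet_uIoc)
    (fun N => Eventually.of_forall fun s hs => ?_) (Eventually.of_forall fun _ _ => hu)
    intervalIntegrable_const (Eventually.of_forall fun s hs => ?_)
  · exact hb N _ (update_mem_ball_of_mem_uIcc hw (hsub hs))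
  · exact (Summable.of_norm_bounded hu fun N =>
      hb N _ (update_mem_ball_of_mem_uIcc hw (hsub hs))).hasSum

/-- The operator is linear in h, so the fixed point is the Neumann series ∑ T^N ψ. The N-th term and
its partial derivatives are bounded by a multiple of 2^(-N), hence the sum is C¹ and T may be
applied termwise. -/
theorem IsCompatibleSystem.exists_picard_fixedPoint (hs : IsCompatibleSystem a r sim c L p)
    {A M : ℝ} (hLM : ∀ j m, ∀ z ∈ Metric.ball a r, |L j m z| ≤ M)
    (hLM' : ∀ j m i, ∀ z ∈ Metric.ball a r, |partialD i (L j m) z| ≤ M)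
    (hpM : ∀ j m i, ∀ z ∈ Metric.ball a r, |partialD i (p j m) z| ≤ M)
    (hr : r * (n ^ 2 * M ^ 2) ≤ 1 / 32)
    {ψ : Fin n → (Fin n → ℝ) → ℝ} (hψ : ∀ j, ContDiffOn ℝ 1 (ψ j) (Metric.ball a r))
    (hψA : ∀ j, ∀ z ∈ Metric.ball a r, |ψ j z| ≤ A)
    (hψA' : ∀ j i, ∀ z ∈ Metric.ball a r, |partialD i (ψ j) z| ≤ A)
    (hψs : ∀ i j, sim i j → ∀ w ∈ Metric.ball a r, ψ i w = ψ j w) :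
    ∃ κ : Fin n → (Fin n → ℝ) → ℝ, (∀ j, ContDiffOn ℝ 1 (κ j) (Metric.ball a r)) ∧
      (∀ j, ∀ w ∈ Metric.ball a r, κ j w = ψ j w + picardOp a sim L p κ j w) ∧
      (∀ i j, sim i j → ∀ w ∈ Metric.ball a r, κ i w = κ j w) := by
  set K := 16 * ((n : ℝ) ^ 2 * M ^ 2) + 1 with hK
  have hK1 : 1 ≤ K := by
    have : 0 ≤ 16 * ((n : ℝ) ^ 2 * M ^ 2) := by positivity
    rw [hK]; linarith
  set H : ℕ → Fin n → (Fin n → ℝ) → ℝ := fun N => (picardOp a sim L p)^[N] ψ with hH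
  have hHs : ∀ N, H (N + 1) = picardOp a sim L p (H N) := fun N =>
    Function.iterate_succ_apply' _ _ _
  have hHC : ∀ N j, ContDiffOn ℝ 1 (H N j) (Metric.ball a r) := by
    intro N
    induction N with
    | zero => exact hψ
    | succ N ih =>
      intro j; rw [hHs]
      exact contDiffOn_picardOp hs.contDiffOn_L hs.contDiffOn_p ih j
  have hHb : ∀ N, (∀ j, ∀ z ∈ Metric.ball a r, |H N j z| ≤ A * (1 / 2) ^ N) ∧
      ∀ j i, ∀ z ∈ Metric.ball a r, |partialD i (H N j) z| ≤ K * (A * (1 / 2) ^ N) := by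
    intro N
    induction N with
    | zero =>
      refine ⟨fun j z hz => by simpa [hH] using hψA j z hz, fun j i z hz => ?_⟩
      have hA : 0 ≤ A := (abs_nonneg _).trans (hψA j z hz)
      refine (hψA' j i z hz).trans ?_
      simp only [pow_zero, mul_one]
      nlinarith
    | succ N ih =>
      have e : A * (1 / 2) ^ (N + 1) = A * (1 / 2) ^ N / 2 := by ring
      rw [hHs, e]
      exact ⟨fun j z hz => abs_picardOp_le hLM hpM hr ih.1 j hz, fun j i z hz =>
        abs_partialD_picardOp_le hs.contDiffOn_L hs.contDiffOn_p (hHC N) hLM hLM' hpM hr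
          ih.1 ih.2 j i hz⟩
  have hHcongr : ∀ N i j, sim i j → ∀ w ∈ Metric.ball a r, H N i w = H N j w := by
    intro N
    induction N with
    | zero => exact hψs
    | succ N ih =>
      intro i j hij w hw
      rw [hHs]
      exact hs.picardOp_congr (fun j => (hHC N j).continuousOn) hij (ih i j hij) hw
  have hgeo : Summable fun N : ℕ => K * (A * (1 / 2 : ℝ) ^ N) :=
    ((summable_geometric_of_lt_one (by norm_num) (by norm_num)).mul_left A).mul_left K
  have hb1 : ∀ N j, ∀ z ∈ Metric.ball a r, |H N j z| ≤ K * (A * (1 / 2) ^ N) := by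
    intro N j z hz
    have := (hHb N).1 j z hz
    have h0 := (abs_nonneg _).trans this
    nlinarith
  have hsumm : ∀ j, ∀ w ∈ Metric.ball a r, Summable fun N => H N j w := fun j w hw =>
    Summable.of_norm_bounded hgeo fun N => hb1 N j w hw
  set κ : Fin n → (Fin n → ℝ) → ℝ := fun j w => ∑' N, H N j w with hκ
  have hκC : ∀ j, ContDiffOn ℝ 1 (κ j) (Metric.ball a r) := fun j =>
    contDiffOn_tsum_of_partialD_bound hgeo (fun N => hHC N j) (fun N => hb1 N j)
      fun N => (hHb N).2 j
  refine ⟨κ, hκC, fun j w hw => ?_, fun i j hij w hw => tsum_congr fun N => hHcongr N i j hij w hw⟩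
  have hS : HasSum (fun N => picardOp a sim L p (H N) j w) (picardOp a sim L p κ j w) := by
    refine hasSum_sum fun k _ => hasSum_sum fun m _ => ?_
    have hbd : ∀ N, ∀ z ∈ Metric.ball a r,
        |((H N k z - H N j z) * L j m z) * partialD k (p j m) z| ≤
          2 * (K * (A * (1 / 2) ^ N)) * M * M := by
      intro N z hz
      have h1 : |H N k z - H N j z| ≤ 2 * (K * (A * (1 / 2) ^ N)) :=
        (abs_sub _ _).trans (by linarith [hb1 N k z hz, hb1 N j z hz])
      rw [abs_mul, abs_mul]
      have h2 := hLM j m z hz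
      have h3 := hpM j m k z hz
      have h4 := (abs_nonneg _).trans h2
      have h5 := (abs_nonneg _).trans h1
      gcongr
    have hfin := hasSum_coordPrimitive (a := a) (r := r)
      (G := fun N z => ((H N k z - H N j z) * L j m z) * partialD k (p j m) z)
      (((hgeo.mul_left 2).mul_right M).mul_right M)
      (fun N => ((((hHC N k).continuousOn.sub (hHC N j).continuousOn)).mul
        (hs.contDiffOn_L j m).continuousOn).mul
          (continuousOn_partialD Metric.isOpen_ball (hs.contDiffOn_p j m) k))
      hbd k (piecewise_mem_ball hw (keepSet sim j (k.val + 1)))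
    convert hfin using 1
    refine coordPrimitive_congr (fun z hz => ?_) k (piecewise_mem_ball hw _)
    rw [tsum_mul_right, tsum_mul_right, (hsumm k z hz).tsum_sub (hsumm j z hz)]
  change ∑' N, H N j w = _
  rw [(hsumm j w hw).tsum_eq_zero_add]
  congr 1
  rw [← hS.tsum_eq]
  exact tsum_congr fun N => by rw [hHs]
end


/-! ### Defects of the equations and their transport along the path -/

theorem partialD_congr {n : ℕ} {U : Set (Fin n → ℝ)} (hU : IsOpen U) {f g : (Fin n → ℝ) → ℝ}
    (h : ∀ w ∈ U, f w = g w) (i : Fin n) {w : Fin n → ℝ} (hw : w ∈ U) :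
    partialD i f w = partialD i g w := by
  have : f =ᶠ[𝓝 w] g := by filter_upwards [hU.mem_nhds hw] with z hz using h z hz
  unfold partialD
  rw [this.fderiv_eq]

theorem partialD_add {n : ℕ} {U : Set (Fin n → ℝ)} (hU : IsOpen U) {f g : (Fin n → ℝ) → ℝ}
    (hf : ContDiffOn ℝ 1 f U) (hg : ContDiffOn ℝ 1 g U) (i : Fin n) {w : Fin n → ℝ} (hw : w ∈ U) :
    partialD i (fun z => f z + g z) w = partialD i f w + partialD i g w := by
  unfold partialD
  rw [fderiv_fun_add ((hf.differentiableOn one_ne_zero).differentiableAt (hU.mem_nhds hw))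
    ((hg.differentiableOn one_ne_zero).differentiableAt (hU.mem_nhds hw))]
  simp

/-- The defect of the equation `∂ᵢκʲ = c j i (κⁱ - κʲ)`. -/
noncomputable def lambdaDefect {n : ℕ} (c : Fin n → Fin n → (Fin n → ℝ) → ℝ)
    (κ : Fin n → (Fin n → ℝ) → ℝ) (j i : Fin n) (w : Fin n → ℝ) : ℝ :=
  partialD i (κ j) w - c j i w * (κ i w - κ j w)

section
variable {n : ℕ} {a : Fin n → ℝ} {r : ℝ} {sim : Fin n → Fin n → Prop}
  {c L p : Fin n → Fin n → (Fin n → ℝ) → ℝ} {κ : Fin n → (Fin n → ℝ) → ℝ}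

theorem mem_keepSet {i j : Fin n} {N : ℕ} : i ∈ keepSet sim j N ↔ i.val < N ∨ sim j i := by
  simp [keepSet]

theorem coordPrimitive_of_apply_eq {k : Fin n} {G : (Fin n → ℝ) → ℝ} {w : Fin n → ℝ}
    (h : w k = a k) : coordPrimitive a k G w = 0 := by
  simp [coordPrimitive, h]

theorem piecewise_keepSet_piecewise_keepSet {j : Fin n} {M N : ℕ} (h : M ≤ N) (w : Fin n → ℝ) :
    (keepSet sim j M).piecewise ((keepSet sim j N).piecewise w a) a =
      (keepSet sim j M).piecewise w a := by
  ext i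
  by_cases hi : i ∈ keepSet sim j M
  · have : i ∈ keepSet sim j N := by
      rw [mem_keepSet] at *
      exact hi.imp_left fun h' => h'.trans_le h
    simp [hi, this]
  · simp [hi]

theorem update_piecewise_keepSet {j k : Fin n} (hjk : ¬ sim j k) (w : Fin n → ℝ) :
    Function.update ((keepSet sim j (k.val + 1)).piecewise w a) k (a k) =
      (keepSet sim j k.val).piecewise w a := by
  ext i
  rcases eq_or_ne i k with rfl | hik
  · have : i ∉ keepSet sim j i.val := by simp [mem_keepSet, hjk]
    simp [this]
  · have : i ∈ keepSet sim j (k.val + 1) ↔ i ∈ keepSet sim j k.val := by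
      rw [mem_keepSet, mem_keepSet]
      have : i.val ≠ k.val := fun h => hik (Fin.ext h)
      refine or_congr_left ⟨fun h => by omega, fun h => by omega⟩
    by_cases hi : i ∈ keepSet sim j k.val
    · simp [hik, hi, this.2 hi]
    · simp [hik, hi, mt this.1 hi]

/-- At a stage-N point the coordinates l ≥ N outside the class of j still equal a^l, so their
primitives vanish. Passing from stage k to k + 1 therefore adds exactly one primitive. -/
theorem IsCompatibleSystem.picardOp_step (hs : IsCompatibleSystem a r sim c L p)
    (hκ : ∀ j, ContDiffOn ℝ 1 (κ j) (Metric.ball a r)) {j k : Fin n} (hjk : ¬ sim j k)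
    {w : Fin n → ℝ} (hw : w ∈ Metric.ball a r) :
    picardOp a sim L p κ j ((keepSet sim j (k.val + 1)).piecewise w a) =
      picardOp a sim L p κ j ((keepSet sim j k.val).piecewise w a) +
      coordPrimitive a k (fun z => c j k z * (κ k z - κ j z))
        ((keepSet sim j (k.val + 1)).piecewise w a) := by
  classical
  set F : Fin n → (Fin n → ℝ) → ℝ := fun l =>
    coordPrimitive a l (fun z => c j l z * (κ l z - κ j z)) with hF
  have key : ∀ N : ℕ, picardOp a sim L p κ j ((keepSet sim j N).piecewise w a) =
      ∑ l with ¬ sim j l, if l.val < N then F l ((keepSet sim j (l.val + 1)).piecewise w a)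
        else 0 := by
    intro N
    rw [hs.picardOp_eq (fun j => (hκ j).continuousOn) j (piecewise_mem_ball hw _)]
    refine Finset.sum_congr rfl fun l hl => ?_
    have hl : ¬ sim j l := by simpa using hl
    split_ifs with hlN
    · rw [piecewise_keepSet_piecewise_keepSet hlN]
    · refine coordPrimitive_of_apply_eq ?_
      have : l ∉ keepSet sim j N := by simp [mem_keepSet, hl]; omega
      by_cases h' : l ∈ keepSet sim j (l.val + 1) <;> simp [h', this]
  rw [key, key]
  have hsplit : ∀ l : Fin n, (if l.val < k.val + 1 then
      F l ((keepSet sim j (l.val + 1)).piecewise w a) else 0) =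
      (if l.val < k.val then F l ((keepSet sim j (l.val + 1)).piecewise w a) else 0) +
      (if l = k then F k ((keepSet sim j (k.val + 1)).piecewise w a) else 0) := by
    intro l
    rcases eq_or_ne l k with rfl | hlk
    · simp
    · have : l.val ≠ k.val := fun h => hlk (Fin.ext h)
      have h2 : l.val < k.val + 1 ↔ l.val < k.val := by omega
      simp [hlk, h2]
  rw [Finset.sum_congr rfl fun l _ => hsplit l, Finset.sum_add_distrib]
  congr 1
  simp [hjk, hF]

theorem IsCompatibleSystem.coordPrimitive_eq_sum (hs : IsCompatibleSystem a r sim c L p)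
    (hκ : ∀ j, ContDiffOn ℝ 1 (κ j) (Metric.ball a r)) (j k : Fin n)
    {w : Fin n → ℝ} (hw : w ∈ Metric.ball a r) :
    coordPrimitive a k (fun z => c j k z * (κ k z - κ j z)) w =
      ∑ m, coordPrimitive a k (fun z => ((κ k z - κ j z) * L j m z) * partialD k (p j m) z) w := by
  rw [← coordPrimitive_sum (r := r) Finset.univ
    (G := fun m z => ((κ k z - κ j z) * L j m z) * partialD k (p j m) z)
    (fun m => (((hκ k).continuousOn.sub (hκ j).continuousOn).mul
      (hs.contDiffOn_L j m).continuousOn).mul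
      (continuousOn_partialD Metric.isOpen_ball (hs.contDiffOn_p j m) k)) k hw]
  refine coordPrimitive_congr (fun z hz => ?_) k hw
  rw [hs.coeff_eq j k z hz, Finset.sum_mul]
  exact Finset.sum_congr rfl fun m _ => by ring

theorem IsCompatibleSystem.contDiffOn_coordPrimitive (hs : IsCompatibleSystem a r sim c L p)
    (hκ : ∀ j, ContDiffOn ℝ 1 (κ j) (Metric.ball a r)) (j k : Fin n) :
    ContDiffOn ℝ 1 (coordPrimitive a k (fun z => c j k z * (κ k z - κ j z)))
      (Metric.ball a r) :=
  (ContDiffOn.sum fun m _ => _root_.contDiffOn_coordPrimitive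
    (((hκ k).sub (hκ j)).mul (hs.contDiffOn_L j m)) (hs.contDiffOn_p j m) k).congr
    fun _ hw => hs.coordPrimitive_eq_sum hκ j k hw

theorem IsCompatibleSystem.partialD_coordPrimitive_eq_sum
    (hs : IsCompatibleSystem a r sim c L p)
    (hκ : ∀ j, ContDiffOn ℝ 1 (κ j) (Metric.ball a r)) (j k i : Fin n)
    {w : Fin n → ℝ} (hw : w ∈ Metric.ball a r) :
    partialD i (coordPrimitive a k (fun z => c j k z * (κ k z - κ j z))) w =
      ∑ m, coordPrimitiveDeriv a k (fun z => (κ k z - κ j z) * L j m z) (p j m) i w := by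
  have hC := fun m => ((hκ k).sub (hκ j)).mul (hs.contDiffOn_L j m)
  rw [partialD_congr Metric.isOpen_ball (fun w hw => hs.coordPrimitive_eq_sum hκ j k hw) i hw,
    partialD_sum Metric.isOpen_ball _
      (fun m _ => _root_.contDiffOn_coordPrimitive (hC m) (hs.contDiffOn_p j m) k) i hw]
  exact Finset.sum_congr rfl fun m _ =>
    partialD_coordPrimitive (hC m) (hs.contDiffOn_p j m) k i hw

theorem IsCompatibleSystem.continuousOn_lambdaDefect (hs : IsCompatibleSystem a r sim c L p)
    (hκ : ∀ j, ContDiffOn ℝ 1 (κ j) (Metric.ball a r)) (j i : Fin n) :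
    ContinuousOn (lambdaDefect c κ j i) (Metric.ball a r) :=
  (continuousOn_partialD Metric.isOpen_ball (hκ j) i).sub
    ((hs.continuousOn_coeff j i).mul ((hκ i).continuousOn.sub (hκ j).continuousOn))

/-- The compatibility of the equations in the directions `i` and `k`. -/
theorem IsCompatibleSystem.partialD_coordPrimitive (hs : IsCompatibleSystem a r sim c L p)
    (hκ : ∀ j, ContDiffOn ℝ 1 (κ j) (Metric.ball a r))
    (hκs : ∀ i j, sim i j → ∀ w ∈ Metric.ball a r, κ i w = κ j w) {i j k : Fin n} (hik : i ≠ k)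
    (hjk : ¬ sim j k) (hadm : i ≠ j ∨ ∃ j', j' ≠ j ∧ sim j' j)
    {v : Fin n → ℝ} (hv : v ∈ Metric.ball a r) :
    partialD i (coordPrimitive a k (fun z => c j k z * (κ k z - κ j z))) v =
      c j i v * (κ i v - κ j v) - c j i (Function.update v k (a k)) *
        (κ i (Function.update v k (a k)) - κ j (Function.update v k (a k))) +
      coordPrimitive a k (fun z => c j k z * (lambdaDefect c κ k i z - lambdaDefect c κ j i z)
        - c j i z * (lambdaDefect c κ i k z - lambdaDefect c κ j k z)) v := by
  have hB : IsOpen (Metric.ball a r) := Metric.isOpen_ball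
  have cκ := fun j => (hκ j).continuousOn
  have cdκ := fun j i => continuousOn_partialD hB (hκ j) i
  have cc := hs.continuousOn_coeff
  have hdκ : ∀ i j l, sim i j → ∀ w ∈ Metric.ball a r, partialD l (κ i) w = partialD l (κ j) w :=
    fun i j l hij w hw => partialD_congr hB (hκs i j hij) l hw
  -- For i ~ k the argument stays weak: the primitive is differentiated by parts and `closed` kills
  -- the curl of the coefficients. For i ≁ k the coefficient is classically differentiable in
  -- direction i, and one may differentiate under the integral.
  by_cases hsik : sim i k
  · have hsji : ¬ sim j i := fun h => hjk (hs.equiv.trans h hsik)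
    have hC := fun m => ((hκ k).sub (hκ j)).mul (hs.contDiffOn_L j m)
    rw [hs.partialD_coordPrimitive_eq_sum hκ j k i hv]
    simp only [coordPrimitiveDeriv, if_neg hik, Finset.sum_add_distrib, Finset.sum_sub_distrib]
    rw [← coordPrimitive_sum (r := r) Finset.univ (G := fun m z =>
      partialD i (fun z => (κ k z - κ j z) * L j m z) z * partialD k (p j m) z -
        partialD k (fun z => (κ k z - κ j z) * L j m z) z * partialD i (p j m) z)
      (fun m => ((continuousOn_partialD hB (hC m) i).mul
          (continuousOn_partialD hB (hs.contDiffOn_p j m) k)).sub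
        ((continuousOn_partialD hB (hC m) k).mul
          (continuousOn_partialD hB (hs.contDiffOn_p j m) i))) k hv]
    have e1 : ∀ z ∈ Metric.ball a r, ∑ m, (κ k z - κ j z) * L j m z * partialD i (p j m) z =
        c j i z * (κ i z - κ j z) := by
      intro z hz
      rw [hs.coeff_eq j i z hz, hκs i k hsik z hz, Finset.sum_mul]
      exact Finset.sum_congr rfl fun m _ => by ring
    rw [e1 v hv, e1 _ (update_self_mem_ball hv k)]
    congr 1
    refine coordPrimitive_congr (fun z hz => ?_) k hv
    have e2 : ∀ l m, partialD l (fun z => (κ k z - κ j z) * L j m z) z =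
        (κ k z - κ j z) * partialD l (L j m) z +
          L j m z * (partialD l (κ k) z - partialD l (κ j) z) := by
      intro l m
      rw [partialD_mul hB ((hκ k).sub (hκ j)) (hs.contDiffOn_L j m) l hz,
        partialD_sub hB (hκ k) (hκ j) l hz]
    simp only [e2]
    have e3 : ∑ m, (((κ k z - κ j z) * partialD i (L j m) z +
          L j m z * (partialD i (κ k) z - partialD i (κ j) z)) * partialD k (p j m) z -
        ((κ k z - κ j z) * partialD k (L j m) z +
          L j m z * (partialD k (κ k) z - partialD k (κ j) z)) * partialD i (p j m) z) =
        (κ k z - κ j z) * ∑ m, (partialD i (L j m) z * partialD k (p j m) z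
          - partialD k (L j m) z * partialD i (p j m) z) +
        (partialD i (κ k) z - partialD i (κ j) z) * ∑ m, L j m z * partialD k (p j m) z -
        (partialD k (κ k) z - partialD k (κ j) z) * ∑ m, L j m z * partialD i (p j m) z := by
      simp only [Finset.mul_sum, ← Finset.sum_add_distrib, ← Finset.sum_sub_distrib]
      exact Finset.sum_congr rfl fun m _ => by ring
    rw [e3, hs.closed i j k hsik (fun h => hsji (hs.equiv.symm h)) z hz, ← hs.coeff_eq j k z hz,
      ← hs.coeff_eq j i z hz]
    simp only [lambdaDefect]
    rw [hdκ i k k hsik z hz, hκs i k hsik z hz]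
    ring
  · have hski : ¬ sim k i := fun h => hsik (hs.equiv.symm h)
    have hskj : ¬ sim k j := fun h => hjk (hs.equiv.symm h)
    set G' : (Fin n → ℝ) → ℝ := fun z =>
      (c j k z * c k i z + c j i z * (c i k z - c j k z)) * (κ k z - κ j z) +
        c j k z * (partialD i (κ k) z - partialD i (κ j) z) with hG'
    have cG' : ContinuousOn G' (Metric.ball a r) :=
      ((((cc j k).mul (cc k i)).add ((cc j i).mul ((cc i k).sub (cc j k)))).mul
        ((cκ k).sub (cκ j))).add ((cc j k).mul ((cdκ k i).sub (cdκ j i)))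
    have dκ : ∀ l l' z, z ∈ Metric.ball a r →
        HasDerivAt (fun t => κ l (Function.update z l' t)) (partialD l' (κ l) z) (z l') := by
      intro l l' z hz
      have := hasDerivAt_update_of_contDiffOn hB (hκ l) l' (w := z) (t := z l') (by simpa using hz)
      simpa using this
    have dG : ∀ z ∈ Metric.ball a r, HasDerivAt
        (fun t => c j k (Function.update z i t) *
          (κ k (Function.update z i t) - κ j (Function.update z i t))) (G' z) (z i) := by
      intro z hz
      have h1 := (hs.hasDerivAt_coeff i j k hski hskj hadm z hz).fun_mul
        ((dκ k i z hz).fun_sub (dκ j i z hz))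
      simpa [hG'] using h1
    have h1 := hasDerivAt_coordPrimitive_of_hasDerivAt (a := a) (r := r) (k := k)
      ((cc j k).mul ((cκ k).sub (cκ j))) cG' hik dG hv
    rw [partialD_eq_of_hasDerivAt hB (hs.contDiffOn_coordPrimitive hκ j k) hv h1]
    set E : (Fin n → ℝ) → ℝ := fun z =>
      c j k z * (lambdaDefect c κ k i z - lambdaDefect c κ j i z)
        - c j i z * (lambdaDefect c κ i k z - lambdaDefect c κ j k z) with hE
    have cE : ContinuousOn E (Metric.ball a r) := by
      have := hs.continuousOn_lambdaDefect hκ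
      exact ((cc j k).mul ((this k i).sub (this j i))).sub
        ((cc j i).mul ((this i k).sub (this j k)))
    -- `G'` is the i-derivative of c_jk (κ^k - κ^j). By integrability, removing the defect
    -- combination `E` leaves the k-derivative of c_ji (κ^i - κ^j), whose integral in w^k is the
    -- boundary term.
    set g' : (Fin n → ℝ) → ℝ := fun z => G' z - E z with hg'
    have hgE : ∀ z, g' z = (c j i z * c i k z + c j k z * (c k i z - c j i z)) * (κ i z - κ j z) +
        c j i z * (partialD k (κ i) z - partialD k (κ j) z) := by
      intro z
      simp only [hg', hG', hE, lambdaDefect]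
      ring
    have dg : ∀ z ∈ Metric.ball a r, HasDerivAt
        (fun t => c j i (Function.update z k t) *
          (κ i (Function.update z k t) - κ j (Function.update z k t))) (g' z) (z k) := by
      intro z hz
      -- Here no differentiability of c_ji is available or needed: the product c_ji (κ^i - κ^j)
      -- vanishes identically.
      by_cases hsij : sim i j
      · have hz0 : g' z = 0 := by rw [hgE, hκs i j hsij z hz, hdκ i j k hsij z hz]; ring
        rw [hz0]
        refine (hasDerivAt_const (z k) (0 : ℝ)).congr_of_eventuallyEq ?_
        filter_upwards [Metric.isOpen_ball.mem_nhds (apply_mem_ball_of_mem_ball_pi hz k)] with t ht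
        rw [hκs i j hsij _ (update_mem_ball_pi hz ht)]; ring
      · have h1 := (hs.hasDerivAt_coeff k j i hsik hsij
          (Or.inl fun h => hskj (h ▸ hs.equiv.refl k)) z hz).fun_mul
          ((dκ i k z hz).fun_sub (dκ j k z hz))
        rw [hgE]
        simpa using h1
    have cg' : ContinuousOn g' (Metric.ball a r) := cG'.sub cE
    rw [← coordPrimitive_of_hasDerivAt (g := fun z => c j i z * (κ i z - κ j z)) cg' dg hv,
      ← coordPrimitive_add cg' cE k hv]
    exact coordPrimitive_congr (fun z _ => by simp [hg']) k hv
end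


/-! ### Vanishing of the defects and existence of solutions -/

section
variable {n : ℕ} {a : Fin n → ℝ} {r : ℝ} {sim : Fin n → Fin n → Prop}
  {c L p : Fin n → Fin n → (Fin n → ℝ) → ℝ} {κ ψ : Fin n → (Fin n → ℝ) → ℝ}

theorem keepSet_piecewise_zero_apply {j k : Fin n} (h : ¬ sim j k) (w : Fin n → ℝ) :
    (keepSet sim j 0).piecewise w a k = a k := by
  have : k ∉ keepSet sim j 0 := by simp [mem_keepSet, h]
  simp [this]

theorem IsCompatibleSystem.picardOp_piecewise_zero (hs : IsCompatibleSystem a r sim c L p)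
    (hκ : ∀ j, ContDiffOn ℝ 1 (κ j) (Metric.ball a r)) (j : Fin n)
    {w : Fin n → ℝ} (hw : w ∈ Metric.ball a r) :
    picardOp a sim L p κ j ((keepSet sim j 0).piecewise w a) = 0 := by
  classical
  rw [hs.picardOp_eq (fun j => (hκ j).continuousOn) j (piecewise_mem_ball hw _)]
  refine Finset.sum_eq_zero fun k hk => coordPrimitive_of_apply_eq ?_
  have hk : ¬ sim j k := by simpa using hk
  by_cases h' : k ∈ keepSet sim j (k.val + 1)
  · simp [h', keepSet_piecewise_zero_apply hk]
  · simp [h']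

/-- The defects of a fixed point of the Picard operator are controlled by integrals of themselves
along the path of integration. -/
theorem IsCompatibleSystem.abs_lambdaDefect_piecewise_le (hs : IsCompatibleSystem a r sim c L p)
    (hκ : ∀ j, ContDiffOn ℝ 1 (κ j) (Metric.ball a r))
    (hκs : ∀ i j, sim i j → ∀ w ∈ Metric.ball a r, κ i w = κ j w)
    (hfix : ∀ j, ∀ w ∈ Metric.ball a r, κ j w = ψ j w + picardOp a sim L p κ j w)
    (hψ0 : ∀ j, ∀ N, ∀ w ∈ Metric.ball a r, ψ j ((keepSet sim j N).piecewise w a) = ψ j w)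
    (hψ' : ∀ i j, sim j i → (i ≠ j ∨ ∃ j', j' ≠ j ∧ sim j' j) → ∀ w ∈ Metric.ball a r,
      partialD i (ψ j) w = 0)
    {C S : ℝ} (hC : ∀ j k, ∀ w ∈ Metric.ball a r, |c j k w| ≤ C)
    (hS : ∀ i j, (i ≠ j ∨ ∃ j', j' ≠ j ∧ sim j' j) → ∀ w ∈ Metric.ball a r,
      |lambdaDefect c κ j i w| ≤ S) (N : ℕ) (hN : N ≤ n) :
    ∀ i j, (i ≠ j ∨ ∃ j', j' ≠ j ∧ sim j' j) → i ∈ keepSet sim j N → ∀ w ∈ Metric.ball a r,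
      |lambdaDefect c κ j i ((keepSet sim j N).piecewise w a)| ≤ N * (r * (4 * C * S)) := by
  have hB : IsOpen (Metric.ball a r) := Metric.isOpen_ball
  induction N with
  | zero =>
    intro i j hadm hi w hw
    -- On the initial plane κ^j equals ψ^j, which is constant along the prescribed directions of its
    -- class; the right-hand side vanishes because κ^i = κ^j. So the defect is zero there.
    have hji : sim j i := by simpa [mem_keepSet] using hi
    have h1 := partialD_comp_piecewise (hκ j) (keepSet sim j 0) i hw
    have h2 := partialD_congr hB (f := fun w => κ j ((keepSet sim j 0).piecewise w a)) (g := ψ j)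
      (fun w hw => by
        rw [hfix j _ (piecewise_mem_ball hw _), hs.picardOp_piecewise_zero hκ j hw, hψ0 j 0 w hw,
          add_zero]) i hw
    rw [h1, if_pos hi, hψ' i j hji hadm w hw] at h2
    simp [lambdaDefect, h2, hκs i j (hs.equiv.symm hji) _ (piecewise_mem_ball hw _)]
  | succ N ih =>
    have ih := ih (by omega)
    intro i j hadm hi w hw
    have hC0 : 0 ≤ C := (abs_nonneg _).trans (hC j j w hw)
    have hS0 : 0 ≤ S := (abs_nonneg _).trans (hS i j hadm w hw)
    have hr0 : 0 < r := Metric.pos_of_mem_ball hw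
    have hE0 : 0 ≤ r * (4 * C * S) := by positivity
    set k : Fin n := ⟨N, by omega⟩ with hk
    -- A coordinate in the class of j is switched on from the start, so this stage of the path is
    -- trivial.
    by_cases hjk : sim j k
    · have hkeep : keepSet sim j (N + 1) = keepSet sim j N := by
        ext l
        rw [mem_keepSet, mem_keepSet]
        rcases eq_or_ne l k with rfl | hlk
        · simp [hjk]
        · have : l.val ≠ N := fun h => hlk (Fin.ext h)
          exact or_congr_left ⟨fun h => by omega, fun h => by omega⟩
      rw [hkeep] at hi ⊢
      refine (ih i j hadm hi w hw).trans ?_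
      push_cast; nlinarith
    · have hv := piecewise_mem_ball hw (keepSet sim j (N + 1))
      set v := (keepSet sim j (N + 1)).piecewise w a with hvdef
      have hCp := hs.contDiffOn_coordPrimitive hκ j k
      have hstep : ∀ w ∈ Metric.ball a r, κ j ((keepSet sim j (N + 1)).piecewise w a) =
          κ j ((keepSet sim j N).piecewise w a) +
          coordPrimitive a k (fun z => c j k z * (κ k z - κ j z))
            ((keepSet sim j (N + 1)).piecewise w a) := by
        intro w hw
        have := hs.picardOp_step hκ hjk hw
        rw [hfix j _ (piecewise_mem_ball hw (keepSet sim j (N + 1))),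
          hfix j _ (piecewise_mem_ball hw (keepSet sim j N)),
          hψ0 j (N + 1) w hw, hψ0 j N w hw, this, add_assoc]
      have hd := partialD_congr hB hstep i hw
      rw [partialD_add hB (contDiffOn_comp_piecewise (hκ j) _)
        (contDiffOn_comp_piecewise hCp _) i hw, partialD_comp_piecewise (hκ j) _ i hw,
        partialD_comp_piecewise (hκ j) _ i hw, partialD_comp_piecewise hCp _ i hw, if_pos hi,
        if_pos hi, ← hvdef] at hd
      -- Along the segment's own direction the equation holds exactly, by the fundamental theorem of
      -- calculus.
      rcases eq_or_ne i k with rfl | hik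
      · have hnot : k ∉ keepSet sim j N := by
          rw [mem_keepSet]; exact not_or.2 ⟨lt_irrefl N, hjk⟩
        rw [if_neg hnot, zero_add, partialD_eq_of_hasDerivAt hB hCp hv
          (hasDerivAt_coordPrimitive_self ((hs.continuousOn_coeff j k).mul
            ((hκ k).continuousOn.sub (hκ j).continuousOn)) k hv)] at hd
        have : lambdaDefect c κ j k v = 0 := by
          simp only [lambdaDefect, hd, Pi.mul_apply, Pi.sub_apply, sub_self]
        rw [this, abs_zero]
        positivity
      · have hiN : i ∈ keepSet sim j N := by
          rw [mem_keepSet] at hi ⊢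
          have : i.val ≠ N := fun h => hik (Fin.ext h)
          exact hi.imp_left fun h => by omega
        have hup : Function.update v k (a k) = (keepSet sim j N).piecewise w a :=
          update_piecewise_keepSet hjk w
        rw [if_pos hiN, hs.partialD_coordPrimitive hκ hκs hik hjk hadm hv, hup] at hd
        -- The boundary term at w^k = a^k in the compatibility identity is the right-hand side of
        -- the equation at stage N. The defect is thus carried over from stage N, up to an integral
        -- of defects bounded by r · 4CS.
        have hsplit : lambdaDefect c κ j i v =
            lambdaDefect c κ j i ((keepSet sim j N).piecewise w a) + coordPrimitive a k
              (fun z => c j k z * (lambdaDefect c κ k i z - lambdaDefect c κ j i z)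
                - c j i z * (lambdaDefect c κ i k z - lambdaDefect c κ j k z)) v := by
          simp only [lambdaDefect] at hd ⊢
          rw [hd]; ring
        rw [hsplit]
        have hkj : k ≠ j := fun h => hjk (h ▸ hs.equiv.refl j)
        refine (abs_add_le _ _).trans ?_
        have h1 := ih i j hadm hiN w hw
        have h2 := abs_coordPrimitive_le (a := a) (r := r) (C := 4 * C * S) (G := fun z =>
          c j k z * (lambdaDefect c κ k i z - lambdaDefect c κ j i z)
            - c j i z * (lambdaDefect c κ i k z - lambdaDefect c κ j k z)) (fun z hz => by
            have e1 : |lambdaDefect c κ k i z - lambdaDefect c κ j i z| ≤ 2 * S :=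
              (abs_sub _ _).trans
                (by linarith [hS i k (Or.inl hik) z hz, hS i j hadm z hz])
            have e2 : |lambdaDefect c κ i k z - lambdaDefect c κ j k z| ≤ 2 * S :=
              (abs_sub _ _).trans
                (by linarith [hS k i (Or.inl hik.symm) z hz, hS k j (Or.inl hkj) z hz])
            refine (abs_sub _ _).trans ?_
            rw [abs_mul, abs_mul]
            have e3 := mul_le_mul (hC j k z hz) e1 (abs_nonneg _) hC0
            have e4 := mul_le_mul (hC j i z hz) e2 (abs_nonneg _) hC0
            linarith) k hv
        push_cast
        linarith

/-- Iterating the halving from one finite bound gives bounds S / 2^N for every N. Both the defects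
and the difference of two solutions are shown to vanish this way. -/
theorem eq_zero_of_bound_halving {ι : Type*} {f : ι → ℝ} {S : ℝ} (h0 : ∀ x, |f x| ≤ S)
    (h : ∀ S, (∀ x, |f x| ≤ S) → ∀ x, |f x| ≤ S / 2) (x : ι) : f x = 0 := by
  have key : ∀ N : ℕ, ∀ x, |f x| ≤ S * (1 / 2) ^ N := by
    intro N
    induction N with
    | zero => simpa using h0
    | succ N ih =>
      intro x
      refine (h _ ih x).trans (le_of_eq ?_)
      ring
  have ht : Tendsto (fun N : ℕ => S * (1 / 2 : ℝ) ^ N) atTop (𝓝 (S * 0)) :=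
    (tendsto_pow_atTop_nhds_zero_of_lt_one (by norm_num) (by norm_num)).const_mul S
  have := ge_of_tendsto' ht fun N => key N x
  rw [mul_zero] at this
  exact abs_eq_zero.1 (le_antisymm this (abs_nonneg _))

theorem exists_uniform_bound {ι : Type*} [Finite ι] {f : ι → (Fin n → ℝ) → ℝ} {r' : ℝ}
    (hr' : r' < r) (hf : ∀ x, ContinuousOn (f x) (Metric.ball a r)) :
    ∃ M, 0 ≤ M ∧ ∀ x, ∀ w ∈ Metric.ball a r', |f x w| ≤ M := by
  have h1 : ∀ x, ∃ C, ∀ w ∈ Metric.closedBall a r', ‖f x w‖ ≤ C := fun x =>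
    (isCompact_closedBall a r').exists_bound_of_continuousOn
      ((hf x).mono (Metric.closedBall_subset_ball hr'))
  choose C hC using h1
  obtain ⟨M, hM⟩ := Set.Finite.bddAbove (Set.finite_range C)
  exact ⟨max M 0, le_max_right _ _, fun x w hw =>
    (hC x w (Metric.ball_subset_closedBall hw)).trans ((hM ⟨x, rfl⟩).trans (le_max_left _ _))⟩

/-- Existence of a local solution with prescribed values on the planes `wᵏ = aᵏ`, `k` not equivalent
to `j`. -/
theorem IsCompatibleSystem.exists_solution (hs : IsCompatibleSystem a r sim c L p) (hr : 0 < r)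
    (hψ : ∀ j, ContDiffOn ℝ 1 (ψ j) (Metric.ball a r))
    (hψs : ∀ i j, sim i j → ∀ w ∈ Metric.ball a r, ψ i w = ψ j w)
    (hψ0 : ∀ j, ∀ N, ∀ w ∈ Metric.ball a r, ψ j ((keepSet sim j N).piecewise w a) = ψ j w)
    (hψ' : ∀ i j, sim j i → (i ≠ j ∨ ∃ j', j' ≠ j ∧ sim j' j) → ∀ w ∈ Metric.ball a r,
      partialD i (ψ j) w = 0) :
    ∃ ε > 0, ε ≤ r ∧ ∃ κ : Fin n → (Fin n → ℝ) → ℝ,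
      (∀ j, ContDiffOn ℝ 1 (κ j) (Metric.ball a ε)) ∧
      (∀ i j, sim i j → ∀ w ∈ Metric.ball a ε, κ i w = κ j w) ∧
      (∀ i j, (i ≠ j ∨ ∃ j', j' ≠ j ∧ sim j' j) → ∀ w ∈ Metric.ball a ε,
        partialD i (κ j) w = c j i w * (κ i w - κ j w)) ∧
      (∀ j, ∀ w ∈ Metric.ball a ε,
        κ j ((keepSet sim j 0).piecewise w a) = ψ j w) := by
  have hB : IsOpen (Metric.ball a r) := Metric.isOpen_ball
  have hr2 : r / 2 < r := by linarith
  obtain ⟨M₁, hM₁0, hM₁⟩ := exists_uniform_bound (f := fun x : Fin n × Fin n => L x.1 x.2) hr2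
    fun x => (hs.contDiffOn_L x.1 x.2).continuousOn
  obtain ⟨M₂, hM₂0, hM₂⟩ := exists_uniform_bound
    (f := fun x : Fin n × Fin n × Fin n => partialD x.2.2 (L x.1 x.2.1)) hr2
    fun x => continuousOn_partialD hB (hs.contDiffOn_L x.1 x.2.1) _
  obtain ⟨M₃, hM₃0, hM₃⟩ := exists_uniform_bound
    (f := fun x : Fin n × Fin n × Fin n => partialD x.2.2 (p x.1 x.2.1)) hr2
    fun x => continuousOn_partialD hB (hs.contDiffOn_p x.1 x.2.1) _
  obtain ⟨C, hC0, hC⟩ := exists_uniform_bound (f := fun x : Fin n × Fin n => c x.1 x.2) hr2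
    fun x => hs.continuousOn_coeff x.1 x.2
  obtain ⟨A₁, hA₁0, hA₁⟩ := exists_uniform_bound (f := ψ) hr2 fun j => (hψ j).continuousOn
  obtain ⟨A₂, hA₂0, hA₂⟩ := exists_uniform_bound
    (f := fun x : Fin n × Fin n => partialD x.2 (ψ x.1)) hr2
    fun x => continuousOn_partialD hB (hψ x.1) _
  set M := M₁ + M₂ + M₃ with hM
  set T := (n : ℝ) ^ 2 * M ^ 2 + n * C + 1 with hT
  have hT1 : 1 ≤ T := by
    rw [hT]; have : 0 ≤ (n : ℝ) ^ 2 * M ^ 2 := by positivity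
    have : 0 ≤ (n : ℝ) * C := by positivity
    linarith
  -- `T` dominates both n² M², which controls the contraction, and n C, which controls the
  -- propagation of defects, so this one radius serves both.
  set ε := min (r / 2) (1 / (32 * T)) with hε
  have hε0 : 0 < ε := lt_min (by positivity) (by positivity)
  have hεr : ε ≤ r / 2 := min_le_left _ _
  have hεT : ε * T ≤ 1 / 32 := by
    calc ε * T ≤ 1 / (32 * T) * T := by gcongr; exact min_le_right _ _
      _ = 1 / 32 := by field_simp
  have hε1 : ε * ((n : ℝ) ^ 2 * M ^ 2) ≤ 1 / 32 := by
    refine le_trans ?_ hεT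
    gcongr
    rw [hT]; have : 0 ≤ (n : ℝ) * C := by positivity
    linarith
  have hε2 : ε * (n * C) ≤ 1 / 32 := by
    refine le_trans ?_ hεT
    gcongr
    rw [hT]; have : 0 ≤ (n : ℝ) ^ 2 * M ^ 2 := by positivity
    linarith
  have hsub : Metric.ball a ε ⊆ Metric.ball a (r / 2) := Metric.ball_subset_ball hεr
  have hsub' : Metric.ball a ε ⊆ Metric.ball a r := Metric.ball_subset_ball (by linarith)
  obtain ⟨κ, hκ, hfix, hκs⟩ := (hs.mono (r' := ε) (by linarith)).exists_picard_fixedPoint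
    (A := A₁ + A₂) (M := M) (ψ := ψ)
    (fun j m z hz => (hM₁ (j, m) z (hsub hz)).trans (by rw [hM]; linarith))
    (fun j m i z hz => (hM₂ (j, m, i) z (hsub hz)).trans (by rw [hM]; linarith))
    (fun j m i z hz => (hM₃ (j, m, i) z (hsub hz)).trans (by rw [hM]; linarith))
    hε1 (fun j => (hψ j).mono hsub')
    (fun j z hz => (hA₁ j z (hsub hz)).trans (by linarith))
    (fun j i z hz => (hA₂ (j, i) z (hsub hz)).trans (by linarith))
    (fun i j hij w hw => hψs i j hij w (hsub' hw))
  -- The halving argument needs a finite initial bound on the defects. They are continuous on the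
  -- ball of radius `ε`, hence bounded on a strictly smaller one.
  set δ := ε / 2 with hδ
  have hδ0 : 0 < δ := by positivity
  have hδε : δ < ε := by rw [hδ]; linarith
  have hsubδ : Metric.ball a δ ⊆ Metric.ball a ε := Metric.ball_subset_ball hδε.le
  have hsδ := hs.mono (r' := δ) (by linarith)
  have hsε := hs.mono (r' := ε) (by linarith)
  obtain ⟨S₀, -, hS₀⟩ := exists_uniform_bound
    (f := fun x : Fin n × Fin n => lambdaDefect c κ x.1 x.2) hδε
    fun x => hsε.continuousOn_lambdaDefect hκ x.1 x.2
  have hzero := eq_zero_of_bound_halving (S := S₀)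
    (ι := {x : Fin n × Fin n × (Fin n → ℝ) // (x.1 ≠ x.2.1 ∨ ∃ j', j' ≠ x.2.1 ∧ sim j' x.2.1) ∧
      x.2.2 ∈ Metric.ball a δ}) (f := fun x => lambdaDefect c κ x.1.2.1 x.1.1 x.1.2.2)
    (fun x => hS₀ (x.1.2.1, x.1.1) _ x.2.2)
    (by
      rintro S hS ⟨⟨i, j, w⟩, hadm, hw⟩
      have := hsδ.abs_lambdaDefect_piecewise_le (κ := κ) (ψ := ψ) (C := C) (S := S)
        (fun j => (hκ j).mono hsubδ) (fun i j hij w hw => hκs i j hij w (hsubδ hw))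
        (fun j w hw => hfix j w (hsubδ hw))
        (fun j N w hw => hψ0 j N w (hsub' (hsubδ hw)))
        (fun i j hij hadm w hw => hψ' i j hij hadm w (hsub' (hsubδ hw)))
        (fun j k w hw => hC (j, k) w (hsub (hsubδ hw)))
        (fun i j hadm w hw => hS ⟨(i, j, w), hadm, hw⟩) n le_rfl i j hadm
        (by simp [mem_keepSet]) w hw
      have hk : keepSet sim j n = Finset.univ := by ext l; simp [mem_keepSet]
      rw [hk, Finset.piecewise_univ] at this
      refine this.trans ?_
      have hS0 : 0 ≤ S := (abs_nonneg _).trans (hS ⟨(i, j, w), hadm, hw⟩)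
      calc (n : ℝ) * (δ * (4 * C * S)) = 4 * S * (δ * (n * C)) := by ring
        _ ≤ 4 * S * (1 / 32) := by
          gcongr
          refine le_trans ?_ hε2
          gcongr
        _ ≤ S / 2 := by linarith)
  refine ⟨δ, hδ0, by linarith, κ, fun j => (hκ j).mono hsubδ,
    fun i j hij w hw => hκs i j hij w (hsubδ hw), fun i j hadm w hw => ?_, fun j w hw => ?_⟩
  · have := hzero ⟨(i, j, w), hadm, hw⟩
    simp only [lambdaDefect] at this
    linarith
  · rw [hfix j _ (hsubδ (piecewise_mem_ball hw _)), hsδ.picardOp_piecewise_zero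
      (fun j => (hκ j).mono hsubδ) j hw, add_zero, hψ0 j 0 w (hsub' (hsubδ hw))]
end


/-! ### The frame in Riemann invariants: symmetry and flatness of the connection -/

section
variable {n : ℕ} {R : Fin n → (Fin n → ℝ) → (Fin n → ℝ)} {Ω : Set (Fin n → ℝ)}
  {ρ : OpenPartialHomeomorph (Fin n → ℝ) (Fin n → ℝ)}

/-- The linear map `y ↦ ∑ⱼ yʲ R_j(u)`. -/
noncomputable def frameMap (R : Fin n → (Fin n → ℝ) → (Fin n → ℝ)) (u : Fin n → ℝ) :
    (Fin n → ℝ) →L[ℝ] (Fin n → ℝ) :=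
  ∑ j, (ContinuousLinearMap.proj (R := ℝ) (φ := fun _ : Fin n => ℝ) j).smulRight (R j u)

theorem frameMap_single (u : Fin n → ℝ) (j : Fin n) :
    frameMap R u (Pi.single j 1) = R j u := by
  simp [frameMap, Pi.single_apply]

theorem IsNormalizedRiemannInvariants.fderiv_apply
    (hρ : IsNormalizedRiemannInvariants R Ω ρ) {x : Fin n → ℝ} (hx : x ∈ ρ.source) (j : Fin n) :
    fderiv ℝ ρ x (R j x) = Pi.single j 1 := by
  have hd : DifferentiableAt ℝ ρ x :=
    (hρ.contDiffOn.differentiableOn one_ne_zero).differentiableAt (ρ.open_source.mem_nhds hx)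
  ext i
  have h1 := hρ.normalized x hx i j
  have h2 : HasFDerivAt (fun v => ρ v i)
      ((ContinuousLinearMap.proj (R := ℝ) (φ := fun _ : Fin n => ℝ) i).comp (fderiv ℝ ρ x)) x :=
    hasFDerivAt_pi'.1 hd.hasFDerivAt i
  rw [h2.fderiv] at h1
  simpa [Pi.single_apply] using h1

theorem IsNormalizedRiemannInvariants.fderiv_comp_frameMap
    (hρ : IsNormalizedRiemannInvariants R Ω ρ) {x : Fin n → ℝ} (hx : x ∈ ρ.source) :
    (fderiv ℝ ρ x).comp (frameMap R x) = ContinuousLinearMap.id ℝ _ := by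
  refine ContinuousLinearMap.coe_injective (LinearMap.pi_ext' fun j => LinearMap.ext_ring ?_)
  simp [frameMap_single, hρ.fderiv_apply hx]

/-- In finite dimension the right inverse given by the normalization is also a left inverse. -/
theorem IsNormalizedRiemannInvariants.frameMap_comp_fderiv
    (hρ : IsNormalizedRiemannInvariants R Ω ρ) {x : Fin n → ℝ} (hx : x ∈ ρ.source) :
    (frameMap R x).comp (fderiv ℝ ρ x) = ContinuousLinearMap.id ℝ _ := by
  have h := congrArg (fun f : (Fin n → ℝ) →L[ℝ] (Fin n → ℝ) => (f : (Fin n → ℝ) →ₗ[ℝ] (Fin n → ℝ)))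
    (hρ.fderiv_comp_frameMap hx)
  have h' : (fderiv ℝ ρ x : (Fin n → ℝ) →ₗ[ℝ] (Fin n → ℝ)) *
    (frameMap R x : (Fin n → ℝ) →ₗ[ℝ] (Fin n → ℝ)) = 1 := h
  exact ContinuousLinearMap.coe_injective (mul_eq_one_comm.1 h')

/-- The derivative of `ρ` as an isomorphism, with inverse the frame. -/
noncomputable def IsNormalizedRiemannInvariants.fderivEquiv
    (hρ : IsNormalizedRiemannInvariants R Ω ρ) {x : Fin n → ℝ} (hx : x ∈ ρ.source) :
    (Fin n → ℝ) ≃L[ℝ] (Fin n → ℝ) :=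
  ContinuousLinearEquiv.equivOfInverse (fderiv ℝ ρ x) (frameMap R x)
    (fun y => DFunLike.congr_fun (hρ.frameMap_comp_fderiv hx) y)
    (fun y => DFunLike.congr_fun (hρ.fderiv_comp_frameMap hx) y)

theorem IsNormalizedRiemannInvariants.hasFDerivAt_equiv
    (hρ : IsNormalizedRiemannInvariants R Ω ρ) {x : Fin n → ℝ} (hx : x ∈ ρ.source) :
    HasFDerivAt ρ (hρ.fderivEquiv hx : (Fin n → ℝ) →L[ℝ] (Fin n → ℝ)) x :=
  ((hρ.contDiffOn.differentiableOn one_ne_zero).differentiableAt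
    (ρ.open_source.mem_nhds hx)).hasFDerivAt

theorem IsNormalizedRiemannInvariants.hasFDerivAt_symm
    (hρ : IsNormalizedRiemannInvariants R Ω ρ) {w : Fin n → ℝ} (hw : w ∈ ρ.target) :
    HasFDerivAt ρ.symm (frameMap R (ρ.symm w)) w :=
  ρ.hasFDerivAt_symm hw (hρ.hasFDerivAt_equiv (ρ.map_target hw))

theorem IsNormalizedRiemannInvariants.contDiffOn_symm
    (hρ : IsNormalizedRiemannInvariants R Ω ρ) : ContDiffOn ℝ 1 ρ.symm ρ.target :=
  fun _ hw => (ρ.contDiffAt_symm hw (hρ.hasFDerivAt_equiv (ρ.map_target hw))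
    (hρ.contDiffOn.contDiffAt (ρ.open_source.mem_nhds (ρ.map_target hw)))).contDiffWithinAt

/-- The components of the frame in the coordinates `w`. -/
noncomputable def frameComp (R : Fin n → (Fin n → ℝ) → (Fin n → ℝ))
    (ρ : OpenPartialHomeomorph (Fin n → ℝ) (Fin n → ℝ)) (j m : Fin n) (w : Fin n → ℝ) : ℝ :=
  R j (ρ.symm w) m

/-- The components of the dual frame in the coordinates `w`. -/
noncomputable def dualComp (R : Fin n → (Fin n → ℝ) → (Fin n → ℝ))
    (ρ : OpenPartialHomeomorph (Fin n → ℝ) (Fin n → ℝ)) (k m : Fin n) (w : Fin n → ℝ) : ℝ :=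
  (frameMatrix R (ρ.symm w))⁻¹ k m

theorem contDiffOn_frameComp (hR : IsC1FrameOn R Ω) (hρ : IsNormalizedRiemannInvariants R Ω ρ)
    (j m : Fin n) : ContDiffOn ℝ 1 (frameComp R ρ j m) ρ.target :=
  (contDiff_apply ℝ ℝ m).comp_contDiffOn ((hR.contDiffOn j).comp hρ.contDiffOn_symm
    fun _ hw => hρ.source_subset (ρ.map_target hw))

theorem partialD_frameComp (hΩ : IsOpen Ω) (hR : IsC1FrameOn R Ω)
    (hρ : IsNormalizedRiemannInvariants R Ω ρ) (i j m : Fin n) {w : Fin n → ℝ}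
    (hw : w ∈ ρ.target) :
    partialD i (frameComp R ρ j m) w =
      fderiv ℝ (R j) (ρ.symm w) (R i (ρ.symm w)) m := by
  have hd : HasFDerivAt (R j) (fderiv ℝ (R j) (ρ.symm w)) (ρ.symm w) :=
    (((hR.contDiffOn j).differentiableOn one_ne_zero).differentiableAt
      (hΩ.mem_nhds (hρ.source_subset (ρ.map_target hw)))).hasFDerivAt
  have h1 : HasFDerivAt (frameComp R ρ j m) _ w :=
    hasFDerivAt_pi'.1 (hd.comp w (hρ.hasFDerivAt_symm hw)) m
  unfold partialD
  rw [h1.fderiv]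
  simp [frameMap_single]

/-- Chain rule, since ∂ρ⁻¹/∂wⁱ = R_i ∘ ρ⁻¹. For fixed k and j this exhibits i ↦ Z^k_ij as a form L
dp with C¹ ingredients. -/
theorem connZ_eq_sum (hΩ : IsOpen Ω) (hR : IsC1FrameOn R Ω)
    (hρ : IsNormalizedRiemannInvariants R Ω ρ) (k i j : Fin n) {w : Fin n → ℝ}
    (hw : w ∈ ρ.target) :
    connZ R ρ k i j w = ∑ m, dualComp R ρ k m w * partialD i (frameComp R ρ j m) w := by
  simp only [partialD_frameComp hΩ hR hρ i j _ hw]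
  rfl

/-- The frame fields are the coordinate derivatives of ρ⁻¹. As they are C¹, ρ⁻¹ is in fact C², and
the identity is the symmetry of its second derivative. -/
theorem partialD_frameComp_comm (hR : IsC1FrameOn R Ω)
    (hρ : IsNormalizedRiemannInvariants R Ω ρ) (i j m : Fin n) {w : Fin n → ℝ}
    (hw : w ∈ ρ.target) :
    partialD i (frameComp R ρ j m) w = partialD j (frameComp R ρ i m) w := by
  set f : (Fin n → ℝ) → ℝ := fun w => ρ.symm w m with hf
  have hfd : ∀ w ∈ ρ.target, HasFDerivAt f
      ((ContinuousLinearMap.proj (R := ℝ) (φ := fun _ : Fin n => ℝ) m).comp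
        (frameMap R (ρ.symm w))) w := fun w hw =>
    hasFDerivAt_pi'.1 (hρ.hasFDerivAt_symm hw) m
  have hfe : ∀ w ∈ ρ.target, fderiv ℝ f w = ∑ j, frameComp R ρ j m w •
      ContinuousLinearMap.proj (R := ℝ) (φ := fun _ : Fin n => ℝ) j := by
    intro w hw
    rw [(hfd w hw).fderiv]
    ext y
    simp [frameMap, frameComp, mul_comm]
  have hC : ContDiffOn ℝ 1 (fderiv ℝ f) ρ.target :=
    (ContDiffOn.sum fun j _ => (contDiffOn_frameComp hR hρ j m).smul contDiffOn_const).congr hfe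
  have hC2 : ContDiffOn ℝ (1 + 1) f ρ.target :=
    (contDiffOn_succ_iff_fderiv_of_isOpen ρ.open_target).2
      ⟨fun w hw => (hfd w hw).differentiableAt.differentiableWithinAt, by simp, hC⟩
  have hsym : IsSymmSndFDerivAt ℝ f w :=
    (hC2.contDiffAt (ρ.open_target.mem_nhds hw)).isSymmSndFDerivAt (by simp; rfl)
  have key : ∀ i j, partialD i (frameComp R ρ j m) w =
      fderiv ℝ (fderiv ℝ f) w (Pi.single i 1) (Pi.single j 1) := by
    intro i j
    have e : ∀ z ∈ ρ.target, frameComp R ρ j m z = fderiv ℝ f z (Pi.single j 1) := by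
      intro z hz
      rw [hfe z hz]
      simp [Pi.single_apply]
    have hd : DifferentiableAt ℝ (fderiv ℝ f) w :=
      (hC.differentiableOn one_ne_zero).differentiableAt (ρ.open_target.mem_nhds hw)
    rw [partialD_congr ρ.open_target e i hw]
    unfold partialD
    rw [fderiv_clm_apply hd (differentiableAt_const _)]
    simp
  rw [key, key]
  exact hsym _ _

theorem connZ_comm (hΩ : IsOpen Ω) (hR : IsC1FrameOn R Ω)
    (hρ : IsNormalizedRiemannInvariants R Ω ρ) (k i j : Fin n) {w : Fin n → ℝ}
    (hw : w ∈ ρ.target) : connZ R ρ k i j w = connZ R ρ k j i w := by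
  rw [connZ_eq_sum hΩ hR hρ k i j hw, connZ_eq_sum hΩ hR hρ k j i hw]
  exact Finset.sum_congr rfl fun m _ => by rw [partialD_frameComp_comm hR hρ i j m hw]

theorem isUnit_det_frameMatrix (hR : IsC1FrameOn R Ω) {u : Fin n → ℝ} (hu : u ∈ Ω) :
    IsUnit (frameMatrix R u).det := by
  rw [← Matrix.isUnit_iff_isUnit_det, ← Matrix.linearIndependent_cols_iff_isUnit]
  exact hR.linearIndependent u hu

theorem contDiffOn_det {U : Set (Fin n → ℝ)} {A : (Fin n → ℝ) → Matrix (Fin n) (Fin n) ℝ}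
    (hA : ∀ i j, ContDiffOn ℝ 1 (fun w => A w i j) U) : ContDiffOn ℝ 1 (fun w => (A w).det) U := by
  simp only [Matrix.det_apply']
  exact ContDiffOn.sum fun σ _ => contDiffOn_const.mul (contDiffOn_prod fun i _ => hA _ _)

/-- Cramer's rule: the inverse is the adjugate over the determinant, both polynomial in the C¹
entries. -/
theorem contDiffOn_dualComp (hR : IsC1FrameOn R Ω) (hρ : IsNormalizedRiemannInvariants R Ω ρ)
    (k m : Fin n) : ContDiffOn ℝ 1 (dualComp R ρ k m) ρ.target := by
  have hA : ∀ i j, ContDiffOn ℝ 1 (fun w => frameMatrix R (ρ.symm w) i j) ρ.target := fun i j =>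
    contDiffOn_frameComp hR hρ j i
  have hdet := contDiffOn_det hA
  have hadj : ContDiffOn ℝ 1 (fun w => (frameMatrix R (ρ.symm w)).adjugate k m) ρ.target := by
    simp only [Matrix.adjugate_apply]
    refine contDiffOn_det fun i j => ?_
    simp only [Matrix.updateRow_apply]
    split_ifs
    · exact contDiffOn_const
    · exact hA i j
  refine ((hdet.inv fun w hw => ?_).mul hadj).congr fun w hw => ?_
  · exact (isUnit_det_frameMatrix hR (hρ.source_subset (ρ.map_target hw))).ne_zero
  · simp [dualComp, Matrix.inv_def]

theorem sum_dualComp_mul_frameComp (hR : IsC1FrameOn R Ω)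
    (hρ : IsNormalizedRiemannInvariants R Ω ρ) (k l : Fin n) {w : Fin n → ℝ}
    (hw : w ∈ ρ.target) :
    ∑ m, dualComp R ρ k m w * frameComp R ρ l m w = if k = l then 1 else 0 := by
  have := Matrix.nonsing_inv_mul (frameMatrix R (ρ.symm w))
    (isUnit_det_frameMatrix hR (hρ.source_subset (ρ.map_target hw)))
  have := congrFun (congrFun this k) l
  rw [Matrix.mul_apply, Matrix.one_apply] at this
  exact this

theorem sum_frameComp_mul_dualComp (hR : IsC1FrameOn R Ω)
    (hρ : IsNormalizedRiemannInvariants R Ω ρ) (m m' : Fin n) {w : Fin n → ℝ}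
    (hw : w ∈ ρ.target) :
    ∑ l, frameComp R ρ l m w * dualComp R ρ l m' w = if m = m' then 1 else 0 := by
  have := Matrix.mul_nonsing_inv (frameMatrix R (ρ.symm w))
    (isUnit_det_frameMatrix hR (hρ.source_subset (ρ.map_target hw)))
  have := congrFun (congrFun this m) m'
  rw [Matrix.mul_apply, Matrix.one_apply] at this
  exact this

theorem partialD_frameComp_eq_sum (hΩ : IsOpen Ω) (hR : IsC1FrameOn R Ω)
    (hρ : IsNormalizedRiemannInvariants R Ω ρ) (i j m : Fin n) {w : Fin n → ℝ}
    (hw : w ∈ ρ.target) :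
    partialD i (frameComp R ρ j m) w = ∑ l, connZ R ρ l i j w * frameComp R ρ l m w := by
  simp only [connZ_eq_sum hΩ hR hρ _ i j hw, Finset.sum_mul]
  rw [Finset.sum_comm]
  have : ∀ m', ∑ l, dualComp R ρ l m' w * partialD i (frameComp R ρ j m') w * frameComp R ρ l m w =
      (if m = m' then 1 else 0) * partialD i (frameComp R ρ j m') w := by
    intro m'
    rw [← sum_frameComp_mul_dualComp hR hρ m m' hw, Finset.sum_mul]
    exact Finset.sum_congr rfl fun l _ => by ring
  simp [this]

theorem sum_partialD_dualComp_mul (hΩ : IsOpen Ω) (hR : IsC1FrameOn R Ω)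
    (hρ : IsNormalizedRiemannInvariants R Ω ρ) (i k l : Fin n) {w : Fin n → ℝ}
    (hw : w ∈ ρ.target) :
    ∑ m, partialD i (dualComp R ρ k m) w * frameComp R ρ l m w = - connZ R ρ k i l w := by
  have h1 := partialD_congr ρ.open_target
    (fun w hw => sum_dualComp_mul_frameComp hR hρ k l hw) i hw
  have h2 : partialD i (fun _ : Fin n → ℝ => if k = l then (1 : ℝ) else 0) w = 0 := by
    simp [partialD]
  have hL := contDiffOn_dualComp hR hρ
  have hp := contDiffOn_frameComp hR hρ
  rw [h2, partialD_sum ρ.open_target _ (fun m _ => (hL k m).mul (hp l m)) i hw] at h1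
  have h3 : ∀ m, partialD i (fun w => dualComp R ρ k m w * frameComp R ρ l m w) w = _ := fun m =>
    partialD_mul ρ.open_target (hL k m) (hp l m) i hw
  simp only [h3, Finset.sum_add_distrib] at h1
  rw [connZ_eq_sum hΩ hR hρ k i l hw]
  have h4 : ∑ m, partialD i (dualComp R ρ k m) w * frameComp R ρ l m w =
      ∑ m, frameComp R ρ l m w * partialD i (dualComp R ρ k m) w :=
    Finset.sum_congr rfl fun m _ => mul_comm _ _
  linarith

/-- The weak curl of the coefficients `Z^j_{·q} = L^j · ∂_· R_q`, i.e. the flatness of the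
connection. -/
theorem sum_partialD_dualComp_mul_partialD_sub (hΩ : IsOpen Ω) (hR : IsC1FrameOn R Ω)
    (hρ : IsNormalizedRiemannInvariants R Ω ρ) (i k j q : Fin n) {w : Fin n → ℝ}
    (hw : w ∈ ρ.target) :
    ∑ m, (partialD i (dualComp R ρ j m) w * partialD k (frameComp R ρ q m) w
      - partialD k (dualComp R ρ j m) w * partialD i (frameComp R ρ q m) w) =
    ∑ l, (connZ R ρ j k l w * connZ R ρ l i q w - connZ R ρ j i l w * connZ R ρ l k q w) := by
  -- Expand ∂_k R_q in the frame and use ∂_i L^j · R_l = -Z^j_il, the derivative of L^j · R_l =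
  -- δ^j_l.
  have key : ∀ i k, ∑ m, partialD i (dualComp R ρ j m) w * partialD k (frameComp R ρ q m) w =
      - ∑ l, connZ R ρ j i l w * connZ R ρ l k q w := by
    intro i k
    simp only [partialD_frameComp_eq_sum hΩ hR hρ k q _ hw, Finset.mul_sum]
    rw [Finset.sum_comm, ← Finset.sum_neg_distrib]
    refine Finset.sum_congr rfl fun l _ => ?_
    have := sum_partialD_dualComp_mul hΩ hR hρ i j l hw
    rw [← neg_mul, ← this, Finset.sum_mul]
    exact Finset.sum_congr rfl fun m _ => by ring
  rw [Finset.sum_sub_distrib, key, key, Finset.sum_sub_distrib]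
  ring
end


/-! ### Compatibility of the reduced system -/

section
variable {n : ℕ} {R : Fin n → (Fin n → ℝ) → (Fin n → ℝ)} {Ω : Set (Fin n → ℝ)}
  {ρ : OpenPartialHomeomorph (Fin n → ℝ) (Fin n → ℝ)}

theorem sum_eq_add_of_eq_zero {i j : Fin n} (hij : i ≠ j) {f : Fin n → ℝ}
    (h : ∀ l, l ≠ i → l ≠ j → f l = 0) : ∑ l, f l = f i + f j :=
  Fintype.sum_eq_add i j hij fun l hl => h l hl.1 hl.2

/-- For i ≁ q only the entries Z^i_iq and Z^q_iq survive, which collapses the quadratic terms of the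
flatness identity. -/
theorem sum_connZ_mul_connZ {sim : Fin n → Fin n → Prop} {w : Fin n → ℝ}
    (h0 : ∀ i j k, ¬ sim i j → k ≠ i → k ≠ j → connZ R ρ k i j w = 0)
    {i q : Fin n} (hiq : i ≠ q) (hs : ¬ sim i q) (j k : Fin n) :
    ∑ l, connZ R ρ j k l w * connZ R ρ l i q w =
      connZ R ρ j k i w * connZ R ρ i i q w + connZ R ρ j k q w * connZ R ρ q i q w :=
  sum_eq_add_of_eq_zero hiq fun l h1 h2 => by rw [h0 i q l hs h1 h2, mul_zero]

/-- The reduced `λ`-system of a rich frame is compatible. -/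
theorem isCompatibleSystem_connZ (hΩ : IsOpen Ω) (hR : IsC1FrameOn R Ω)
    (hρ : IsNormalizedRiemannInvariants R Ω ρ) {a : Fin n → ℝ} {r : ℝ}
    (hball : Metric.ball a r ⊆ ρ.target) {sim : Fin n → Fin n → Prop} (hsim : Equivalence sim)
    (h0 : ∀ i j k, ¬ sim i j → k ≠ i → k ≠ j → ∀ w ∈ Metric.ball a r, connZ R ρ k i j w = 0)
    (h1 : ∀ i j k, sim i j → ¬ sim j k → ∀ w ∈ Metric.ball a r,
      connZ R ρ i i k w = connZ R ρ j j k w) :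
    IsCompatibleSystem a r sim (fun j k => connZ R ρ j j k) (dualComp R ρ) (frameComp R ρ) := by
  have hB : IsOpen (Metric.ball a r) := Metric.isOpen_ball
  have hL := fun j m => (contDiffOn_dualComp hR hρ j m).mono hball
  have hp := fun j m => (contDiffOn_frameComp hR hρ j m).mono hball
  have hcomm : ∀ k i j, ∀ w ∈ Metric.ball a r, connZ R ρ k i j w = connZ R ρ k j i w :=
    fun k i j w hw => connZ_comm hΩ hR hρ k i j (hball hw)
  have hne : ∀ {i j}, ¬ sim i j → i ≠ j := fun h e => h (e ▸ hsim.refl _)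
  have hcZ : ∀ j k i, ContinuousOn (connZ R ρ j k i) (Metric.ball a r) := fun j k i =>
    (continuousOn_finsetSum _ fun m _ => (hL j m).continuousOn.mul
      (continuousOn_partialD hB (hp i m) k)).congr
      fun w hw => connZ_eq_sum hΩ hR hρ j k i (hball hw)
  have hderiv : ∀ i j k, ¬ sim k i → ¬ sim k j → i ≠ j → ∀ w ∈ Metric.ball a r,
      HasDerivAt (fun t => connZ R ρ j j k (Function.update w i t))
        (connZ R ρ j j k w * connZ R ρ k k i w
          + connZ R ρ j j i w * (connZ R ρ i i k w - connZ R ρ j j k w)) (w i) := by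
    intro i j k hki hkj hij w hw
    have hik : ¬ sim i k := fun h => hki (hsim.symm h)
    have hjk : ¬ sim j k := fun h => hkj (hsim.symm h)
    -- The weak curl, in the directions i and j, of the form with components Z^j_·k, evaluated by
    -- flatness.
    have hrz : ∀ z ∈ Metric.ball a r,
        ∑ m, (partialD i (dualComp R ρ j m) z * partialD j (frameComp R ρ k m) z
          - partialD j (dualComp R ρ j m) z * partialD i (frameComp R ρ k m) z) =
        connZ R ρ j j k z * connZ R ρ k k i z
          + connZ R ρ j j i z * (connZ R ρ i i k z - connZ R ρ j j k z) := by
      intro z hz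
      have h0' := fun i j k hs h h' => h0 i j k hs h h' z hz
      rw [sum_partialD_dualComp_mul_partialD_sub hΩ hR hρ i j j k (hball hz),
        Finset.sum_sub_distrib, sum_connZ_mul_connZ h0' (hne hik) hik,
        sum_connZ_mul_connZ h0' (hne hjk) hjk, h0' i k j hik hij.symm (hne hjk),
        hcomm k i k z hz, hcomm j i j z hz]
      ring
    set D : Fin n → (Fin n → ℝ) → ℝ := fun m z =>
      partialD i (dualComp R ρ j m) z * partialD j (frameComp R ρ k m) z
        - partialD j (dualComp R ρ j m) z * partialD i (frameComp R ρ k m) z with hD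
    have cD : ∀ m, ContinuousOn (D m) (Metric.ball a r) := fun m =>
      ((continuousOn_partialD hB (hL j m) i).mul (continuousOn_partialD hB (hp k m) j)).sub
        ((continuousOn_partialD hB (hL j m) j).mul (continuousOn_partialD hB (hp k m) i))
    rw [← hrz w hw]
    -- The i-component Z^j_ik of this form vanishes, so no boundary terms appear: the weak curl is
    -- the i-derivative of the j-component alone, and hence a classical derivative.
    refine hasDerivAt_of_hasDerivAt_coordPrimitive (k := j) (q' := fun z => ∑ m, D m z)
      (hcZ j j k) (continuousOn_finsetSum _ fun m _ => cD m) hij (fun v hv => ?_) hw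
    have hsum : ∀ v ∈ Metric.ball a r, coordPrimitive a j (connZ R ρ j j k) v =
        ∑ m, coordPrimitive a j
          (fun z => dualComp R ρ j m z * partialD j (frameComp R ρ k m) z) v := by
      intro v hv
      rw [← coordPrimitive_sum (r := r) Finset.univ
        (G := fun m z => dualComp R ρ j m z * partialD j (frameComp R ρ k m) z)
        (fun m => (hL j m).continuousOn.mul (continuousOn_partialD hB (hp k m) j)) j hv]
      exact coordPrimitive_congr (fun z hz => connZ_eq_sum hΩ hR hρ j j k (hball hz)) j hv
    have hd := HasDerivAt.fun_sum (u := Finset.univ) fun m _ =>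
      hasDerivAt_coordPrimitive (hL j m) (hp k m) j i (w := v) hv
    have hval : ∑ m, coordPrimitiveDeriv a j (dualComp R ρ j m) (frameComp R ρ k m) i v =
        coordPrimitive a j (fun z => ∑ m, D m z) v := by
      simp only [coordPrimitiveDeriv, if_neg hij]
      rw [Finset.sum_add_distrib, Finset.sum_sub_distrib]
      have hz : ∀ z ∈ Metric.ball a r,
          ∑ m, dualComp R ρ j m z * partialD i (frameComp R ρ k m) z = 0 := by
        intro z hz
        rw [← connZ_eq_sum hΩ hR hρ j i k (hball hz)]
        exact h0 i k j hik hij.symm (hne hjk) z hz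
      rw [hz v hv, hz _ (update_self_mem_ball hv j), sub_zero, zero_add]
      exact (coordPrimitive_sum (r := r) Finset.univ cD j hv).symm
    rw [← hval]
    refine hd.congr_of_eventuallyEq ?_
    filter_upwards [Metric.isOpen_ball.mem_nhds (apply_mem_ball_of_mem_ball_pi hv i)] with t ht
    exact hsum _ (update_mem_ball_pi hv ht)
  refine
    { equiv := hsim
      contDiffOn_L := hL
      contDiffOn_p := hp
      coeff_eq := fun j k w hw => ?_
      coeff_congr := h1
      closed := fun i j k hik hij w hw => ?_
      hasDerivAt_coeff := fun i j k hki hkj hadm w hw => ?_ }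
  · rw [hcomm j j k w hw, connZ_eq_sum hΩ hR hρ j k j (hball hw)]
  · have h0' := fun i j k hs h h' => h0 i j k hs h h' w hw
    have hkj : ¬ sim k j := fun h => hij (hsim.trans hik h)
    rw [sum_partialD_dualComp_mul_partialD_sub hΩ hR hρ i k j j (hball hw),
      Finset.sum_sub_distrib, sum_connZ_mul_connZ h0' (hne hij) hij,
      sum_connZ_mul_connZ h0' (hne hkj) hkj, hcomm j k i w hw, h1 i k j hik hkj w hw,
      hcomm j k j w hw, hcomm j i j w hw]
    ring
  · by_cases hij : i = j
    · subst hij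
      obtain ⟨j', hj', hs⟩ := hadm.resolve_left (fun h => h rfl)
      have hkj' : ¬ sim k j' := fun h => hkj (hsim.trans h hs)
      have hd := hderiv i j' k hki hkj' hj'.symm w hw
      have e : ∀ z ∈ Metric.ball a r, connZ R ρ j' j' k z = connZ R ρ i i k z :=
        h1 j' i k hs fun h => hki (hsim.symm h)
      rw [e w hw, sub_self, mul_zero, add_zero] at hd
      rw [sub_self, mul_zero, add_zero]
      refine hd.congr_of_eventuallyEq ?_
      filter_upwards [Metric.isOpen_ball.mem_nhds (apply_mem_ball_of_mem_ball_pi hw i)] with t ht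
      exact (e _ (update_mem_ball_pi hw ht)).symm
    · exact hderiv i j k hki hkj hij w hw
end


/-! ### Classes of imposed equalities and the eigenvalue counts -/

section
variable {n : ℕ}

/-- The classes with at least two elements of an equivalence relation on `Fin n`. -/
theorem exists_nontrivial_classes {sim : Fin n → Fin n → Prop} (hsim : Equivalence sim) :
    ∃ (s₀ : ℕ) (A : Fin s₀ → Finset (Fin n)), (∀ α, 2 ≤ (A α).card) ∧
      (∀ α β, α ≠ β → Disjoint (A α) (A β)) ∧
      (∀ i j, i ≠ j → (sim i j ↔ ∃ α, i ∈ A α ∧ j ∈ A α)) := by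
  classical
  set cl : Fin n → Finset (Fin n) := fun i => Finset.univ.filter (sim i) with hcl
  have hmem : ∀ i j, j ∈ cl i ↔ sim i j := fun i j => by simp [hcl]
  have hcleq : ∀ i j, sim i j → cl i = cl j := fun i j hij => by
    ext k
    rw [hmem, hmem]
    exact ⟨fun h => hsim.trans (hsim.symm hij) h, fun h => hsim.trans hij h⟩
  -- Classes are enumerated as sets rather than by representatives, so each is listed once.
  let Q := {S : Finset (Fin n) // (∃ i, S = cl i) ∧ 2 ≤ S.card}
  let e := Fintype.equivFin Q
  refine ⟨Fintype.card Q, fun α => (e.symm α).1, fun α => (e.symm α).2.2, fun α β hαβ => ?_,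
    fun i j hij => ⟨fun h => ?_, ?_⟩⟩
  · obtain ⟨⟨i, hi⟩, -⟩ := (e.symm α).2
    obtain ⟨⟨j, hj⟩, -⟩ := (e.symm β).2
    rw [Finset.disjoint_left]
    intro k hk hk'
    change k ∈ (e.symm α).1 at hk
    change k ∈ (e.symm β).1 at hk'
    rw [hi, hmem] at hk
    rw [hj, hmem] at hk'
    exact hαβ (e.symm.injective (Subtype.ext (by
      rw [hi, hj, hcleq i j (hsim.trans hk (hsim.symm hk'))])))
  · have hc : 2 ≤ (cl i).card :=
      Finset.one_lt_card.2 ⟨i, (hmem i i).2 (hsim.refl i), j, (hmem i j).2 h, hij⟩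
    refine ⟨e ⟨cl i, ⟨i, rfl⟩, hc⟩, ?_⟩
    simp only [Equiv.symm_apply_apply]
    exact ⟨(hmem i i).2 (hsim.refl i), (hmem i j).2 h⟩
  · rintro ⟨α, hi, hj⟩
    obtain ⟨⟨k, hk⟩, -⟩ := (e.symm α).2
    change i ∈ (e.symm α).1 at hi
    change j ∈ (e.symm α).1 at hj
    rw [hk, hmem] at hi hj
    exact hsim.trans (hsim.symm hi) hj

variable {s₀ : ℕ} {A : Fin s₀ → Finset (Fin n)} {κ : Fin n → (Fin n → ℝ) → ℝ} {w : Fin n → ℝ}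

theorem exists_ne_mem_of_two_le_card (h2 : ∀ α, 2 ≤ (A α).card) (α : Fin s₀) (i : Fin n) :
    ∃ j ∈ A α, j ≠ i :=
  Finset.exists_mem_ne (h2 α) i

theorem setOf_simple_subset (h2 : ∀ α, 2 ≤ (A α).card)
    (hκ : ∀ α, ∀ i ∈ A α, ∀ j ∈ A α, κ i w = κ j w) :
    {i | ∀ j, j ≠ i → κ j w ≠ κ i w} ⊆ ↑(Finset.univ.biUnion A)ᶜ := by
  intro i hi
  simp only [Finset.coe_compl, Set.mem_compl_iff, Finset.mem_coe, Finset.mem_biUnion,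
    Finset.mem_univ, true_and, not_exists]
  intro α hα
  obtain ⟨j, hj, hji⟩ := exists_ne_mem_of_two_le_card h2 α i
  exact hi j hji (hκ α j hj i hα)

theorem numSimple_le (h2 : ∀ α, 2 ≤ (A α).card)
    (hκ : ∀ α, ∀ i ∈ A α, ∀ j ∈ A α, κ i w = κ j w) :
    numSimple κ w ≤ (Finset.univ.biUnion A)ᶜ.card := by
  rw [← Set.ncard_coe_finset]
  exact Set.ncard_le_ncard (setOf_simple_subset h2 hκ) (Finset.finite_toSet _)

/-- If the number of simple eigenvalues is maximal, every index outside the blocks is simple. Each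
repeated value is then the common value of some block. -/
theorem numNonSimple_le (h2 : ∀ α, 2 ≤ (A α).card)
    (hκ : ∀ α, ∀ i ∈ A α, ∀ j ∈ A α, κ i w = κ j w)
    (hs : numSimple κ w = (Finset.univ.biUnion A)ᶜ.card) : numNonSimple κ w ≤ s₀ := by
  have heq := Set.eq_of_subset_of_ncard_le (setOf_simple_subset h2 hκ)
    (by rw [Set.ncard_coe_finset]; exact hs.ge) (Finset.finite_toSet _)
  have hne : ∀ α, ∃ i, i ∈ A α := fun α =>
    Finset.card_pos.1 (lt_of_lt_of_le (by norm_num) (h2 α))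
  choose rep hrep using hne
  have hsub : {c : ℝ | ∃ i j, i ≠ j ∧ κ i w = c ∧ κ j w = c} ⊆
      Set.range fun α => κ (rep α) w := by
    rintro c ⟨i, j, hij, hi, hj⟩
    have hns : i ∉ {i | ∀ j, j ≠ i → κ j w ≠ κ i w} := fun h => h j hij.symm (hj.trans hi.symm)
    rw [heq] at hns
    simp only [Finset.coe_compl, Set.mem_compl_iff, Finset.mem_coe, Finset.mem_biUnion,
      Finset.mem_univ, true_and, not_exists, not_not, not_forall] at hns
    obtain ⟨α, hα⟩ := hns
    exact ⟨α, by rw [← hi]; exact hκ α _ (hrep α) _ hα⟩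
  calc numNonSimple κ w ≤ (Set.range fun α => κ (rep α) w).ncard :=
        Set.ncard_le_ncard hsub (Set.finite_range _)
    _ ≤ (Set.univ : Set (Fin s₀)).ncard := by
        rw [← Set.image_univ]; exact Set.ncard_image_le (Set.toFinite _)
    _ = s₀ := by simp [Set.ncard_univ]

theorem numSimple_eq (h2 : ∀ α, 2 ≤ (A α).card)
    (hκ : ∀ α, ∀ i ∈ A α, ∀ j ∈ A α, κ i w = κ j w)
    (hne : ∀ i j, i ≠ j → (¬ ∃ α, i ∈ A α ∧ j ∈ A α) → κ i w ≠ κ j w) :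
    numSimple κ w = (Finset.univ.biUnion A)ᶜ.card := by
  rw [← Set.ncard_coe_finset]
  unfold numSimple
  congr 1
  refine (setOf_simple_subset h2 hκ).antisymm fun i hi j hji => hne j i hji ?_
  rintro ⟨α, -, hα⟩
  simp only [Finset.coe_compl, Set.mem_compl_iff, Finset.mem_coe, Finset.mem_biUnion,
    Finset.mem_univ, true_and, not_exists] at hi
  exact hi α hα

theorem numNonSimple_eq (h2 : ∀ α, 2 ≤ (A α).card)
    (hd : ∀ α β, α ≠ β → Disjoint (A α) (A β))
    (hκ : ∀ α, ∀ i ∈ A α, ∀ j ∈ A α, κ i w = κ j w)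
    (hne : ∀ i j, i ≠ j → (¬ ∃ α, i ∈ A α ∧ j ∈ A α) → κ i w ≠ κ j w) :
    numNonSimple κ w = s₀ := by
  refine le_antisymm (numNonSimple_le h2 hκ (numSimple_eq h2 hκ hne)) ?_
  have hne' : ∀ α, ∃ i, i ∈ A α := fun α =>
    Finset.card_pos.1 (lt_of_lt_of_le (by norm_num) (h2 α))
  choose rep hrep using hne'
  have hinj : Function.Injective fun α => κ (rep α) w := by
    intro α β hαβ
    by_contra hne₁
    have hdis := Finset.disjoint_left.1 (hd α β hne₁)
    refine hne (rep α) (rep β) (fun h => hdis (hrep α) (h ▸ hrep β)) ?_ hαβ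
    rintro ⟨γ, h1, h2⟩
    rcases eq_or_ne γ α with rfl | hγ
    · exact hdis h2 (hrep β)
    · exact Finset.disjoint_left.1 (hd γ α hγ) h1 (hrep α)
  have hsub : (Set.range fun α => κ (rep α) w) ⊆
      {c : ℝ | ∃ i j, i ≠ j ∧ κ i w = c ∧ κ j w = c} := by
    rintro _ ⟨α, rfl⟩
    obtain ⟨j, hj, hji⟩ := exists_ne_mem_of_two_le_card h2 α (rep α)
    exact ⟨rep α, j, hji.symm, rfl, hκ α _ hj _ (hrep α)⟩
  have hfin : {c : ℝ | ∃ i j, i ≠ j ∧ κ i w = c ∧ κ j w = c}.Finite :=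
    (Set.finite_range fun i => κ i w).subset fun c ⟨i, _, _, hi, _⟩ => ⟨i, hi⟩
  calc s₀ = (Set.range fun α => κ (rep α) w).ncard := by
        rw [← Set.image_univ, Set.ncard_image_of_injective _ hinj]; simp [Set.ncard_univ]
    _ ≤ _ := Set.ncard_le_ncard hsub hfin
end

/-! ### Uniqueness for the linear system -/

section
variable {n : ℕ} {a : Fin n → ℝ} {r : ℝ} {c : Fin n → Fin n → (Fin n → ℝ) → ℝ}
  {δ : Fin n → (Fin n → ℝ) → ℝ}

theorem fderiv_apply_eq_sum_partialD {f : (Fin n → ℝ) → ℝ} (w v : Fin n → ℝ) :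
    fderiv ℝ f w v = ∑ i, v i * partialD i f w := by
  have : v = ∑ i, v i • (Pi.single i 1 : Fin n → ℝ) := by
    ext j; simp [Finset.sum_apply, Pi.single_apply]
  conv_lhs => rw [this]
  rw [map_sum]
  simp [partialD]

/-- A `C¹` solution of the homogeneous linear system that vanishes on the initial manifolds
vanishes. -/
theorem eventually_eq_zero_of_lambda_system (hr : 0 < r)
    (hc : ∀ j i, ContinuousOn (c j i) (Metric.ball a r))
    (hδ : ∀ j, ContDiffOn ℝ 1 (δ j) (Metric.ball a r)) {P : Fin n → Prop}
    (hd : ∀ i j, (i ≠ j ∨ P j) → ∀ w ∈ Metric.ball a r,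
      partialD i (δ j) w = c j i w * (δ i w - δ j w))
    (h0 : ∀ j, P j → δ j a = 0)
    (h1 : ∀ j, ¬ P j → ∀ w ∈ Metric.ball a r, δ j (Function.update a j (w j)) = 0) :
    ∀ᶠ w in 𝓝 a, ∀ j, δ j w = 0 := by
  classical
  have hr2 : r / 2 < r := by linarith
  obtain ⟨C, hC0, hC⟩ := exists_uniform_bound (f := fun x : Fin n × Fin n => c x.1 x.2) hr2
    fun x => hc x.1 x.2
  obtain ⟨S₀, hS₀0, hS₀⟩ := exists_uniform_bound (f := δ) hr2 fun j => (hδ j).continuousOn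
  set ε := min (r / 2) (1 / (4 * (n * C + 1))) with hε
  have hε0 : 0 < ε := lt_min (by positivity) (by positivity)
  have hεC : ε * (n * C) ≤ 1 / 4 := by
    calc ε * (n * C) ≤ 1 / (4 * (n * C + 1)) * (n * C + 1) := by
          gcongr
          · exact min_le_right _ _
          · linarith
      _ = 1 / 4 := by field_simp
  have hsub : Metric.ball a ε ⊆ Metric.ball a (r / 2) :=
    Metric.ball_subset_ball (min_le_left _ _)
  have hsub' : Metric.ball a ε ⊆ Metric.ball a r :=
    hsub.trans (Metric.ball_subset_ball hr2.le)
  have hzero := eq_zero_of_bound_halving (S := S₀)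
    (ι := {x : Fin n × (Fin n → ℝ) // x.2 ∈ Metric.ball a ε}) (f := fun x => δ x.1.1 x.1.2)
    (fun x => hS₀ _ _ (hsub x.2)) (by
      rintro S hS ⟨⟨j, w⟩, hw⟩
      have hS0 : 0 ≤ S := (abs_nonneg _).trans (hS ⟨(j, w), hw⟩)
      -- `b` is a point where δ^j is known to vanish: the base point, or, when ∂_j δ^j is not
      -- prescribed, the point of the j-axis with the same j-th coordinate as `w`. In the latter
      -- case the segment from `b` to `w` has no j-component, so the missing equation is not used.
      obtain ⟨b, hb, hbδ, hbw, hbd⟩ : ∃ b ∈ Metric.ball a ε, δ j b = 0 ∧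
          (¬ P j → w j - b j = 0) ∧ ∀ i, |w i - b i| ≤ ε := by
        have hwi : ∀ i, |w i - a i| ≤ ε := fun i => by
          have := Metric.mem_ball.1 (apply_mem_ball_of_mem_ball_pi hw i)
          rw [Real.dist_eq] at this
          exact this.le
        by_cases hP : P j
        · exact ⟨a, Metric.mem_ball_self hε0, h0 j hP, fun h => absurd hP h, hwi⟩
        · refine ⟨Function.update a j (w j), update_mem_ball_pi (Metric.mem_ball_self hε0)
            (apply_mem_ball_of_mem_ball_pi hw j), h1 j hP w (hsub' hw), fun _ => by simp,
            fun i => ?_⟩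
          rcases eq_or_ne i j with rfl | hij
          · simpa using hε0.le
          · simpa [hij] using hwi i
      have hseg : ∀ t ∈ Set.Icc (0 : ℝ) 1, b + t • (w - b) ∈ Metric.ball a ε := fun t ht =>
        (convex_ball a ε).add_smul_sub_mem hb hw ht
      have hder : ∀ t ∈ Set.Icc (0 : ℝ) 1, HasDerivWithinAt (fun t : ℝ => δ j (b + t • (w - b)))
          (fderiv ℝ (δ j) (b + t • (w - b)) (w - b)) (Set.Icc 0 1) t := by
        intro t ht
        have hf : HasFDerivAt (δ j) (fderiv ℝ (δ j) (b + t • (w - b))) (b + t • (w - b)) :=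
          (((hδ j).differentiableOn one_ne_zero).differentiableAt
            (Metric.isOpen_ball.mem_nhds (hsub' (hseg t ht)))).hasFDerivAt
        have hl : HasDerivAt (fun t : ℝ => b + t • (w - b)) (w - b) t := by
          simpa using ((hasDerivAt_id t).smul_const (w - b)).const_add b
        exact (hf.comp_hasDerivAt t hl).hasDerivWithinAt
      have hbound : ∀ t ∈ Set.Ico (0 : ℝ) 1,
          ‖fderiv ℝ (δ j) (b + t • (w - b)) (w - b)‖ ≤ S / 2 := by
        intro t ht
        have hz := hseg t ⟨ht.1, ht.2.le⟩
        set z := b + t • (w - b)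
        rw [fderiv_apply_eq_sum_partialD]
        have hterm : ∀ i, |(w - b) i * partialD i (δ j) z| ≤ ε * (C * (2 * S)) := by
          intro i
          by_cases hadm : i ≠ j ∨ P j
          · rw [hd i j hadm z (hsub' hz), abs_mul, abs_mul]
            have e1 := hC (j, i) z (hsub hz)
            have e2 : |δ i z - δ j z| ≤ 2 * S := (abs_sub _ _).trans
              (by linarith [hS ⟨(i, z), hz⟩, hS ⟨(j, z), hz⟩])
            have e3 := hbd i
            simp only [Pi.sub_apply]
            gcongr
          · push Not at hadm
            have : (w - b) i = 0 := by
              rw [hadm.1]; exact hbw hadm.2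
            rw [this, zero_mul, abs_zero]
            positivity
        calc ‖∑ i, (w - b) i * partialD i (δ j) z‖ ≤ ∑ _i : Fin n, ε * (C * (2 * S)) :=
              (Finset.abs_sum_le_sum_abs _ _).trans (Finset.sum_le_sum fun i _ => hterm i)
          _ = 2 * S * (ε * (n * C)) := by simp; ring
          _ ≤ 2 * S * (1 / 4) := by gcongr
          _ = S / 2 := by ring
      have := norm_image_sub_le_of_norm_deriv_le_segment_01' hder hbound
      simpa [hbδ] using this)
  filter_upwards [Metric.ball_mem_nhds a hε0] with w hw j
  exact hzero ⟨(j, w), hw⟩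
end


/-! ### Reduction of the λ-system by the imposed equalities -/

section
variable {n : ℕ} {R : Fin n → (Fin n → ℝ) → (Fin n → ℝ)} {Ω : Set (Fin n → ℝ)}
  {ρ : OpenPartialHomeomorph (Fin n → ℝ) (Fin n → ℝ)} {wbar : Fin n → ℝ}
  {κ : Fin n → (Fin n → ℝ) → ℝ}

theorem equivalence_imposesEq : Equivalence (ImposesEq R ρ wbar) where
  refl _ _ _ := Eventually.of_forall fun _ => rfl
  symm h κ hκ := (h κ hκ).mono fun _ e => e.symm
  trans h h' κ hκ := by
    filter_upwards [h κ hκ, h' κ hκ] with w e e' using e.trans e'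

/-- Where g is nonzero it is nonzero on a neighbourhood, which would meet the dense set where f is
nonzero. -/
theorem eventually_eq_zero_of_mul_eq_zero {U : Set (Fin n → ℝ)} (hU : IsOpen U) (hw : wbar ∈ U)
    {f g : (Fin n → ℝ) → ℝ} (hf : ∀ᶠ w in 𝓝 wbar, w ∈ closure {z | f z ≠ 0})
    (hg : ContinuousOn g U) (h : ∀ w ∈ U, f w * g w = 0) : ∀ᶠ w in 𝓝 wbar, g w = 0 := by
  filter_upwards [hf, hU.mem_nhds hw] with w hwf hwU
  by_contra hne
  have hnhds : ∀ᶠ z in 𝓝 w, g z ≠ 0 ∧ z ∈ U :=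
    ((hg.continuousAt (hU.mem_nhds hwU)).eventually_ne hne).and (hU.mem_nhds hwU)
  obtain ⟨z, ⟨hz1, hz2⟩, hz3⟩ := mem_closure_iff_nhds.1 hwf _ hnhds
  exact (mul_ne_zero hz3 hz1) (h z hz2)

/-- If the coefficient were densely nonzero, the algebraic equation would give κ^i = κ^j for every
local solution, and the equality would be imposed. -/
theorem eventually_connZ_eq_zero (hΩ : IsOpen Ω) (hR : IsC1FrameOn R Ω)
    (hρ : IsNormalizedRiemannInvariants R Ω ρ) {i j k : Fin n}
    (hZ : ZeroOrDenselyNonzeroAt (connZ R ρ k i j) wbar) (hki : k ≠ i) (hkj : k ≠ j)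
    (hij : ¬ ImposesEq R ρ wbar i j) : ∀ᶠ w in 𝓝 wbar, connZ R ρ k i j w = 0 := by
  refine hZ.resolve_right fun hdense => hij fun κ hκ => ?_
  obtain ⟨U, hU, hwU, hUt, hsol⟩ := hκ
  have hg : ContinuousOn (fun w => κ i w - κ j w) U :=
    (hsol.contDiffOn i).continuousOn.sub (hsol.contDiffOn j).continuousOn
  have := eventually_eq_zero_of_mul_eq_zero hU hwU hdense hg fun w hw => by
    rcases lt_trichotomy i j with h | h | h
    · linarith [hsol.algebraic i j k h hki hkj w hw]
    · simp [h]
    · rw [connZ_comm hΩ hR hρ k i j (hUt hw)]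
      linarith [hsol.algebraic j i k h hkj hki w hw]
  exact this.mono fun w hw => sub_eq_zero.1 hw

/-- Differentiating κ^j = κ^k along w^i gives (Z^j_ji - Z^k_ki)(κ^i - κ^j) = 0. A densely nonzero
factor would impose κ^i = κ^j. -/
theorem eventually_connZ_sub_eq_zero {i j k : Fin n} (hij : i ≠ j) (hki : k ≠ i)
    (hZ : ZeroOrDenselyNonzeroAt (fun w => connZ R ρ j j i w - connZ R ρ k k i w) wbar)
    (hjk : ImposesEq R ρ wbar j k) (hnij : ¬ ImposesEq R ρ wbar i j) :
    ∀ᶠ w in 𝓝 wbar, connZ R ρ j j i w - connZ R ρ k k i w = 0 := by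
  refine hZ.resolve_right fun hdense => hnij fun κ hκ => ?_
  have hjk' := hjk κ hκ
  obtain ⟨U, hU, hwU, hUt, hsol⟩ := hκ
  obtain ⟨V, hV, hVo, hwV⟩ := eventually_nhds_iff.1 hjk'
  have hg : ContinuousOn (fun w => κ i w - κ j w) (U ∩ V) :=
    ((hsol.contDiffOn i).continuousOn.sub (hsol.contDiffOn j).continuousOn).mono
      Set.inter_subset_left
  have := eventually_eq_zero_of_mul_eq_zero (hU.inter hVo) ⟨hwU, hwV⟩ hdense hg fun w hw => by
    have h1 := hsol.differential i j hij w hw.1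
    have h2 := hsol.differential i k hki.symm w hw.1
    have h3 := partialD_congr hVo hV i hw.2
    rw [h1, h2, ← hV w hw.2] at h3
    linarith
  exact this.mono fun w hw => sub_eq_zero.1 hw

/-- On a ball around the base point the `λ`-system reduces to a compatible system for the common
values of the `κʲ` with imposed equality. -/
theorem exists_isCompatibleSystem (hΩ : IsOpen Ω) (hR : IsC1FrameOn R Ω)
    (hρ : IsNormalizedRiemannInvariants R Ω ρ) (hwbar : wbar ∈ ρ.target)
    (hZ : ∀ i j k, i ≠ j → k ≠ i → k ≠ j → ZeroOrDenselyNonzeroAt (connZ R ρ k i j) wbar)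
    (hZ' : ∀ i j k, i ≠ j → k ≠ i → j ≠ k → ImposesEq R ρ wbar j k →
      ZeroOrDenselyNonzeroAt (fun w => connZ R ρ j j i w - connZ R ρ k k i w) wbar) :
    ∃ r > 0, Metric.ball wbar r ⊆ ρ.target ∧
      (∀ i j k, ¬ ImposesEq R ρ wbar i j → k ≠ i → k ≠ j → ∀ w ∈ Metric.ball wbar r,
        connZ R ρ k i j w = 0) ∧
      IsCompatibleSystem wbar r (ImposesEq R ρ wbar) (fun j k => connZ R ρ j j k)
        (dualComp R ρ) (frameComp R ρ) := by
  have hsim : Equivalence (ImposesEq R ρ wbar) := equivalence_imposesEq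
  have hne : ∀ {i j}, ¬ ImposesEq R ρ wbar i j → i ≠ j := fun h e => h (e ▸ hsim.refl _)
  have h0 : ∀ᶠ w in 𝓝 wbar, ∀ i j k, ¬ ImposesEq R ρ wbar i j → k ≠ i → k ≠ j →
      connZ R ρ k i j w = 0 := by
    simp only [eventually_all]
    intro i j k hij hki hkj
    exact eventually_connZ_eq_zero hΩ hR hρ (hZ i j k (hne hij) hki hkj) hki hkj hij
  have h1 : ∀ᶠ w in 𝓝 wbar, ∀ i j k, ImposesEq R ρ wbar i j → ¬ ImposesEq R ρ wbar j k →
      connZ R ρ i i k w = connZ R ρ j j k w := by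
    simp only [eventually_all]
    intro i j k hij hjk
    rcases eq_or_ne i j with rfl | hne'
    · exact Eventually.of_forall fun _ => rfl
    have hki : ¬ ImposesEq R ρ wbar k i := fun h => hjk (hsim.symm (hsim.trans h hij))
    exact (eventually_connZ_sub_eq_zero (hne hki) (hne hjk)
      (hZ' k i j (hne hki) (hne hjk) hne' hij) hij hki).mono fun w hw => sub_eq_zero.1 hw
  obtain ⟨r, hr, hball⟩ := Metric.eventually_nhds_iff_ball.1
    ((h0.and h1).and (show ∀ᶠ w in 𝓝 wbar, w ∈ ρ.target from ρ.open_target.mem_nhds hwbar))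
  refine ⟨r, hr, fun w hw => (hball w hw).2,
    fun i j k h h' h'' w hw => (hball w hw).1.1 i j k h h' h'', ?_⟩
  exact isCompatibleSystem_connZ hΩ hR hρ (fun w hw => (hball w hw).2) hsim
    (fun i j k h h' h'' w hw => (hball w hw).1.1 i j k h h' h'')
    (fun i j k h h' w hw => (hball w hw).1.2 i j k h h')

/-- On a small ball a local solution takes equal values at equivalent indices. -/
theorem IsLocalSolution.exists_ball (h : IsLocalSolution R ρ wbar κ) :
    ∃ r > 0, Metric.ball wbar r ⊆ ρ.target ∧
      IsLambdaSolutionOn (connZ R ρ) (Metric.ball wbar r) κ ∧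
      ∀ i j, ImposesEq R ρ wbar i j → ∀ w ∈ Metric.ball wbar r, κ i w = κ j w := by
  have h1 : ∀ᶠ w in 𝓝 wbar, ∀ i j, ImposesEq R ρ wbar i j → κ i w = κ j w := by
    simp only [eventually_all]
    exact fun i j hij => hij κ h
  obtain ⟨U, hU, hwU, hUt, hsol⟩ := h
  obtain ⟨r, hr, hball⟩ := Metric.eventually_nhds_iff_ball.1
    (h1.and (show ∀ᶠ w in 𝓝 wbar, w ∈ U from hU.mem_nhds hwU))
  exact ⟨r, hr, fun w hw => hUt (hball w hw).2,
    { contDiffOn := fun j => (hsol.contDiffOn j).mono fun w hw => (hball w hw).2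
      differential := fun i j hij w hw => hsol.differential i j hij w (hball w hw).2
      algebraic := fun i j k h h' h'' w hw => hsol.algebraic i j k h h' h'' w (hball w hw).2 },
    fun i j hij w hw => (hball w hw).1 i j hij⟩

/-- For i ≠ j the right-hand side of the equation vanishes. For i = j the system has no equation,
but κ^j coincides with some κ^j' of its class, whose derivative along w^j is prescribed and zero. -/
theorem IsLambdaSolutionOn.partialD_eq_zero {Z : Fin n → Fin n → Fin n → (Fin n → ℝ) → ℝ}
    {U : Set (Fin n → ℝ)} {sim : Fin n → Fin n → Prop} (h : IsLambdaSolutionOn Z U κ)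
    (hU : IsOpen U) (hs : ∀ i j, sim i j → ∀ w ∈ U, κ i w = κ j w) {i j : Fin n} (hij : sim i j)
    (hadm : i ≠ j ∨ ∃ j', j' ≠ j ∧ sim j' j) {w : Fin n → ℝ} (hw : w ∈ U) :
    partialD i (κ j) w = 0 := by
  by_cases hne : i = j
  · subst hne
    obtain ⟨j', hj', hs'⟩ := hadm.resolve_left fun h => h rfl
    rw [← partialD_congr hU (hs j' i hs') i hw, h.differential i j' hj'.symm w hw,
      hs j' i hs' w hw, sub_self, mul_zero]
  · rw [h.differential i j hne w hw, hs i j hij w hw, sub_self, mul_zero]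
end


/-! ### Existence and uniqueness for prescribed initial data -/

section
variable {n : ℕ} {R : Fin n → (Fin n → ℝ) → (Fin n → ℝ)}
  {ρ : OpenPartialHomeomorph (Fin n → ℝ) (Fin n → ℝ)} {wbar : Fin n → ℝ} {s₀ : ℕ}
  {A : Fin s₀ → Finset (Fin n)} {φ : Fin n → ℝ → ℝ} {h : Fin s₀ → ℝ}

theorem mem_class_iff (h2 : ∀ α, 2 ≤ (A α).card)
    (hA : ∀ i j, i ≠ j → (ImposesEq R ρ wbar i j ↔ ∃ α, i ∈ A α ∧ j ∈ A α)) (j : Fin n) :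
    (∃ j', j' ≠ j ∧ ImposesEq R ρ wbar j' j) ↔ ∃ α, j ∈ A α := by
  constructor
  · rintro ⟨j', hne, hs⟩
    obtain ⟨α, -, hα⟩ := (hA j' j hne).1 hs
    exact ⟨α, hα⟩
  · rintro ⟨α, hα⟩
    obtain ⟨j', hj', hne⟩ := exists_ne_mem_of_two_le_card h2 α j
    exact ⟨j', hne, (hA j' j hne).2 ⟨α, hj', hα⟩⟩

theorem imposesEq_of_mem_class
    (hA : ∀ i j, i ≠ j → (ImposesEq R ρ wbar i j ↔ ∃ α, i ∈ A α ∧ j ∈ A α))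
    {α : Fin s₀} {i j : Fin n} (hi : i ∈ A α) (hj : j ∈ A α) : ImposesEq R ρ wbar i j := by
  rcases eq_or_ne i j with rfl | hne
  · exact equivalence_imposesEq.refl i
  · exact (hA i j hne).2 ⟨α, hi, hj⟩

/-- The compatible system supplies the differential equations. The algebraic ones hold because each
has either a vanishing coefficient (i ≁ j) or equal values κ^i = κ^j (i ~ j). -/
theorem exists_localSolution_hasInitialData {r : ℝ} (hr : 0 < r)
    (hball : Metric.ball wbar r ⊆ ρ.target)
    (hZ0 : ∀ i j k, ¬ ImposesEq R ρ wbar i j → k ≠ i → k ≠ j → ∀ w ∈ Metric.ball wbar r,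
      connZ R ρ k i j w = 0)
    (hs : IsCompatibleSystem wbar r (ImposesEq R ρ wbar) (fun j k => connZ R ρ j j k)
      (dualComp R ρ) (frameComp R ρ))
    (h2 : ∀ α, 2 ≤ (A α).card) (hdis : ∀ α β, α ≠ β → Disjoint (A α) (A β))
    (hA : ∀ i j, i ≠ j → (ImposesEq R ρ wbar i j ↔ ∃ α, i ∈ A α ∧ j ∈ A α))
    (hφ : ∀ i, (∀ α, i ∉ A α) → ContDiffAt ℝ 1 (φ i) (wbar i)) :
    ∃ κ, IsLocalSolution R ρ wbar κ ∧ HasInitialData A φ h wbar κ := by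
  classical
  have hsim : Equivalence (ImposesEq R ρ wbar) := equivalence_imposesEq
  have hblock := mem_class_iff h2 hA
  obtain ⟨r₁, hr₁, hφ₁⟩ : ∃ r₁ > 0, ∀ i, (∀ α, i ∉ A α) →
      ContDiffOn ℝ 1 (φ i) (Metric.ball (wbar i) r₁) := by
    have : ∀ i, ∃ r₁ > 0, (∀ α, i ∉ A α) → ContDiffOn ℝ 1 (φ i) (Metric.ball (wbar i) r₁) := by
      intro i
      by_cases hi : ∀ α, i ∉ A α
      · obtain ⟨r₁, hr₁, hb⟩ := Metric.eventually_nhds_iff_ball.1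
          ((hφ i hi).eventually (by simp))
        exact ⟨r₁, hr₁, fun _ t ht => (hb t ht).contDiffWithinAt⟩
      · exact ⟨1, one_pos, fun hi' => absurd hi' hi⟩
    choose f hf0 hf using this
    obtain ⟨r₁, h1, h2⟩ : ∃ r₁ > 0, ∀ i, r₁ ≤ f i := by
      rcases isEmpty_or_nonempty (Fin n) with he | he
      · exact ⟨1, one_pos, fun i => he.elim i⟩
      · exact ⟨Finset.univ.inf' Finset.univ_nonempty f,
          (Finset.lt_inf'_iff _).2 fun i _ => hf0 i, fun i => Finset.inf'_le _ (Finset.mem_univ i)⟩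
    exact ⟨r₁, h1, fun i hi => (hf i hi).mono (Metric.ball_subset_ball (h2 i))⟩
  set r₂ := min r r₁
  have hr₂ : 0 < r₂ := lt_min hr hr₁
  have hs₂ := hs.mono (min_le_left r r₁)
  -- Since the blocks are disjoint, the chosen block is the only one containing `j`, so the choice
  -- does no harm.
  set ψ : Fin n → (Fin n → ℝ) → ℝ := fun j w =>
    if H : ∃ α, j ∈ A α then h H.choose else φ j (w j) with hψ
  have hψA : ∀ {j α}, j ∈ A α → ∀ w, ψ j w = h α := by
    intro j α hj w
    have H : ∃ α, j ∈ A α := ⟨α, hj⟩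
    simp only [hψ, dif_pos H]
    by_contra hne
    have : H.choose ≠ α := fun e => hne (by rw [e])
    exact Finset.disjoint_left.1 (hdis _ _ this) H.choose_spec hj
  have hψφ : ∀ {j}, (¬ ∃ α, j ∈ A α) → ∀ w, ψ j w = φ j (w j) := fun hj w => dif_neg hj
  obtain ⟨ε, hε, hεr, κ, hκ, hκs, hκd, hκ0⟩ := hs₂.exists_solution (ψ := ψ) hr₂
    (fun j => by
      by_cases hj : ∃ α, j ∈ A α
      · simp only [hψ, dif_pos hj]; exact contDiffOn_const
      · have e : ψ j = fun w => φ j (w j) := funext (hψφ hj)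
        rw [e]
        refine (hφ₁ j (fun α hα => hj ⟨α, hα⟩)).comp (contDiff_apply ℝ ℝ j).contDiffOn fun w hw => ?_
        exact Metric.ball_subset_ball (min_le_right r r₁) (apply_mem_ball_of_mem_ball_pi hw j))
    (fun i j hij w _ => by
      rcases eq_or_ne i j with rfl | hne
      · rfl
      · obtain ⟨α, hi, hj⟩ := (hA i j hne).1 hij
        rw [hψA hi, hψA hj])
    (fun j N w _ => by
      by_cases hj : ∃ α, j ∈ A α
      · obtain ⟨α, hα⟩ := hj
        rw [hψA hα, hψA hα]
      · have : j ∈ keepSet (ImposesEq R ρ wbar) j N := mem_keepSet.2 (Or.inr (hsim.refl j))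
        rw [hψφ hj, hψφ hj]
        simp [this])
    (fun i j hji hadm w _ => by
      have hj : ∃ α, j ∈ A α := by
        rcases hadm with hne | hb
        · exact (hblock j).1 ⟨i, hne, hsim.symm hji⟩
        · exact (hblock j).1 hb
      obtain ⟨α, hα⟩ := hj
      have e : ψ j = fun _ => h α := funext (hψA hα)
      simp [e, partialD])
  have hsub : Metric.ball wbar ε ⊆ Metric.ball wbar r :=
    Metric.ball_subset_ball (hεr.trans (min_le_left _ _))
  refine ⟨κ, ⟨Metric.ball wbar ε, Metric.isOpen_ball, Metric.mem_ball_self hε, hsub.trans hball,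
    hκ, fun i j hij w hw => hκd i j (Or.inl hij) w hw, fun i j k hij hki hkj w hw => ?_⟩, ?_, ?_⟩
  · by_cases hsij : ImposesEq R ρ wbar i j
    · rw [hκs i j hsij w hw, sub_self, mul_zero]
    · rw [hZ0 i j k hsij hki hkj w (hsub hw), zero_mul]
  · intro i hi
    have hi' : ¬ ∃ α, i ∈ A α := not_exists.2 hi
    filter_upwards [Metric.ball_mem_nhds (wbar i) hε] with t ht
    have := hκ0 i (Function.update wbar i t)
      (update_mem_ball_pi (Metric.mem_ball_self hε) ht)
    rw [hψφ hi', Function.update_self] at this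
    rw [← this]
    congr 1
    ext l
    by_cases hl : l ∈ keepSet (ImposesEq R ρ wbar) i 0
    · simp [hl]
    · have : l ≠ i := fun e => hl (mem_keepSet.2 (Or.inr (e ▸ hsim.refl i)))
      simp [hl, this]
  · intro α i hi
    have := hκ0 i wbar (Metric.mem_ball_self hε)
    rw [hψA hi, Finset.piecewise_same] at this
    exact this

/-- The difference of two solutions solves the same homogeneous system: it vanishes at the base
point for block indices and on the own axis for the others. For block indices the equation along
w^j, absent from the λ-system, reads 0 = 0. -/
theorem localSolution_unique {r : ℝ} (hr : 0 < r)
    (hs : IsCompatibleSystem wbar r (ImposesEq R ρ wbar) (fun j k => connZ R ρ j j k)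
      (dualComp R ρ) (frameComp R ρ))
    (h2 : ∀ α, 2 ≤ (A α).card)
    (hA : ∀ i j, i ≠ j → (ImposesEq R ρ wbar i j ↔ ∃ α, i ∈ A α ∧ j ∈ A α))
    {κ κ' : Fin n → (Fin n → ℝ) → ℝ}
    (hκ : IsLocalSolution R ρ wbar κ) (hκi : HasInitialData A φ h wbar κ)
    (hκ' : IsLocalSolution R ρ wbar κ') (hκi' : HasInitialData A φ h wbar κ') :
    ∀ᶠ w in 𝓝 wbar, ∀ i, κ i w = κ' i w := by
  have hblock := mem_class_iff h2 hA
  obtain ⟨r₁, hr₁, -, hsol, heq⟩ := hκ.exists_ball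
  obtain ⟨r₂, hr₂, -, hsol', heq'⟩ := hκ'.exists_ball
  have hax : ∀ᶠ w in 𝓝 wbar, ∀ i, (¬ ∃ j', j' ≠ i ∧ ImposesEq R ρ wbar j' i) →
      κ i (Function.update wbar i (w i)) = κ' i (Function.update wbar i (w i)) := by
    simp only [eventually_all]
    intro i hi
    have hi' : ∀ α, i ∉ A α := not_exists.1 (mt (hblock i).2 hi)
    have ht : Tendsto (fun w : Fin n → ℝ => w i) (𝓝 wbar) (𝓝 (wbar i)) :=
      (continuous_apply i).tendsto wbar
    filter_upwards [ht.eventually (hκi.1 i hi'), ht.eventually (hκi'.1 i hi')] with w e e'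
    rw [e, e']
  obtain ⟨r₃, hr₃, hax⟩ := Metric.eventually_nhds_iff_ball.1 hax
  set r₀ := min (min r r₁) (min r₂ r₃) with hr₀
  have hr₀0 : 0 < r₀ := lt_min (lt_min hr hr₁) (lt_min hr₂ hr₃)
  have hb := Metric.ball_subset_ball (x := wbar) ((min_le_left _ _).trans (min_le_left _ _) : r₀ ≤ r)
  have hb₁ := Metric.ball_subset_ball (x := wbar)
    ((min_le_left _ _).trans (min_le_right _ _) : r₀ ≤ r₁)
  have hb₂ := Metric.ball_subset_ball (x := wbar)
    ((min_le_right _ _).trans (min_le_left _ _) : r₀ ≤ r₂)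
  have hb₃ := Metric.ball_subset_ball (x := wbar)
    ((min_le_right _ _).trans (min_le_right _ _) : r₀ ≤ r₃)
  have hC := fun j => (hsol.contDiffOn j).mono hb₁
  have hC' := fun j => (hsol'.contDiffOn j).mono hb₂
  have := eventually_eq_zero_of_lambda_system (δ := fun j w => κ j w - κ' j w)
    (c := fun j i => connZ R ρ j j i) (P := fun j => ∃ j', j' ≠ j ∧ ImposesEq R ρ wbar j' j) hr₀0
    (fun j i => (hs.continuousOn_coeff j i).mono hb) (fun j => (hC j).sub (hC' j))
    (fun i j hadm w hw => by
      rw [partialD_sub Metric.isOpen_ball (hC j) (hC' j) i hw]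
      by_cases hij : i = j
      · subst hij
        have hr := equivalence_imposesEq (R := R) (ρ := ρ) (wbar := wbar).refl i
        rw [hsol.partialD_eq_zero Metric.isOpen_ball heq hr hadm (hb₁ hw),
          hsol'.partialD_eq_zero Metric.isOpen_ball heq' hr hadm (hb₂ hw)]
        ring
      · rw [hsol.differential i j hij w (hb₁ hw), hsol'.differential i j hij w (hb₂ hw)]
        ring)
    (fun j hj => by
      obtain ⟨α, hα⟩ := (hblock j).1 hj
      rw [hκi.2 α j hα, hκi'.2 α j hα, sub_self])
    (fun j hj w hw => sub_eq_zero.2 (hax w (hb₃ hw) j hj))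
  exact this.mono fun w hw i => sub_eq_zero.1 (hw i)
end

/-! ### The main theorem -/

theorem mainTheorem1 {n : ℕ} (R : Fin n → (Fin n → ℝ) → (Fin n → ℝ))
    (Ω : Set (Fin n → ℝ)) (hΩ : IsOpen Ω)
    (hR : IsC1FrameOn R Ω) (hrich : IsRichOn R Ω)
    (ρ : OpenPartialHomeomorph (Fin n → ℝ) (Fin n → ℝ))
    (hρ : IsNormalizedRiemannInvariants R Ω ρ)
    (wbar : Fin n → ℝ) (hwbar : wbar ∈ ρ.target)
    -- nondegeneracy of the base point
    (hZ : ∀ i j k, i ≠ j → k ≠ i → k ≠ j → ZeroOrDenselyNonzeroAt (connZ R ρ k i j) wbar)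
    (hZ' : ∀ i j k, i ≠ j → k ≠ i → j ≠ k → ImposesEq R ρ wbar j k →
      ZeroOrDenselyNonzeroAt (fun w => connZ R ρ j j i w - connZ R ρ k k i w) wbar)
    -- some `Z^k_{ij}` with distinct indices is not identically zero near `wbar`
    (hne : ∃ i j k, i ≠ j ∧ k ≠ i ∧ k ≠ j ∧ ¬ ∀ᶠ w in 𝓝 wbar, connZ R ρ k i j w = 0) :
    ∃ (s₀ s₁ : ℕ) (A : Fin s₀ → Finset (Fin n)),
      1 ≤ s₀ ∧
      (∀ α, 2 ≤ (A α).card) ∧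
      (∀ α β, α ≠ β → Disjoint (A α) (A β)) ∧
      s₁ + ∑ α, (A α).card = n ∧
      -- exactly the equalities within the `A α` are imposed
      (∀ i j, i ≠ j → (ImposesEq R ρ wbar i j ↔ ∃ α, i ∈ A α ∧ j ∈ A α)) ∧
      -- existence and uniqueness of the local solution with given data
      (∀ (φ : Fin n → ℝ → ℝ) (h : Fin s₀ → ℝ),
        (∀ i, (∀ α, i ∉ A α) → ContDiffAt ℝ 1 (φ i) (wbar i)) →
        (∃ κ, IsLocalSolution R ρ wbar κ ∧ HasInitialData A φ h wbar κ) ∧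
        (∀ κ κ', IsLocalSolution R ρ wbar κ → HasInitialData A φ h wbar κ →
          IsLocalSolution R ρ wbar κ' → HasInitialData A φ h wbar κ' →
          ∀ᶠ w in 𝓝 wbar, ∀ i, κ i w = κ' i w)) ∧
      -- common values do not depend on the coordinates of their own block
      (∀ κ, IsLocalSolution R ρ wbar κ → ∀ᶠ w in 𝓝 wbar, ∀ α, ∀ i ∈ A α, ∀ j ∈ A α,
        partialD i (κ j) w = 0) ∧
      -- maximal numbers of simple and of non-simple eigenvalues
      (∀ κ, IsLocalSolution R ρ wbar κ → ∀ᶠ w in 𝓝 wbar,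
        numSimple κ w ≤ s₁ ∧ (numSimple κ w = s₁ → numNonSimple κ w ≤ s₀)) ∧
      (∃ κ, IsLocalSolution R ρ wbar κ ∧ ∀ᶠ w in 𝓝 wbar,
        numSimple κ w = s₁ ∧ numNonSimple κ w = s₀) := by
  classical
  have hsim : Equivalence (ImposesEq R ρ wbar) := equivalence_imposesEq
  obtain ⟨r, hr, hball, hZ0, hs⟩ := exists_isCompatibleSystem hΩ hR hρ hwbar hZ hZ'
  obtain ⟨s₀, A, h2, hdis, hA⟩ := exists_nontrivial_classes hsim
  have hclass : ∀ κ, IsLocalSolution R ρ wbar κ →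
      ∀ᶠ w in 𝓝 wbar, ∀ α, ∀ i ∈ A α, ∀ j ∈ A α, κ i w = κ j w := by
    intro κ hκ
    simp only [eventually_all]
    exact fun α i hi j hj => imposesEq_of_mem_class hA hi hj κ hκ
  have hexist : ∀ (φ : Fin n → ℝ → ℝ) (h : Fin s₀ → ℝ),
      (∀ i, (∀ α, i ∉ A α) → ContDiffAt ℝ 1 (φ i) (wbar i)) →
      ∃ κ, IsLocalSolution R ρ wbar κ ∧ HasInitialData A φ h wbar κ := fun φ h hφ =>
    exists_localSolution_hasInitialData hr hball hZ0 hs h2 hdis hA hφ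
  have hcard : (Finset.univ.biUnion A).card = ∑ α, (A α).card :=
    Finset.card_biUnion fun α _ β _ hαβ => hdis α β hαβ
  refine ⟨s₀, (Finset.univ.biUnion A)ᶜ.card, A, ?_, h2, hdis, ?_, hA, fun φ h hφ =>
    ⟨hexist φ h hφ, fun κ κ' hκ hκi hκ' hκi' =>
      localSolution_unique hr hs h2 hA hκ hκi hκ' hκi'⟩, fun κ hκ => ?_, fun κ hκ => ?_, ?_⟩
  · obtain ⟨i, j, k, hij, hki, hkj, hnz⟩ := hne
    -- A coefficient with distinct indices that is not identically zero forces an imposed equality,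
    -- hence at least one block.
    have hij' : ImposesEq R ρ wbar i j := by
      by_contra hcon
      exact hnz (eventually_connZ_eq_zero hΩ hR hρ (hZ i j k hij hki hkj) hki hkj hcon)
    obtain ⟨α, -⟩ := (hA i j hij).1 hij'
    exact α.pos
  · rw [← hcard, Finset.card_compl_add_card, Fintype.card_fin]
  · obtain ⟨r', hr', -, hsol, heq⟩ := hκ.exists_ball
    filter_upwards [Metric.ball_mem_nhds wbar hr'] with w hw α i hi j hj
    exact hsol.partialD_eq_zero Metric.isOpen_ball heq (imposesEq_of_mem_class hA hi hj)
      (Or.inr ((mem_class_iff h2 hA j).2 ⟨α, hj⟩)) hw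
  · exact (hclass κ hκ).mono fun w hw => ⟨numSimple_le h2 hw, numNonSimple_le h2 hw⟩
  -- The constants i < n for singletons and n + α for blocks are pairwise different across classes
  -- at the base point; continuity keeps the values apart nearby.
  · obtain ⟨κ, hκ, hκi⟩ := hexist (fun i _ => (i.val : ℝ)) (fun α => (n + α.val : ℝ))
      fun i _ => contDiffAt_const
    have hval : ∀ i, (∀ α, i ∉ A α) → κ i wbar = i.val := by
      intro i hi
      simpa using (hκi.1 i hi).self_of_nhds
    have hne' : ∀ i j, i ≠ j → (¬ ∃ α, i ∈ A α ∧ j ∈ A α) → κ i wbar ≠ κ j wbar := by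
      intro i j hij hnot
      have hlt : ∀ (i : Fin n) (α : Fin s₀), (i.val : ℝ) < n + α.val := fun i α => by
        exact_mod_cast i.isLt.trans_le (Nat.le_add_right n α.val)
      by_cases hi : ∀ α, i ∉ A α
      · rw [hval i hi]
        by_cases hj : ∀ α, j ∉ A α
        · rw [hval j hj]
          exact fun e => hij (Fin.ext (by exact_mod_cast e))
        · push Not at hj
          obtain ⟨β, hβ⟩ := hj
          rw [hκi.2 β j hβ]
          exact (hlt i β).ne
      · push Not at hi
        obtain ⟨α, hα⟩ := hi
        rw [hκi.2 α i hα]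
        by_cases hj : ∀ α, j ∉ A α
        · rw [hval j hj]
          exact (hlt j α).ne'
        · push Not at hj
          obtain ⟨β, hβ⟩ := hj
          rw [hκi.2 β j hβ]
          intro e
          have : α = β := Fin.ext (by exact_mod_cast add_left_cancel e)
          exact hnot ⟨α, hα, this ▸ hβ⟩
    have hne'' : ∀ᶠ w in 𝓝 wbar, ∀ i j, i ≠ j → (¬ ∃ α, i ∈ A α ∧ j ∈ A α) →
        κ i w ≠ κ j w := by
      simp only [eventually_all]
      intro i j hij hnot
      obtain ⟨U, hU, hwU, -, hsol⟩ := hκ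
      have hc : ∀ i, ContinuousAt (κ i) wbar := fun i =>
        (hsol.contDiffOn i).continuousOn.continuousAt (hU.mem_nhds hwU)
      exact (((hc i).sub (hc j)).eventually_ne (sub_ne_zero.2 (hne' i j hij hnot))).mono
          fun _ => sub_ne_zero.1
    refine ⟨κ, hκ, ?_⟩
    filter_upwards [hclass κ hκ, hne''] with w h3 h4
    exact ⟨numSimple_eq h2 h3 h4, numNonSimple_eq h2 hdis h3 h4⟩
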